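/- Fix $L>0$. Let $\|\cdot\|$ be the norm of $L^2_{per}[0,L]$ (complex valued), $\|u\|_{H^1}^2=\|u\|^2+\|u_x\|^2$, $\|u\|_{H^2}^2=\|u\|^2+\|u_{xx}\|^2$, let $P_m$ be the orthogonal projection of $L^2_{per}$ onto $H_m=\mathrm{span}\{e^{ikx2\pi/L}:|k|\le m\}$, let $X=C^1_b(\mathbb R,H_m)$ with $|v|_X=\sup_s\|v(s)\|+\sup_s\|v_s(s)\|$, and let $Y=C_b(\mathbb R,H^2_{per})$. For $\gamma>0$, $\mu\ge 0$, $m\in\{0,1,2,\dots\}$, $f\in L^2_{per}$ (independent of $s$) and $v\in X$, a bounded solution on $\mathbb R$ of $$ i w_s+w_{xx}+|w|^2w+i\gamma w=f-i\mu\,[P_m w-v] \qquad (3.1)$$ with $L$-periodic boundary conditions is a $w\in Y$ that is differentiable in $s$ with values in $L^2_{per}$ and satisfies (3.1) in $L^2_{per}$ for every $s\in\mathbb R$. For $c>0$ write $F=\|f\|$, $V=|v|_X$ and, for $R,S\ge 0$ and $0<\xi<1$, $$k_1(R)=6\gamma FR+6\mu\gamma VR+\tfrac{\mu^2c^2R^6}{\gamma}+2\mu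 FR+2\mu^2VR+2\mu VR,$$ $$k_2(\xi,R)=\tfrac{c^2R^6}{16\xi}+\tfrac12cR^4+2FR+2\mu VR+(1-\xi)R^2,\qquad r_1(R)=\sqrt{\tfrac{28}{3}k_2(\tfrac17,R)+\tfrac{7}{3\gamma}k_1(R)},$$ $$k_5(R,S)=\tfrac{c\,(R^{1/2}S^2)^4}{\gamma^3}+\tfrac{c\,\{RS[R^2S+(\gamma+\mu)R+\mu V+F]\}^2}{\gamma},$$ $$k_6(R,S)=2k_5(R,S)+\tfrac{c\mu^2V^2}{\gamma}+c\gamma\mu^2V^2+c\gamma F^2+c\mu(R^2S)^2+c\mu F^2+c\mu^3V^2,$$ $$k_7(R,S)=c\,(RS^3+F^2+\mu^2V^2),\qquad r_2(R,S)=\sqrt{\tfrac{4}{\gamma}k_6(R,S)+4k_7(R,S)}+R .$$ Put $\tilde{\mathcal R}_0=\frac{F}{\gamma}+\frac{\mu^{1/2}}{\gamma^{1/2}}V$, $\ \tilde{\tilde{\mathcal R}}_1=r_1(\tilde{\mathcal R}_0)$, $$\mathcal R_0=\tfrac{F}{\sqrt{\gamma(\gamma+\mu)}}+\sqrt{\tfrac{\mu}{\gamma+\mu}}\,V+\sqrt{\tfrac{\mu}{\gamma+\mu}},\qquad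 \tilde{\mathcal R}_1=r_1(\mathcal R_0),\qquad \tilde{\mathcal R}_2=r_2(\mathcal R_0,\tilde{\mathcal R}_1),$$ $$K_1=6\gamma F\mathcal R_0+6\mu\gamma V\mathcal R_0+\mu(c^2\mathcal R_0^6+\mathcal R_0^2)+2\mu+2\mu F\mathcal R_0+2\mu V\mathcal R_0,\qquad K_2=k_2(\tfrac13,\mathcal R_0),$$ $$\mathcal R_1=\sqrt{\tfrac{(\frac32\mu+6\gamma)K_2+K_1}{\gamma+\mu}},\qquad \mathcal R_2=r_2(\mathcal R_0,\mathcal R_1),\qquad \mathcal R'=\mathcal R_2+c\mathcal R_0^2\mathcal R_1+(\gamma+\mu)\mathcal R_0+F+\mu V .$$ Theorem 4.2. There is a constant $c>0$, depending only on $L$, such that the following holds. Let $\gamma,\mu,m,f,v$ be as above, and let $w$ be any bounded solution of (3.1) on $\mathbb R$. If $m$ is large enough that $$\max\Big\{\frac{\tilde{\tilde{\mathcal R}}_1L}{2\pi(m+1)},\ \frac{\tilde{\mathcal R}_2L}{2\pi(m+1)}\Big\}\le 1,$$ then for all $s\in\mathbb R$ $$\|w(s)\|\le\mathcal R_0,\qquad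 \|w(s)\|_{H^1}\le\mathcal R_1,\qquad \|w(s)\|_{H^2}\le\mathcal R_2,\qquad \|w_s(s)\|\le\mathcal R' .$$ Moreover, for fixed $\gamma>0$, $F\ge0$ and $V\ge0$, as $\mu\to\infty$, $\mathcal R_0=O(1)$, $\mathcal R_1=O(\mu^{1/2})$, $\mathcal R_2=O(\mu^2)$ and $\mathcal R'=O(\mu^2)$. -/

import Mathlib

open MeasureTheory Filter Topology Asymptotics
open scoped ContDiff

namespace NLS

noncomputable section

/-! ### Periodic function spaces -/

/-- `L²_per[0, L]`: square-integrable complex functions on the circle `ℝ / Lℤ`, whose measure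
`volume` has total mass `L`, so that the norm is the one of `L²[0, L]`. -/
abbrev L2per (L : ℝ) [Fact (0 < L)] : Type :=
  Lp ℂ 2 (volume : Measure (AddCircle L))

/-- `g` is the weak derivative of `u` in the class of `L`-periodic functions: the test functions
are the smooth `L`-periodic functions on the line, and the integrals are over one period. -/
def HasWeakDeriv {L : ℝ} [Fact (0 < L)] (u g : L2per L) : Prop :=
  ∀ φ : ℝ → ℂ, ContDiff ℝ ∞ φ → Function.Periodic φ L →
    ∫ x in (0 : ℝ)..L, u (x : AddCircle L) * deriv φ x =
      -∫ x in (0 : ℝ)..L, g (x : AddCircle L) * φ x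

open Classical in
/-- The weak derivative of `u` (and `0` if `u` has no square-integrable weak derivative). -/
def weakDeriv {L : ℝ} [Fact (0 < L)] (u : L2per L) : L2per L :=
  if h : ∃ g : L2per L, HasWeakDeriv u g then h.choose else 0

/-- Membership in `H²_per`. -/
def MemH2 {L : ℝ} [Fact (0 < L)] (u : L2per L) : Prop :=
  ∃ g h : L2per L, HasWeakDeriv u g ∧ HasWeakDeriv g h

/-- `‖u‖_{H¹}`, where `‖u‖_{H¹}² = ‖u‖² + ‖u_x‖²`. -/
def h1Norm {L : ℝ} [Fact (0 < L)] (u : L2per L) : ℝ :=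
  √(‖u‖ ^ 2 + ‖weakDeriv u‖ ^ 2)

/-- `‖u‖_{H²}`, where `‖u‖_{H²}² = ‖u‖² + ‖u_xx‖²`. -/
def h2Norm {L : ℝ} [Fact (0 < L)] (u : L2per L) : ℝ :=
  √(‖u‖ ^ 2 + ‖weakDeriv (weakDeriv u)‖ ^ 2)

/-! ### Fourier modes -/

/-- The function `x ↦ exp (i k x 2π / L)` as an element of `L²_per`. -/
def mode (L : ℝ) [Fact (0 < L)] (k : ℤ) : L2per L :=
  ContinuousMap.toLp (E := ℂ) 2 (volume : Measure (AddCircle L)) ℂ (fourier k)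

/-- `H_m = span {exp (i k x 2π / L) : |k| ≤ m}`. -/
def Hm (L : ℝ) [Fact (0 < L)] (m : ℕ) : Submodule ℂ (L2per L) :=
  Submodule.span ℂ (mode L '' {k : ℤ | |k| ≤ (m : ℤ)})

instance finiteDimensional_Hm (L : ℝ) [Fact (0 < L)] (m : ℕ) :
    FiniteDimensional ℂ (Hm L m) := by
  have h : {k : ℤ | |k| ≤ (m : ℤ)}.Finite :=
    (Set.finite_Icc (-(m : ℤ)) m).subset fun k hk => abs_le.mp hk
  exact FiniteDimensional.span_of_finite ℂ (h.image _)

/-- `P_m`, the orthogonal projection of `L²_per` onto `H_m`. -/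
def Pm {L : ℝ} [Fact (0 < L)] (m : ℕ) : L2per L →L[ℂ] L2per L :=
  (Hm L m).starProjection

/-! ### The trajectory space `X` and bounded solutions -/

/-- `v ∈ X = C_b¹(ℝ, P_m H²)`. (`P_m H² = H_m` is finite-dimensional, so that it does not matter
in which norm the derivative is taken.) -/
structure MemX {L : ℝ} [Fact (0 < L)] (m : ℕ) (v : ℝ → L2per L) : Prop where
  mem_Hm : ∀ s, v s ∈ Hm L m
  contDiff : ContDiff ℝ 1 v
  bounded : ∃ M : ℝ, ∀ s, ‖v s‖ ≤ M
  bounded_deriv : ∃ M : ℝ, ∀ s, ‖deriv v s‖ ≤ M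

/-- `|v|_X = sup_s ‖v(s)‖ + sup_s ‖v_s(s)‖`. -/
def xNorm {L : ℝ} [Fact (0 < L)] (v : ℝ → L2per L) : ℝ :=
  (⨆ s : ℝ, ‖v s‖) + ⨆ s : ℝ, ‖deriv v s‖

/-- `w ∈ Y = C_b(ℝ, H²_per)`. -/
structure MemY {L : ℝ} [Fact (0 < L)] (w : ℝ → L2per L) : Prop where
  memH2 : ∀ s, MemH2 (w s)
  continuous : ∀ s₀, Tendsto (fun s => h2Norm (w s - w s₀)) (𝓝 s₀) (𝓝 0)
  bounded : ∃ M : ℝ, ∀ s, h2Norm (w s) ≤ M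

/-- `w` is a bounded solution on `ℝ` of
`i w_s + w_xx + |w|² w + i γ w = f - i μ (P_m w - v)`: it belongs to `Y`, it is differentiable
in `s` as an `L²_per`-valued function, and the equation holds for every `s` and almost every `x`. -/
structure IsBoundedSolution {L : ℝ} [Fact (0 < L)] (γ μ : ℝ) (m : ℕ) (f : L2per L)
    (v w : ℝ → L2per L) : Prop where
  memY : MemY w
  differentiable : Differentiable ℝ w
  equation : ∀ s : ℝ, ∀ᵐ x : AddCircle L,
    Complex.I * (deriv w s) x + (weakDeriv (weakDeriv (w s))) x
        + ((‖(w s) x‖ ^ 2 : ℝ) : ℂ) * (w s) x + Complex.I * (γ : ℂ) * (w s) x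
      = f x - Complex.I * (μ : ℂ) * ((Pm m (w s)) x - (v s) x)

/-! ### The bounding expressions

`c` is the constant of the estimates, `F` stands for `‖f‖` and `V` for `|v|_X`. -/

/-- `K₁`-type expression built from an `L²` bound `R`; gives `K̃̃₁` and `K̃₁`. -/
def K1Of (c γ F V μ R : ℝ) : ℝ :=
  6 * γ * F * R + 6 * μ * γ * V * R + μ ^ 2 * c ^ 2 * R ^ 6 / γ + 2 * μ * F * R
    + 2 * μ ^ 2 * V * R + 2 * μ * V * R

/-- `K₂`-type expression built from an `L²` bound `R` and `ξ`; gives `K̃̃₂`, `K̃₂`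
(for `ξ = 1/7`) and `K₂` (for `ξ = 1/3`). -/
def K2Of (ξ c F V μ R : ℝ) : ℝ :=
  c ^ 2 * R ^ 6 / (16 * ξ) + 1 / 2 * c * R ^ 4 + 2 * F * R + 2 * μ * V * R + (1 - ξ) * R ^ 2

/-- `H¹` bound built from an `L²` bound `R`. -/
def R1Of (c γ F V μ R : ℝ) : ℝ :=
  √(28 / 3 * K2Of (1 / 7) c F V μ R + 7 / (3 * γ) * K1Of c γ F V μ R)

/-- `K₅`-type expression built from an `L²` bound `R` and an `H¹` bound `S`. -/
def K5Of (c γ F V μ R S : ℝ) : ℝ :=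
  c * (√R * S ^ 2) ^ 4 / γ ^ 3
    + c * (R * S * (R ^ 2 * S + (γ + μ) * R + μ * V + F)) ^ 2 / γ

/-- `K₆`-type expression built from an `L²` bound `R` and an `H¹` bound `S`. -/
def K6Of (c γ F V μ R S : ℝ) : ℝ :=
  2 * K5Of c γ F V μ R S + c * μ ^ 2 * V ^ 2 / γ + c * γ * μ ^ 2 * V ^ 2 + c * γ * F ^ 2
    + c * μ * (R ^ 2 * S) ^ 2 + c * μ * F ^ 2 + c * μ ^ 3 * V ^ 2

/-- `K₇`-type expression built from an `L²` bound `R` and an `H¹` bound `S`. -/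
def K7Of (c F V μ R S : ℝ) : ℝ :=
  c * (R * S ^ 3 + F ^ 2 + μ ^ 2 * V ^ 2)

/-- `H²` bound built from an `L²` bound `R` and an `H¹` bound `S`. -/
def R2Of (c γ F V μ R S : ℝ) : ℝ :=
  √(4 * K6Of c γ F V μ R S / γ + 4 * K7Of c F V μ R S) + R

/-- `R̃₀`. -/
def R0Tilde (γ F V μ : ℝ) : ℝ := F / γ + √μ / √γ * V

/-- `R̃̃₁`. -/
def R1TildeTilde (c γ F V μ : ℝ) : ℝ := R1Of c γ F V μ (R0Tilde γ F V μ)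

/-- `R₀`. -/
def R0 (γ F V μ : ℝ) : ℝ :=
  F / √(γ * (γ + μ)) + √(μ / (γ + μ)) * V + √(μ / (γ + μ))

/-- `R̃₁`. -/
def R1Tilde (c γ F V μ : ℝ) : ℝ := R1Of c γ F V μ (R0 γ F V μ)

/-- `R̃₂`. -/
def R2Tilde (c γ F V μ : ℝ) : ℝ := R2Of c γ F V μ (R0 γ F V μ) (R1Tilde c γ F V μ)

/-- `K₁`. -/
def K1 (c γ F V μ : ℝ) : ℝ :=
  6 * γ * F * R0 γ F V μ + 6 * μ * γ * V * R0 γ F V μ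
    + μ * (c ^ 2 * R0 γ F V μ ^ 6 + R0 γ F V μ ^ 2) + 2 * μ + 2 * μ * F * R0 γ F V μ
    + 2 * μ * V * R0 γ F V μ

/-- `K₂`. -/
def K2 (c γ F V μ : ℝ) : ℝ := K2Of (1 / 3) c F V μ (R0 γ F V μ)

/-- `R₁`. -/
def R1 (c γ F V μ : ℝ) : ℝ :=
  √(((3 / 2 * μ + 6 * γ) * K2 c γ F V μ + K1 c γ F V μ) / (γ + μ))

/-- `R₂`. -/
def R2 (c γ F V μ : ℝ) : ℝ := R2Of c γ F V μ (R0 γ F V μ) (R1 c γ F V μ)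

/-- `R'`. -/
def R' (c γ F V μ : ℝ) : ℝ :=
  R2 c γ F V μ + c * R0 γ F V μ ^ 2 * R1 c γ F V μ + (γ + μ) * R0 γ F V μ + F + μ * V

end

end NLS

/-!
Write `P = P_m`, `Q = 1 - P`, and let `Z = w_xx + |w|² w - f - i μ v` be the residual, so that the
equation reads `w_s = i Z - γ w - μ P w`. Every bound comes from a functional `Φ` of `w`, bounded
on the whole line, with `Φ' + a Φ ≤ b`; for such functionals `Φ ≤ b / a`
(`le_div_of_deriv_add_le`).

* `L²`: pairing the equation with `w` gives damping by `γ ‖w‖² + μ ‖P w‖²`. In general only `γ`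
  damps all of `w`, which gives `R0Tilde`; once `‖Q w‖ ≤ 1`, the damping rate is `γ + μ` up to the
  additional forcing `μ`, which gives `R0`.
* `H¹`: the Hamiltonian `energy` has the gradient `-2 Z`, so that `i Z` drops out of its balance
  and what remains is the pairing of `γ w + μ P w` with `Z`, and a term with `v_s`. The quartic
  part is absorbed by Agmon's inequality. Again there is a bound that uses `γ` only (`R1Of`) and a
  better one, `R1`, if the high modes of `w` and `w_x` are small.
* `H²`: formally `Z_s = i Z_xx + ...`, and `‖Z‖²` has a balance even though `Z` is merely in `L²`,
  because `i Z_xx` contributes nothing to any mode (`hasDerivAt_norm_sq_of_modes`). The derivative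
  of the cubic term leaves a term of the size `|w|² |w_xx|²`, which no damping could absorb; it is
  cancelled by the correction `Re ∫ w̄² w_x²` of `energyTwo`, up to terms that are of lower order in
  `w_xx`.

The bounds are chained in `IsBoundedSolution.bounds`. The bounds `R0Tilde` and `R1TildeTilde` and
the first condition on `m` give `‖Q w‖ ≤ 1`, hence `R0`, and then `R1Tilde`, and an `H²` bound in
terms of `R2Tilde`. The constant `estConst` exceeds the one that this `H²` estimate needs by a
factor; hence the second condition on `m` makes `‖Q w_x‖`, and with it `‖Q w‖`, small enough for
the better `H¹` bound `R1`. The bounds `R2` and `R'` follow from `R0` and `R1`.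

Weak derivatives are handled on the Fourier side (`IsDeriv`). Products are taken with the
continuous representative `rep u` of `u`, the sum of its Fourier series.
-/

namespace NLS

noncomputable section

set_option linter.unusedSectionVars false

variable {L : ℝ} [hL : Fact (0 < L)]

/-! ### Fourier coefficients and weak derivatives -/

lemma inner_mode_mode (k l : ℤ) :
    inner ℂ (mode L k) (mode L l) = if k = l then (L : ℂ) else 0 := by
  have h := (orthonormal_iff_ite.mp (@orthonormal_fourier L hL)) k l
  have h2 : inner ℂ (mode L k) (mode L l)
      = (L : ℂ) * inner ℂ (@fourierLp L hL 2 _ k) (@fourierLp L hL 2 _ l) := by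
    unfold mode fourierLp
    rw [ContinuousMap.inner_toLp, ContinuousMap.inner_toLp,
      AddCircle.volume_eq_smul_haarAddCircle, integral_smul_measure,
      ENNReal.toReal_ofReal hL.out.le]
    simp
  rw [h2, h]
  split_ifs <;> simp

/-- The normalized mode `L^{-1/2} exp (i k x 2π / L)`, as a continuous function. -/
def expC (L : ℝ) [Fact (0 < L)] (k : ℤ) : C(AddCircle L, ℂ) :=
  (((√L)⁻¹ : ℝ) : ℂ) • fourier k

/-- The embedding of the continuous functions into `L²_per`. -/
def toL2 : C(AddCircle L, ℂ) →L[ℂ] L2per L :=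
  ContinuousMap.toLp (E := ℂ) 2 (volume : Measure (AddCircle L)) ℂ

lemma coeFn_toL2 (F : C(AddCircle L, ℂ)) : toL2 F =ᵐ[volume] F :=
  ContinuousMap.coeFn_toLp volume F

lemma toL2_injective : Function.Injective (toL2 (L := L)) :=
  ContinuousMap.toLp_injective volume

lemma toL2_expC (k : ℤ) : toL2 (expC L k) = (((√L)⁻¹ : ℝ) : ℂ) • mode L k := by
  simp only [expC, map_smul]; rfl

lemma orthonormal_expC : Orthonormal ℂ (fun k : ℤ => toL2 (expC L k)) := by
  rw [orthonormal_iff_ite]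
  intro k l
  simp only [toL2_expC]
  rw [inner_smul_left, inner_smul_right, inner_mode_mode]
  have hL0 := hL.out
  split_ifs
  · rw [Complex.conj_ofReal]
    rw [← mul_assoc, ← Complex.ofReal_mul, ← Complex.ofReal_mul, ← mul_inv,
      Real.mul_self_sqrt hL0.le, inv_mul_cancel₀ hL0.ne']
    simp
  · simp

lemma span_expC : ⊤ ≤ (Submodule.span ℂ
    (Set.range fun k : ℤ => toL2 (expC L k))).topologicalClosure := by
  have h : (Submodule.span ℂ (Set.range (mode L))).topologicalClosure = ⊤ := by
    have key := (ContinuousMap.toLp_denseRange ℂ (volume : Measure (AddCircle L)) ℂ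
            (p := 2) (by simp)).topologicalClosure_map_submodule
        (span_fourier_closure_eq_top (T := L))
    rw [Submodule.map_span, ← Set.range_comp] at key
    exact key
  rw [← h]
  apply Submodule.topologicalClosure_mono
  rw [Submodule.span_le]
  rintro _ ⟨k, rfl⟩
  have hs : √L ≠ 0 := (Real.sqrt_pos.mpr hL.out).ne'
  have : mode L k = ((√L : ℝ) : ℂ) • toL2 (expC L k) := by
    rw [toL2_expC, smul_smul, ← Complex.ofReal_mul, mul_inv_cancel₀ hs]; simp
  rw [this]
  exact Submodule.smul_mem _ _ (Submodule.subset_span ⟨k, rfl⟩)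

/-- The Hilbert basis of `L²_per` formed by the normalized modes. -/
def modeBasis (L : ℝ) [Fact (0 < L)] : HilbertBasis ℤ ℂ (L2per L) :=
  HilbertBasis.mk orthonormal_expC span_expC

lemma modeBasis_apply (k : ℤ) : modeBasis L k = toL2 (expC L k) := by
  unfold modeBasis; rw [HilbertBasis.coe_mk]

/-- The `k`-th Fourier coefficient, with respect to the normalized modes. -/
def coef (u : L2per L) (k : ℤ) : ℂ := inner ℂ (modeBasis L k) u

lemma coef_add (u v : L2per L) (k : ℤ) : coef (u + v) k = coef u k + coef v k := inner_add_right _ _ _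
lemma coef_sub (u v : L2per L) (k : ℤ) : coef (u - v) k = coef u k - coef v k := inner_sub_right _ _ _
lemma coef_smul (a : ℂ) (u : L2per L) (k : ℤ) : coef (a • u) k = a * coef u k := inner_smul_right _ _ _

lemma ext_coef {u v : L2per L} (h : ∀ k, coef u k = coef v k) : u = v := by
  apply (modeBasis L).repr.injective
  ext k
  rw [HilbertBasis.repr_apply_apply, HilbertBasis.repr_apply_apply]
  exact h k

lemma hasSum_inner (u v : L2per L) :
    HasSum (fun k => starRingEnd ℂ (coef u k) * coef v k) (inner ℂ u v) := by
  have := (modeBasis L).hasSum_inner_mul_inner u v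
  simpa [coef, inner_conj_symm] using this

lemma hasSum_norm_sq (u : L2per L) : HasSum (fun k => ‖coef u k‖ ^ 2) (‖u‖ ^ 2) := by
  have h := Complex.hasSum_re (hasSum_inner u u)
  convert h using 1
  · ext k
    rw [mul_comm, Complex.mul_conj, Complex.normSq_eq_norm_sq, Complex.ofReal_re]
  · rw [inner_self_eq_norm_sq_to_K]; norm_cast

lemma hasSum_modes (u : L2per L) : HasSum (fun k => coef u k • toL2 (expC L k)) u := by
  have := (modeBasis L).hasSum_repr u
  simpa [HilbertBasis.repr_apply_apply, modeBasis_apply, coef] using this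

/-- The symbol `2 π i k / L` of the derivative. -/
def symb (L : ℝ) (k : ℤ) : ℂ := 2 * Real.pi * Complex.I * k / L

lemma conj_symb (k : ℤ) : starRingEnd ℂ (symb L k) = -symb L k := by
  have : starRingEnd ℂ 2 = 2 := Complex.conj_ofNat 2
  simp [symb, this, neg_div]

lemma norm_symb (k : ℤ) : ‖symb L k‖ = 2 * Real.pi * |(k : ℝ)| / L := by
  have := hL.out
  simp [symb, abs_of_pos Real.pi_pos, abs_of_pos this]

/-- `g` is the derivative of `u` on the Fourier side: `ĝ(k) = (2 π i k / L) û(k)`. -/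
def IsDeriv (u g : L2per L) : Prop := ∀ k, coef g k = symb L k * coef u k

/-- The continuous function `F` on the circle is continuously differentiable, with derivative
`F'`. -/
def IsC1 (F F' : C(AddCircle L, ℂ)) : Prop :=
  ∀ x : ℝ, HasDerivAt (fun y : ℝ => F (y : AddCircle L)) (F' (x : AddCircle L)) x

lemma IsC1.mul {F F' G G' : C(AddCircle L, ℂ)} (hF : IsC1 F F') (hG : IsC1 G G') :
    IsC1 (F * G) (F' * G + F * G') := fun x => by
  exact (hF x).mul (hG x)

lemma IsC1.smul {F F' : C(AddCircle L, ℂ)} (hF : IsC1 F F') (a : ℂ) :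
    IsC1 (a • F) (a • F') := fun x => by
  exact (hF x).const_smul a

lemma IsC1.star {F F' : C(AddCircle L, ℂ)} (hF : IsC1 F F') : IsC1 (star F) (star F') := fun x => by
  simpa using (hF x).star

lemma isC1_expC (k : ℤ) : IsC1 (expC L k) (symb L k • expC L k) := fun x => by
  have := (hasDerivAt_fourier L k x).const_smul (((√L)⁻¹ : ℝ) : ℂ)
  refine this.congr_deriv ?_
  simp [expC, symb]; ring

/-- Integration by parts for two continuously differentiable functions on the circle. -/
lemma IsC1.integral_mul {F F' G G' : C(AddCircle L, ℂ)} (hF : IsC1 F F') (hG : IsC1 G G') :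
    ∫ x : AddCircle L, F x * G' x = -∫ x : AddCircle L, F' x * G x := by
  rw [← AddCircle.intervalIntegral_preimage L 0, ← AddCircle.intervalIntegral_preimage L 0]
  have hc : ∀ H : C(AddCircle L, ℂ), IntervalIntegrable (fun x : ℝ => H (x : AddCircle L)) volume 0 (0 + L) :=
    fun H => (H.continuous.comp (AddCircle.continuous_mk' L)).intervalIntegrable _ _
  have := intervalIntegral.integral_mul_deriv_eq_deriv_mul (a := 0) (b := 0 + L)
    (u := fun x : ℝ => F (x : AddCircle L)) (v := fun x : ℝ => G (x : AddCircle L))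
    (fun x _ => hF x) (fun x _ => hG x) (hc F') (hc G')
  rw [this]
  have hper : ((0 + L : ℝ) : AddCircle L) = ((0 : ℝ) : AddCircle L) := by simp
  rw [hper]; ring

lemma inner_toL2 (F : C(AddCircle L, ℂ)) (u : L2per L) :
    inner ℂ (toL2 F) u = ∫ x : AddCircle L, u x * starRingEnd ℂ (F x) := by
  rw [MeasureTheory.L2.inner_def]
  apply integral_congr_ae
  filter_upwards [coeFn_toL2 F] with x hx
  rw [hx]; rfl

lemma inner_toL2_toL2 (F G : C(AddCircle L, ℂ)) :
    inner ℂ (toL2 F) (toL2 G) = ∫ x : AddCircle L, G x * starRingEnd ℂ (F x) :=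
  ContinuousMap.inner_toLp volume F G

lemma IsC1.isDeriv {F F' : C(AddCircle L, ℂ)} (hF : IsC1 F F') : IsDeriv (toL2 F) (toL2 F') := by
  intro k
  unfold coef
  rw [modeBasis_apply, inner_toL2_toL2, inner_toL2_toL2]
  have h := hF.integral_mul (isC1_expC k).star
  have h2 : (∫ x : AddCircle L, F x * (Star.star (symb L k • expC L k)) x)
      = -symb L k * ∫ x : AddCircle L, F x * starRingEnd ℂ (expC L k x) := by
    rw [← integral_const_mul]
    congr 1; ext x
    have := conj_symb (L := L) k
    simp only [ContinuousMap.star_apply, ContinuousMap.smul_apply, smul_eq_mul, star_mul',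
      RCLike.star_def, this]
    ring
  rw [h2] at h
  have h3 : (∫ x : AddCircle L, F' x * (Star.star (expC L k)) x)
    = ∫ x : AddCircle L, F' x * starRingEnd ℂ (expC L k x) := rfl
  rw [h3] at h
  linear_combination h

/-- Integration by parts, mode by mode. -/
lemma IsDeriv.inner_eq {u u' v v' : L2per L} (hu : IsDeriv u u') (hv : IsDeriv v v') :
    inner ℂ u' v = -inner ℂ u v' := by
  have h1 := hasSum_inner u' v
  have h2 := (hasSum_inner u v').neg
  have e : (fun k => starRingEnd ℂ (coef u' k) * coef v k)
      = fun k => -(starRingEnd ℂ (coef u k) * coef v' k) := by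
    ext k
    rw [hu k, hv k, map_mul, conj_symb]; ring
  rw [e] at h1
  exact h1.unique h2

/-- A periodic continuous function on the line as a function on the circle. -/
def liftC {φ : ℝ → ℂ} (hφ : Continuous φ) (hp : Function.Periodic φ L) : C(AddCircle L, ℂ) :=
  ⟨hp.lift, by
    apply continuous_quot_lift
    exact hφ⟩

lemma liftC_coe {φ : ℝ → ℂ} (hφ : Continuous φ) (hp : Function.Periodic φ L) (x : ℝ) :
    liftC hφ hp (x : AddCircle L) = φ x := hp.lift_coe x

lemma periodic_deriv {φ : ℝ → ℂ} (hp : Function.Periodic φ L) : Function.Periodic (deriv φ) L := by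
  intro x
  rw [← deriv_comp_add_const]
  congr 1
  ext y; exact hp y

/-- A derivative on the Fourier side is a weak derivative: test functions are continuously
differentiable on the circle, and integration by parts holds by Parseval's identity. -/
lemma IsDeriv.hasWeakDeriv {u g : L2per L} (h : IsDeriv u g) : HasWeakDeriv u g := by
  intro φ hφ hp
  have hd : Continuous (deriv φ) := hφ.continuous_deriv (by simp)
  set F := liftC hφ.continuous hp
  set F' := liftC hd (periodic_deriv hp)
  have hC : IsC1 F F' := fun x => by
    have h1 : (fun y : ℝ => F (y : AddCircle L)) = φ := by ext y; exact liftC_coe _ _ _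
    rw [h1, show F' (x : AddCircle L) = deriv φ x from liftC_coe _ _ _]
    exact (hφ.differentiable (by simp) x).hasDerivAt
  have key := hC.star.isDeriv.inner_eq h
  rw [inner_toL2, inner_toL2, ← AddCircle.intervalIntegral_preimage L 0,
    ← AddCircle.intervalIntegral_preimage L 0] at key
  simp only [zero_add, ContinuousMap.star_apply, RCLike.star_def, Complex.conj_conj] at key
  have e1 : ∀ x : ℝ, F (x : AddCircle L) = φ x := fun x => liftC_coe _ _ _
  have e2 : ∀ x : ℝ, F' (x : AddCircle L) = deriv φ x := fun x => liftC_coe _ _ _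
  simpa only [e1, e2] using key

/-- A weak derivative is a derivative on the Fourier side: test against the modes. -/
lemma HasWeakDeriv.isDeriv {u g : L2per L} (h : HasWeakDeriv u g) : IsDeriv u g := by
  intro k
  have hE := (isC1_expC (L := L) k).star
  have hper : ∀ G : C(AddCircle L, ℂ), Function.Periodic (fun x : ℝ => G (x : AddCircle L)) L := by
    intro G x; simp
  have hsm : ContDiff ℝ ∞ (fun x : ℝ => Star.star (expC L k) (x : AddCircle L)) := by
    have : (fun x : ℝ => Star.star (expC L k) (x : AddCircle L))
      = fun x : ℝ => (((√L)⁻¹ : ℝ) : ℂ) * Complex.exp (2 * Real.pi * Complex.I * (-k : ℤ) * x / L) := by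
      ext x
      rw [← fourier_coe_apply]
      simp [expC]
    rw [this]
    have h0 : ContDiff ℝ ∞ (fun x : ℝ => (x : ℂ)) := Complex.ofRealCLM.contDiff
    fun_prop
  have := h _ hsm (hper _)
  unfold coef
  rw [modeBasis_apply, inner_toL2, inner_toL2, ← AddCircle.intervalIntegral_preimage L 0,
    ← AddCircle.intervalIntegral_preimage L 0]
  simp only [zero_add]
  have hd : ∀ x : ℝ, deriv (fun x : ℝ => Star.star (expC L k) (x : AddCircle L)) x
      = -symb L k * starRingEnd ℂ (expC L k x) := by
    intro x
    rw [(hE x).deriv]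
    have := conj_symb (L := L) k
    simp only [ContinuousMap.star_apply, ContinuousMap.smul_apply, smul_eq_mul, star_mul',
      RCLike.star_def, this]
  simp only [hd] at this
  rw [← intervalIntegral.integral_const_mul]
  have h4 : ∀ x : ℝ, u (x : AddCircle L) * (-symb L k * starRingEnd ℂ (expC L k x))
      = - (symb L k * (u (x : AddCircle L) * starRingEnd ℂ (expC L k x))) := fun x => by ring
  simp only [h4, intervalIntegral.integral_neg] at this
  exact (neg_injective this).symm

lemma IsDeriv.unique {u g h : L2per L} (hg : IsDeriv u g) (hh : IsDeriv u h) : g = h :=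
  ext_coef fun k => by rw [hg k, hh k]

lemma IsDeriv.weakDeriv_eq {u g : L2per L} (hg : IsDeriv u g) : weakDeriv u = g := by
  have h : ∃ g : L2per L, HasWeakDeriv u g := ⟨g, hg.hasWeakDeriv⟩
  unfold weakDeriv
  rw [dif_pos h]
  exact IsDeriv.unique h.choose_spec.isDeriv hg

lemma IsDeriv.sub {u g v h : L2per L} (hu : IsDeriv u g) (hv : IsDeriv v h) :
    IsDeriv (u - v) (g - h) := fun k => by
  rw [coef_sub, coef_sub, hu k, hv k]; ring

lemma MemH2.isDeriv {u : L2per L} (hu : MemH2 u) :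
    IsDeriv u (weakDeriv u) ∧ IsDeriv (weakDeriv u) (weakDeriv (weakDeriv u)) := by
  obtain ⟨g, h, hg, hh⟩ := hu
  have e := hg.isDeriv.weakDeriv_eq
  subst e
  have e := hh.isDeriv.weakDeriv_eq
  subst e
  exact ⟨hg.isDeriv, hh.isDeriv⟩

lemma isDeriv_sub_of_memH2 {u v : L2per L} (hu : MemH2 u) (hv : MemH2 v) :
    weakDeriv (u - v) = weakDeriv u - weakDeriv v ∧
    weakDeriv (weakDeriv (u - v)) = weakDeriv (weakDeriv u) - weakDeriv (weakDeriv v) := by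
  have h1 := (hu.isDeriv.1.sub hv.isDeriv.1).weakDeriv_eq
  refine ⟨h1, ?_⟩
  rw [h1]
  exact (hu.isDeriv.2.sub hv.isDeriv.2).weakDeriv_eq

/-! ### Agmon's inequality -/

lemma norm_sq_toL2 (F : C(AddCircle L, ℂ)) : ‖toL2 F‖ ^ 2 = ∫ x : AddCircle L, ‖F x‖ ^ 2 := by
  have h := inner_toL2_toL2 F F
  rw [inner_self_eq_norm_sq_to_K] at h
  have h2 : ∀ x : AddCircle L, F x * starRingEnd ℂ (F x) = ((‖F x‖ ^ 2 : ℝ) : ℂ) := fun x => by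
    rw [Complex.mul_conj, Complex.normSq_eq_norm_sq]
  simp only [h2, integral_complex_ofReal] at h
  rw [← RCLike.ofReal_pow] at h
  exact Complex.ofReal_injective h

/-- The modulus of a continuous function. -/
def absC (F : C(AddCircle L, ℂ)) : C(AddCircle L, ℂ) :=
  ⟨fun x => ((‖F x‖ : ℝ) : ℂ), by fun_prop⟩

lemma norm_toL2_absC (F : C(AddCircle L, ℂ)) : ‖toL2 (absC F)‖ = ‖toL2 F‖ := by
  have : ‖toL2 (absC F)‖ ^ 2 = ‖toL2 F‖ ^ 2 := by
    rw [norm_sq_toL2, norm_sq_toL2]; simp [absC]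
  exact (sq_eq_sq₀ (norm_nonneg _) (norm_nonneg _)).mp this

lemma integrable_of_continuous {E : Type*} [NormedAddCommGroup E] {f : AddCircle L → E}
    (hf : Continuous f) : Integrable f :=
  hf.integrable_of_hasCompactSupport (HasCompactSupport.of_compactSpace f)

lemma integral_norm_mul_norm_le (F G : C(AddCircle L, ℂ)) :
    ∫ x : AddCircle L, ‖F x‖ * ‖G x‖ ≤ ‖toL2 F‖ * ‖toL2 G‖ := by
  have h := inner_toL2_toL2 (absC F) (absC G)
  have h2 : ∀ x : AddCircle L, absC G x * starRingEnd ℂ (absC F x) = ((‖F x‖ * ‖G x‖ : ℝ) : ℂ) :=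
    fun x => by simp [absC, mul_comm]
  simp only [h2, integral_complex_ofReal] at h
  have h3 := norm_inner_le_norm (𝕜 := ℂ) (toL2 (absC F)) (toL2 (absC G))
  rw [h, norm_toL2_absC, norm_toL2_absC, Complex.norm_real] at h3
  exact (le_abs_self _).trans h3

lemma exists_coe_eq (x : AddCircle L) : ∃ r ∈ Set.Icc (0 : ℝ) L, (r : AddCircle L) = x := by
  have h := AddCircle.coe_image_Icc_eq L 0
  have : x ∈ ((↑) : ℝ → AddCircle L) '' Set.Icc 0 (0 + L) := by rw [h]; trivial
  simpa using this

/-- Agmon's inequality for continuously differentiable functions. -/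
lemma IsC1.norm_sq_le {F F' : C(AddCircle L, ℂ)} (hF : IsC1 F F') :
    ‖F‖ ^ 2 ≤ ‖toL2 F‖ ^ 2 / L + 2 * ‖toL2 F‖ * ‖toL2 F'‖ := by
  have hL0 := hL.out
  have hcF : Continuous (fun y : ℝ => F (y : AddCircle L)) :=
    F.continuous.comp (AddCircle.continuous_mk' L)
  have hcF' : Continuous (fun y : ℝ => F' (y : AddCircle L)) :=
    F'.continuous.comp (AddCircle.continuous_mk' L)
  have hK : ∫ x in (0 : ℝ)..L, ‖F (x : AddCircle L)‖ * ‖F' (x : AddCircle L)‖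
      ≤ ‖toL2 F‖ * ‖toL2 F'‖ := by
    have := AddCircle.intervalIntegral_preimage L 0 (fun x => ‖F x‖ * ‖F' x‖)
    rw [zero_add] at this
    rw [this]
    exact integral_norm_mul_norm_le F F'
  -- the increment of `‖F‖²` between two points is controlled by `∫ ‖F‖ ‖F'‖`
  have h1 : ∀ x y : AddCircle L, ‖F x‖ ^ 2 ≤ ‖F y‖ ^ 2 + 2 * (‖toL2 F‖ * ‖toL2 F'‖) := by
    intro x y
    obtain ⟨a, ha, rfl⟩ := exists_coe_eq x
    obtain ⟨b, hb, rfl⟩ := exists_coe_eq y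
    have hci : Continuous (fun t : ℝ => 2 * inner ℝ (F (t : AddCircle L)) (F' (t : AddCircle L))) :=
      continuous_const.mul (hcF.inner hcF')
    have ftc := intervalIntegral.integral_eq_sub_of_hasDerivAt (a := b) (b := a)
      (f := fun t : ℝ => ‖F (t : AddCircle L)‖ ^ 2)
      (f' := fun t : ℝ => 2 * inner ℝ (F (t : AddCircle L)) (F' (t : AddCircle L)))
      (fun t _ => (hF t).norm_sq) (hci.intervalIntegrable _ _)
    have hb1 : ‖∫ t in b..a, 2 * inner ℝ (F (t : AddCircle L)) (F' (t : AddCircle L))‖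
        ≤ ∫ t in (0 : ℝ)..L, 2 * (‖F (t : AddCircle L)‖ * ‖F' (t : AddCircle L)‖) := by
      refine (intervalIntegral.norm_integral_le_integral_norm_uIoc).trans ?_
      rw [intervalIntegral.integral_of_le hL0.le]
      have hci2 : Continuous (fun t : ℝ => 2 * (‖F (t : AddCircle L)‖ * ‖F' (t : AddCircle L)‖)) :=
        continuous_const.mul (hcF.norm.mul hcF'.norm)
      have hsub : Set.uIoc b a ⊆ Set.Ioc 0 L := by
        rw [Set.uIoc]
        exact Set.Ioc_subset_Ioc (le_min hb.1 ha.1) (max_le hb.2 ha.2)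
      refine (setIntegral_mono_on (hci.norm.integrableOn_uIoc) hci2.integrableOn_uIoc
        measurableSet_uIoc (fun t _ => ?_)).trans
        (setIntegral_mono_set hci2.integrableOn_Ioc ?_ hsub.eventuallyLE)
      · rw [norm_mul, Real.norm_ofNat]
        gcongr
        exact norm_inner_le_norm _ _
      · exact Eventually.of_forall fun t => by positivity
    rw [ftc, intervalIntegral.integral_const_mul] at hb1
    have := (le_abs_self _).trans hb1
    linarith
  have h2 : ∀ x : AddCircle L, ‖F x‖ ^ 2 ≤ ‖toL2 F‖ ^ 2 / L + 2 * ‖toL2 F‖ * ‖toL2 F'‖ := by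
    intro x
    have hi : Integrable (fun y : AddCircle L => ‖F y‖ ^ 2) :=
      integrable_of_continuous (by fun_prop)
    have h3 := integral_mono (μ := (volume : Measure (AddCircle L))) (integrable_const _)
      (hi.add (integrable_const _)) (fun y => h1 x y)
    have hv : (volume : Measure (AddCircle L)).real Set.univ = L := by
      rw [Measure.real, AddCircle.measure_univ, ENNReal.toReal_ofReal hL0.le]
    simp only [Pi.add_apply] at h3
    rw [integral_add hi (integrable_const _), integral_const, integral_const, hv,
      ← norm_sq_toL2, smul_eq_mul, smul_eq_mul] at h3
    have h4 : L * (‖F x‖ ^ 2 - 2 * ‖toL2 F‖ * ‖toL2 F'‖) ≤ ‖toL2 F‖ ^ 2 := by linarith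
    have := (le_div_iff₀' hL0).mpr h4
    linarith
  have h0 : 0 ≤ ‖toL2 F‖ ^ 2 / L + 2 * ‖toL2 F‖ * ‖toL2 F'‖ := by positivity
  rw [← Real.le_sqrt (norm_nonneg _) h0, ContinuousMap.norm_le _ (Real.sqrt_nonneg _)]
  exact fun x => Real.le_sqrt_of_sq_le (h2 x)

lemma norm_expC_le (k : ℤ) : ‖expC L k‖ ≤ (√L)⁻¹ := by
  unfold expC
  rw [norm_smul, fourier_norm, mul_one, Complex.norm_real, Real.norm_of_nonneg (by positivity)]

lemma IsDeriv.summable_coef {u g : L2per L} (h : IsDeriv u g) :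
    Summable (fun k => ‖coef u k‖) := by
  have hL0 := hL.out
  have hs1 := (hasSum_norm_sq g).summable
  have hs2 : Summable (fun k : ℤ => (L / (2 * Real.pi)) ^ 2 * (1 / (k : ℝ) ^ 2)) :=
    (Real.summable_one_div_int_pow.mpr one_lt_two).mul_left _
  refine Summable.of_norm_bounded_eventually (hs1.add hs2) ?_
  have : ∀ᶠ k : ℤ in cofinite, k ≠ 0 := by
    rw [Filter.eventually_cofinite]; simp
  filter_upwards [this] with k hk
  rw [norm_norm]
  have hk1 := h k
  have hk' : (0 : ℝ) < |(k : ℝ)| := abs_pos.mpr (by exact_mod_cast hk)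
  have hn : ‖coef g k‖ = 2 * Real.pi * |(k : ℝ)| / L * ‖coef u k‖ := by
    rw [hk1, norm_mul, norm_symb]
  have hu : ‖coef u k‖ = ‖coef g k‖ * (L / (2 * Real.pi) * (1 / |(k : ℝ)|)) := by
    rw [hn]
    have := Real.pi_pos
    field_simp
  have he : (L / (2 * Real.pi)) ^ 2 * (1 / (k : ℝ) ^ 2) = (L / (2 * Real.pi) * (1 / |(k : ℝ)|)) ^ 2 := by
    rw [mul_pow, div_pow 1, sq_abs, one_pow]
  rw [he, hu]
  nlinarith [sq_nonneg (‖coef g k‖ - (L / (2 * Real.pi) * (1 / |(k : ℝ)|))),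
    sq_nonneg (‖coef g k‖), sq_nonneg (L / (2 * Real.pi) * (1 / |(k : ℝ)|))]

/-- The sum of the Fourier series of `u` as a continuous function; it is used for `u` with a
square-integrable derivative, whose Fourier series converges uniformly. -/
def rep (u : L2per L) : C(AddCircle L, ℂ) := ∑' k, coef u k • expC L k

lemma IsDeriv.hasSum_rep {u g : L2per L} (h : IsDeriv u g) :
    HasSum (fun k => coef u k • expC L k) (rep u) := by
  refine Summable.hasSum (Summable.of_norm ?_)
  refine Summable.of_nonneg_of_le (fun k => norm_nonneg _) (fun k => ?_)
    (h.summable_coef.mul_right (√L)⁻¹)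
  rw [norm_smul]
  exact mul_le_mul_of_nonneg_left (norm_expC_le k) (norm_nonneg _)

lemma IsDeriv.toL2_rep {u g : L2per L} (h : IsDeriv u g) : toL2 (rep u) = u := by
  have h1 := h.hasSum_rep.mapL toL2
  simp only [map_smul] at h1
  exact h1.unique (hasSum_modes u)

lemma IsDeriv.rep_sub {u g v h : L2per L} (hu : IsDeriv u g) (hv : IsDeriv v h) :
    rep (u - v) = rep u - rep v := by
  apply toL2_injective
  rw [map_sub, (hu.sub hv).toL2_rep, hu.toL2_rep, hv.toL2_rep]

lemma isC1_sum {S : Finset ℤ} {u g : L2per L} (h : IsDeriv u g) :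
    IsC1 (∑ k ∈ S, coef u k • expC L k) (∑ k ∈ S, coef g k • expC L k) := by
  intro x
  simp only [ContinuousMap.sum_apply]
  refine HasDerivAt.fun_sum fun k _ => ?_
  have := (isC1_expC (L := L) k).smul (coef u k) x
  refine this.congr_deriv ?_
  simp [h k]; ring

/-- An element of `H²_per` is continuously differentiable: the Fourier series of `u` and of its
derivative converge uniformly. -/
lemma IsDeriv.isC1_rep {u g h : L2per L} (hu : IsDeriv u g) (hg : IsDeriv g h) :
    IsC1 (rep u) (rep g) := by
  intro x
  have t1 := hu.hasSum_rep
  have t2 := hg.hasSum_rep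
  refine hasDerivAt_of_tendstoUniformly (g := fun y : ℝ => rep u (y : AddCircle L))
    (g' := fun y : ℝ => rep g (y : AddCircle L)) (l := (atTop : Filter (Finset ℤ)))
    (f := fun S (y : ℝ) => (∑ k ∈ S, coef u k • expC L k) (y : AddCircle L))
    (f' := fun S (y : ℝ) => (∑ k ∈ S, coef g k • expC L k) (y : AddCircle L)) ?_
    (Eventually.of_forall fun S y => isC1_sum hu y) (fun y => ?_) x
  · have := (ContinuousMap.tendsto_iff_tendstoUniformly.mp t2)
    exact this.comp (fun y : ℝ => (y : AddCircle L))
  · exact ((continuous_eval_const (y : AddCircle L)).tendsto (rep u)).comp t1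

/-- Agmon's inequality. -/
lemma IsDeriv.norm_rep_sq_le {u g : L2per L} (h : IsDeriv u g) :
    ‖rep u‖ ^ 2 ≤ ‖u‖ ^ 2 / L + 2 * ‖u‖ * ‖g‖ := by
  have t1 := h.hasSum_rep
  have t2 : Tendsto (fun S : Finset ℤ => toL2 (∑ k ∈ S, coef u k • expC L k)) atTop (𝓝 u) := by
    simpa [map_sum, HasSum] using hasSum_modes u
  have t3 : Tendsto (fun S : Finset ℤ => toL2 (∑ k ∈ S, coef g k • expC L k)) atTop (𝓝 g) := by
    simpa [map_sum, HasSum] using hasSum_modes g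
  exact le_of_tendsto_of_tendsto (t1.norm.pow 2)
    (((t2.norm.pow 2).div_const L).add ((t2.norm.const_mul 2).mul t3.norm))
    (Eventually.of_forall fun S => (isC1_sum h).norm_sq_le)

lemma norm_le_of_coef {a b : L2per L} {C : ℝ} (hC : 0 ≤ C) (h : ∀ k, ‖coef a k‖ ≤ C * ‖coef b k‖) :
    ‖a‖ ≤ C * ‖b‖ := by
  have h1 := hasSum_norm_sq a
  have h2 := (hasSum_norm_sq b).mul_left (C ^ 2)
  have h3 := hasSum_le (fun k => ?_) h1 h2
  · rw [← mul_pow] at h3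
    exact le_of_sq_le_sq h3 (by positivity)
  · rw [← mul_pow]
    exact pow_le_pow_left₀ (norm_nonneg _) (h k) 2

lemma norm_coef_le {u g : L2per L} (h : IsDeriv u g) (m : ℕ) {k : ℤ} (hk : (m : ℤ) < |k|) :
    ‖coef u k‖ ≤ L / (2 * Real.pi * (m + 1)) * ‖coef g k‖ := by
  have hL0 := hL.out
  have hk2 : (m : ℝ) + 1 ≤ |(k : ℝ)| := by
    have : (m : ℤ) + 1 ≤ |k| := hk
    exact_mod_cast this
  rw [h k, norm_mul, norm_symb]
  have := Real.pi_pos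
  have h1 : ‖coef u k‖ * (m + 1) ≤ ‖coef u k‖ * |(k : ℝ)| := by gcongr
  calc ‖coef u k‖ = (‖coef u k‖ * (m + 1)) / (m + 1) := by field_simp
    _ ≤ (‖coef u k‖ * |(k : ℝ)|) / (m + 1) := by gcongr
    _ = _ := by field_simp

/-- Agmon's inequality without the lower-order term, for a derivative (which has mean zero). -/
lemma IsDeriv.norm_rep_deriv_sq_le {u g h : L2per L} (hu : IsDeriv u g) (hg : IsDeriv g h) :
    ‖rep g‖ ^ 2 ≤ 3 * ‖g‖ * ‖h‖ := by
  have hL0 := hL.out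
  have h1 := hg.norm_rep_sq_le
  have h2 : ‖g‖ ≤ L / (2 * Real.pi * ((0 : ℕ) + 1)) * ‖h‖ := by
    refine norm_le_of_coef (by have := Real.pi_pos; positivity) fun k => ?_
    by_cases hk : k = 0
    · subst hk
      have := Real.pi_pos
      rw [hu 0]
      simp only [symb, Int.cast_zero, mul_zero, zero_div, zero_mul, norm_zero]
      positivity
    · exact norm_coef_le hg 0 (by simpa using hk)
  have hpi := Real.pi_gt_three
  have h3 : L / (2 * Real.pi * ((0 : ℕ) + 1)) * ‖h‖ ≤ L * ‖h‖ := by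
    gcongr
    apply div_le_self hL0.le
    simp; linarith
  have h4 : ‖g‖ ^ 2 / L ≤ ‖g‖ * ‖h‖ := by
    rw [div_le_iff₀ hL0]
    nlinarith [norm_nonneg g, norm_nonneg h]
  linarith

/-- The interpolation inequality `‖u_x‖² ≤ ‖u‖ ‖u_xx‖`. -/
lemma IsDeriv.norm_sq_le {u g h : L2per L} (hu : IsDeriv u g) (hg : IsDeriv g h) :
    ‖g‖ ^ 2 ≤ ‖u‖ * ‖h‖ := by
  have h1 := hu.inner_eq hg
  have h2 : ‖inner ℂ g g‖ = ‖g‖ ^ 2 := by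
    rw [inner_self_eq_norm_sq_to_K]; simp
  rw [← h2, h1, norm_neg]
  exact norm_inner_le_norm _ _

/-! ### The projections -/

lemma expC_mem_Hm {m : ℕ} {k : ℤ} (hk : |k| ≤ (m : ℤ)) : modeBasis L k ∈ Hm L m := by
  rw [modeBasis_apply, toL2_expC]
  exact Submodule.smul_mem _ _ (Submodule.subset_span ⟨k, hk, rfl⟩)

lemma expC_mem_Hm_orthogonal {m : ℕ} {k : ℤ} (hk : ¬ |k| ≤ (m : ℤ)) :
    modeBasis L k ∈ (Hm L m)ᗮ := by
  unfold Hm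
  rw [Submodule.mem_orthogonal]
  intro u hu
  induction hu using Submodule.span_induction with
  | mem x hx =>
    obtain ⟨l, hl, rfl⟩ := hx
    rw [modeBasis_apply, toL2_expC, inner_smul_right, inner_mode_mode, if_neg, mul_zero]
    rintro rfl
    exact hk hl
  | zero => simp
  | add x y _ _ hx hy => rw [inner_add_left, hx, hy, add_zero]
  | smul a x _ hx => rw [inner_smul_left, hx, mul_zero]

lemma coef_Pm (m : ℕ) (u : L2per L) (k : ℤ) :
    coef (Pm m u) k = if |k| ≤ (m : ℤ) then coef u k else 0 := by
  unfold coef Pm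
  rw [← Submodule.inner_starProjection_left_eq_right]
  split_ifs with hk
  · rw [Submodule.starProjection_eq_self_iff.mpr (expC_mem_Hm hk)]
  · rw [(Submodule.starProjection_apply_eq_zero_iff _).mpr (expC_mem_Hm_orthogonal hk), inner_zero_left]

lemma inner_Pm_left (m : ℕ) (u v : L2per L) : inner ℂ (Pm m u) v = inner ℂ u (Pm m v) :=
  Submodule.inner_starProjection_left_eq_right _ _ _

lemma Pm_Pm (m : ℕ) (u : L2per L) : Pm m (Pm m u) = Pm m u :=
  Submodule.starProjection_eq_self_iff.mpr (Submodule.starProjection_apply_mem _ _)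

lemma Pm_of_mem {m : ℕ} {v : L2per L} (h : v ∈ Hm L m) : Pm m v = v :=
  Submodule.starProjection_eq_self_iff.mpr h

lemma norm_Pm_le (m : ℕ) (u : L2per L) : ‖Pm m u‖ ≤ ‖u‖ :=
  Submodule.norm_starProjection_apply_le _ _

lemma IsDeriv.Pm {u g : L2per L} (h : IsDeriv u g) (m : ℕ) : IsDeriv (Pm m u) (Pm m g) := by
  intro k
  rw [coef_Pm, coef_Pm, h k]
  split_ifs <;> simp

lemma norm_sq_Pm (m : ℕ) (u : L2per L) : ‖Pm m u‖ ^ 2 = ‖u‖ ^ 2 - ‖u - Pm m u‖ ^ 2 := by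
  have h : inner ℂ (Pm m u) (u - Pm m u) = 0 := by
    rw [inner_sub_right, inner_Pm_left m u (Pm m u), Pm_Pm, inner_Pm_left, sub_self]
  have h2 := norm_add_sq_eq_norm_sq_add_norm_sq_of_inner_eq_zero (𝕜 := ℂ) (Pm m u) (u - Pm m u) h
  rw [add_sub_cancel] at h2
  nlinarith

/-- The high modes of `u` are controlled by the derivative of `u`. -/
lemma IsDeriv.norm_sub_Pm_le {u g : L2per L} (h : IsDeriv u g) (m : ℕ) :
    ‖u - NLS.Pm m u‖ ≤ L / (2 * Real.pi * (m + 1)) * ‖g - NLS.Pm m g‖ := by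
  have hL0 := hL.out
  refine norm_le_of_coef (by have := Real.pi_pos; positivity) fun k => ?_
  rw [coef_sub, coef_sub, coef_Pm, coef_Pm]
  split_ifs with hk
  · simp
  · simpa using norm_coef_le h m (not_le.mp hk)

lemma norm_sub_Pm_le (m : ℕ) (u : L2per L) : ‖u - Pm m u‖ ≤ ‖u‖ := by
  have := norm_sq_Pm m u
  exact le_of_sq_le_sq (by nlinarith [sq_nonneg ‖Pm m u‖]) (norm_nonneg _)

/-! ### Multiplication and conjugation -/

lemma real_inner_eq_re (u v : L2per L) : inner ℝ u v = (inner ℂ u v).re := by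
  rw [MeasureTheory.L2.inner_def, MeasureTheory.L2.inner_def]
  have h : Integrable (fun x => inner ℂ (u x) (v x)) := MeasureTheory.L2.integrable_inner (𝕜 := ℂ) u v
  have := integral_re (𝕜 := ℂ) h
  exact this

/-- Multiplication of square-integrable functions by continuous functions. -/
def mulL : C(AddCircle L, ℂ) →L[ℂ] L2per L →L[ℂ] L2per L :=
  ((ContinuousLinearMap.mul ℂ ℂ).holderL volume ⊤ 2 2).comp
    (ContinuousMap.toLp (E := ℂ) ⊤ (volume : Measure (AddCircle L)) ℂ)

lemma coeFn_mulL (F : C(AddCircle L, ℂ)) (u : L2per L) : mulL F u =ᵐ[volume] fun x => F x * u x := by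
  have h1 := (ContinuousLinearMap.mul ℂ ℂ).coeFn_holder (r := 2)
    (ContinuousMap.toLp (E := ℂ) ⊤ (volume : Measure (AddCircle L)) ℂ F) u
  have h2 := ContinuousMap.coeFn_toLp (p := ⊤) (𝕜 := ℂ) (volume : Measure (AddCircle L)) F
  filter_upwards [h1, h2] with x hx hx2
  rw [← hx2]
  exact hx

lemma norm_mulL_le (F : C(AddCircle L, ℂ)) (u : L2per L) : ‖mulL F u‖ ≤ ‖F‖ * ‖u‖ := by
  apply Lp.norm_le_mul_norm_of_ae_le_mul
  filter_upwards [coeFn_mulL F u] with x hx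
  rw [hx, norm_mul]
  exact mul_le_mul_of_nonneg_right (F.norm_coe_le_norm x) (norm_nonneg _)

lemma mulL_mulL (F G : C(AddCircle L, ℂ)) (u : L2per L) : mulL F (mulL G u) = mulL (F * G) u := by
  apply Lp.ext
  filter_upwards [coeFn_mulL F (mulL G u), coeFn_mulL G u, coeFn_mulL (F * G) u] with x h1 h2 h3
  rw [h1, h2, h3, ContinuousMap.mul_apply]; ring

lemma mulL_toL2 (F G : C(AddCircle L, ℂ)) : mulL F (toL2 G) = toL2 (F * G) := by
  apply Lp.ext
  filter_upwards [coeFn_mulL F (toL2 G), coeFn_toL2 G, coeFn_toL2 (F * G)] with x h1 h2 h3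
  rw [h1, h2, h3]; rfl

/-- Complex conjugation on `L²_per`. -/
def conjL : L2per L →L[ℝ] L2per L :=
  (Complex.conjCLE : ℂ →L[ℝ] ℂ).compLpL 2 volume

lemma coeFn_conjL (u : L2per L) : conjL u =ᵐ[volume] fun x => starRingEnd ℂ (u x) :=
  ContinuousLinearMap.coeFn_compLpL _ u

lemma norm_conjL (u : L2per L) : ‖conjL u‖ = ‖u‖ := by
  apply le_antisymm
  · apply Lp.norm_le_norm_of_ae_le
    filter_upwards [coeFn_conjL u] with x hx
    rw [hx]; simp
  · apply Lp.norm_le_norm_of_ae_le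
    filter_upwards [coeFn_conjL u] with x hx
    rw [hx]; simp

lemma conjL_conjL (u : L2per L) : conjL (conjL u) = u := by
  apply Lp.ext
  filter_upwards [coeFn_conjL u, coeFn_conjL (conjL u)] with x h1 h2
  rw [h2, h1, Complex.conj_conj]

lemma conjL_smul (a : ℂ) (u : L2per L) : conjL (a • u) = starRingEnd ℂ a • conjL u := by
  apply Lp.ext
  filter_upwards [coeFn_conjL u, coeFn_conjL (a • u), Lp.coeFn_smul a u,
    Lp.coeFn_smul (starRingEnd ℂ a) (conjL u)] with x h1 h2 h3 h4
  rw [h2, h3, h4]; simp [h1]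

lemma conjL_toL2 (F : C(AddCircle L, ℂ)) : conjL (toL2 F) = toL2 (star F) := by
  apply Lp.ext
  filter_upwards [coeFn_conjL (toL2 F), coeFn_toL2 F, coeFn_toL2 (star F)] with x h1 h2 h3
  rw [h1, h2, h3]; rfl

lemma conjL_mulL (F : C(AddCircle L, ℂ)) (u : L2per L) :
    conjL (mulL F u) = mulL (star F) (conjL u) := by
  apply Lp.ext
  filter_upwards [coeFn_conjL (mulL F u), coeFn_mulL F u, coeFn_mulL (star F) (conjL u),
    coeFn_conjL u] with x h1 h2 h3 h4
  rw [h1, h2, h3, h4]; simp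

lemma inner_mulL_left (F : C(AddCircle L, ℂ)) (u v : L2per L) :
    inner ℂ (mulL F u) v = inner ℂ u (mulL (star F) v) := by
  rw [MeasureTheory.L2.inner_def, MeasureTheory.L2.inner_def]
  apply integral_congr_ae
  filter_upwards [coeFn_mulL F u, coeFn_mulL (star F) v] with x h1 h2
  rw [h1, h2]
  simp [RCLike.inner_apply]; ring

lemma real_inner_mulL_left (F : C(AddCircle L, ℂ)) (u v : L2per L) :
    inner ℝ (mulL F u) v = inner ℝ u (mulL (star F) v) := by
  rw [real_inner_eq_re, real_inner_eq_re, inner_mulL_left]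

lemma inner_conjL_conjL (u v : L2per L) : inner ℂ (conjL u) (conjL v) = inner ℂ v u := by
  rw [MeasureTheory.L2.inner_def, MeasureTheory.L2.inner_def]
  apply integral_congr_ae
  filter_upwards [coeFn_conjL u, coeFn_conjL v] with x h1 h2
  rw [h1, h2]
  simp [RCLike.inner_apply]; ring

lemma real_inner_conjL_left (u v : L2per L) : inner ℝ (conjL u) v = inner ℝ u (conjL v) := by
  rw [real_inner_eq_re, real_inner_comm, real_inner_eq_re, ← inner_conjL_conjL, conjL_conjL]

lemma real_inner_I_smul_left (u v : L2per L) :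
    inner ℝ (Complex.I • u) v = -inner ℝ u (Complex.I • v) := by
  rw [real_inner_eq_re, real_inner_eq_re, inner_smul_left, inner_smul_right]; simp

lemma real_inner_I_smul_self (u : L2per L) : inner ℝ (Complex.I • u) u = 0 := by
  have := real_inner_I_smul_left u u
  rw [real_inner_comm (Complex.I • u) u] at this
  linarith

lemma real_inner_Pm_left (m : ℕ) (u v : L2per L) : inner ℝ (Pm m u) v = inner ℝ u (Pm m v) := by
  rw [real_inner_eq_re, real_inner_eq_re, inner_Pm_left]

lemma IsDeriv.real_inner_eq {u u' v v' : L2per L} (hu : IsDeriv u u') (hv : IsDeriv v v') :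
    inner ℝ u' v = -inner ℝ u v' := by
  rw [real_inner_eq_re, real_inner_eq_re, hu.inner_eq hv, Complex.neg_re]

/-! ### Time derivatives -/

/-- If the increments of `J` are the pairings of the increments of `w` with a continuous family,
then `J` is differentiable. -/
lemma hasDerivAt_of_increment {w : ℝ → L2per L} {w' : L2per L} {J : ℝ → ℝ} {P : ℝ → L2per L} {s : ℝ}
    (hw : HasDerivAt w w' s) (hP : Tendsto P (𝓝 s) (𝓝 (P s)))
    (hJ : ∀ t, J t - J s = inner ℝ (w t - w s) (P t)) :
    HasDerivAt J (inner ℝ w' (P s)) s := by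
  rw [hasDerivAt_iff_tendsto_slope]
  have h1 := hasDerivAt_iff_tendsto_slope.mp hw
  have h2 : Tendsto P (𝓝[≠] s) (𝓝 (P s)) := hP.mono_left nhdsWithin_le_nhds
  refine (h1.inner h2).congr fun t => ?_
  rw [slope_def_module, slope_def_module, real_inner_smul_left, hJ, smul_eq_mul]

/-- A bounded solution on the whole line of `y' + a y ≤ b` satisfies `y ≤ b / a`. -/
lemma le_div_of_deriv_add_le {y y' : ℝ → ℝ} {a b M : ℝ} (ha : 0 < a)
    (hy : ∀ s, HasDerivAt y (y' s) s) (hM : ∀ s, y s ≤ M) (h : ∀ s, y' s + a * y s ≤ b) (s : ℝ) :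
    y s ≤ b / a := by
  have hanti : Antitone (fun t => (y t - b / a) * Real.exp (a * t)) := by
    have hd : ∀ t, HasDerivAt (fun t => (y t - b / a) * Real.exp (a * t))
        (y' t * Real.exp (a * t) + (y t - b / a) * (Real.exp (a * t) * a)) t := fun t => by
      have h1 : HasDerivAt (fun t => Real.exp (a * t)) (Real.exp (a * t) * a) t := by
        simpa using ((hasDerivAt_id t).const_mul a).exp
      exact ((hy t).sub_const _).mul h1
    refine antitone_of_deriv_nonpos (fun t => (hd t).differentiableAt) fun t => ?_
    rw [(hd t).deriv]
    have h1 := h t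
    have h2 : y' t * Real.exp (a * t) + (y t - b / a) * (Real.exp (a * t) * a)
        = (y' t + a * y t - b) * Real.exp (a * t) := by
      field_simp; ring
    rw [h2]
    exact mul_nonpos_of_nonpos_of_nonneg (by linarith) (Real.exp_pos _).le
  have key : ∀ t ≤ s, y s - b / a ≤ (M - b / a) * Real.exp (a * (t - s)) := fun t ht => by
    have h1 := hanti ht
    simp only at h1
    have h2 : (y t - b / a) * Real.exp (a * t) ≤ (M - b / a) * Real.exp (a * t) :=
      mul_le_mul_of_nonneg_right (by linarith [hM t]) (Real.exp_pos _).le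
    have h3 : Real.exp (a * (t - s)) = Real.exp (a * t) / Real.exp (a * s) := by
      rw [← Real.exp_sub]; ring_nf
    rw [h3, ← mul_div_assoc, le_div_iff₀ (Real.exp_pos _)]
    exact h1.trans h2
  have hlim : Tendsto (fun t => (M - b / a) * Real.exp (a * (t - s))) atBot (𝓝 ((M - b / a) * 0)) := by
    refine Tendsto.const_mul _ (Real.tendsto_exp_atBot.comp ?_)
    exact (tendsto_atBot_add_const_right _ (-s) tendsto_id).const_mul_atBot ha
  rw [mul_zero] at hlim
  have := ge_of_tendsto hlim ((eventually_le_atBot s).mono key)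
  linarith

/-- The energy identity of the inhomogeneous linear Schrödinger equation: if
`Z_s = i Z_xx + g` holds mode by mode, with `Z` and `g` continuous in `L²_per`, then
`(‖Z‖²)_s = 2 ⟨Z, g⟩`. No regularity of `Z` in `x` is needed, since `i Z_xx` contributes nothing
to any mode of the energy. -/
lemma hasDerivAt_norm_sq_of_modes {Z g : ℝ → L2per L} {lam : ℤ → ℝ} (hZ : Continuous Z)
    (hg : Continuous g)
    (h : ∀ k s, HasDerivAt (fun t => coef (Z t) k)
      (-(Complex.I * lam k) * coef (Z s) k + coef (g s) k) s) (s : ℝ) :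
    HasDerivAt (fun t => ‖Z t‖ ^ 2) (2 * inner ℝ (Z s) (g s)) s := by
  have hc : ∀ {u : ℝ → L2per L} (k : ℤ), Continuous u → Continuous (fun t => coef (u t) k) :=
    fun k hu => (continuous_const.inner hu)
  have hint : ∀ a b : ℝ, ‖Z b‖ ^ 2 - ‖Z a‖ ^ 2 = ∫ t in a..b, 2 * inner ℝ (Z t) (g t) := by
    intro a b
    have hmode : ∀ S : Finset ℤ, ∑ k ∈ S, ‖coef (Z b) k‖ ^ 2 - ∑ k ∈ S, ‖coef (Z a) k‖ ^ 2
        = ∫ t in a..b, ∑ k ∈ S, 2 * inner ℝ (coef (Z t) k) (coef (g t) k) := by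
      intro S
      rw [intervalIntegral.integral_eq_sub_of_hasDerivAt
        (f := fun t => ∑ k ∈ S, ‖coef (Z t) k‖ ^ 2)]
      · intro t _
        refine HasDerivAt.fun_sum fun k _ => ?_
        refine (h k t).norm_sq.congr_deriv ?_
        rw [inner_add_right]
        have : inner ℝ (coef (Z t) k) (-(Complex.I * lam k) * coef (Z t) k) = (0 : ℝ) := by
          rw [Complex.inner]
          simp; ring
        rw [this, zero_add]
      · exact (continuous_finsetSum _ fun k _ => continuous_const.mul
          ((hc k hZ).inner (hc k hg))).intervalIntegrable _ _
    have hL1 : Tendsto (fun S : Finset ℤ => ∑ k ∈ S, ‖coef (Z b) k‖ ^ 2 - ∑ k ∈ S, ‖coef (Z a) k‖ ^ 2)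
        atTop (𝓝 (‖Z b‖ ^ 2 - ‖Z a‖ ^ 2)) :=
      by
      have h1 := hasSum_norm_sq (Z b)
      have h2 := hasSum_norm_sq (Z a)
      rw [HasSum, SummationFilter.unconditional_filter] at h1 h2
      exact h1.sub h2
    have hL2 : Tendsto (fun S : Finset ℤ => ∫ t in a..b, ∑ k ∈ S, 2 * inner ℝ (coef (Z t) k) (coef (g t) k))
        atTop (𝓝 (∫ t in a..b, 2 * inner ℝ (Z t) (g t))) := by
      refine intervalIntegral.tendsto_integral_filter_of_dominated_convergence
        (fun t => ‖Z t‖ ^ 2 + ‖g t‖ ^ 2) ?_ ?_ ?_ ?_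
      · exact Eventually.of_forall fun S => (continuous_finsetSum _ fun k _ => continuous_const.mul
          ((hc k hZ).inner (hc k hg))).aestronglyMeasurable
      · refine Eventually.of_forall fun S => Eventually.of_forall fun t _ => ?_
        refine (norm_sum_le _ _).trans ?_
        have h1 := sum_le_hasSum S (fun k _ => sq_nonneg _) (hasSum_norm_sq (Z t))
        have h2 := sum_le_hasSum S (fun k _ => sq_nonneg _) (hasSum_norm_sq (g t))
        refine le_trans ?_ (add_le_add h1 h2)
        rw [← Finset.sum_add_distrib]
        refine Finset.sum_le_sum fun k _ => ?_
        rw [norm_mul, Real.norm_ofNat]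
        have := norm_inner_le_norm (𝕜 := ℝ) (coef (Z t) k) (coef (g t) k)
        nlinarith [sq_nonneg (‖coef (Z t) k‖ - ‖coef (g t) k‖)]
      · exact ((hZ.norm.pow 2).add (hg.norm.pow 2)).intervalIntegrable _ _
      · refine Eventually.of_forall fun t _ => ?_
        have h1 := (Complex.hasSum_re (hasSum_inner (Z t) (g t))).mul_left 2
        rw [← real_inner_eq_re, HasSum, SummationFilter.unconditional_filter] at h1
        simpa only [Complex.inner, mul_comm (coef (g t) _)] using h1
    exact tendsto_nhds_unique (hL1.congr hmode) hL2
  have hcont : Continuous (fun t => 2 * inner ℝ (Z t) (g t)) := continuous_const.mul (hZ.inner hg)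
  have hd := intervalIntegral.integral_hasDerivAt_right (hcont.intervalIntegrable s s)
    (hcont.stronglyMeasurableAtFilter _ _) hcont.continuousAt
  have he : (fun t => ‖Z t‖ ^ 2) = fun t => (∫ x in s..t, 2 * inner ℝ (Z x) (g x)) + ‖Z s‖ ^ 2 := by
    ext t
    rw [← hint s t]; ring
  rw [he]
  exact hd.add_const _

/-! ### Trajectories in `H²_per` -/

lemma IsDeriv.add {u g v h : L2per L} (hu : IsDeriv u g) (hv : IsDeriv v h) :
    IsDeriv (u + v) (g + h) := fun k => by
  rw [coef_add, coef_add, hu k, hv k]; ring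

lemma norm_le_h2Norm (u : L2per L) : ‖u‖ ≤ h2Norm u :=
  Real.le_sqrt_of_sq_le (by nlinarith [sq_nonneg ‖weakDeriv (weakDeriv u)‖])

lemma norm_weakDeriv_weakDeriv_le_h2Norm (u : L2per L) : ‖weakDeriv (weakDeriv u)‖ ≤ h2Norm u :=
  Real.le_sqrt_of_sq_le (by nlinarith [sq_nonneg ‖u‖])

lemma h2Norm_nonneg (u : L2per L) : 0 ≤ h2Norm u := Real.sqrt_nonneg _

lemma MemH2.norm_weakDeriv_le_h2Norm {u : L2per L} (h : MemH2 u) : ‖weakDeriv u‖ ≤ h2Norm u := by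
  refine le_of_sq_le_sq ((h.isDeriv.1.norm_sq_le h.isDeriv.2).trans ?_) (h2Norm_nonneg u)
  rw [pow_two]
  exact mul_le_mul (norm_le_h2Norm u) (norm_weakDeriv_weakDeriv_le_h2Norm u) (norm_nonneg _)
    (h2Norm_nonneg u)

lemma MemH2.norm_rep_sq_le_h2Norm {u : L2per L} (h : MemH2 u) :
    ‖rep u‖ ^ 2 ≤ (1 / L + 2) * h2Norm u ^ 2 := by
  have hL0 := hL.out
  have h1 := h.isDeriv.1.norm_rep_sq_le
  have h2 := norm_le_h2Norm u
  have h3 := h.norm_weakDeriv_le_h2Norm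
  have h4 : ‖u‖ ^ 2 / L ≤ h2Norm u ^ 2 / L := by gcongr
  have h5 : ‖u‖ * ‖weakDeriv u‖ ≤ h2Norm u * h2Norm u :=
    mul_le_mul h2 h3 (norm_nonneg _) (h2Norm_nonneg u)
  have h6 : (1 / L + 2) * h2Norm u ^ 2 = h2Norm u ^ 2 / L + 2 * h2Norm u ^ 2 := by ring
  rw [h6]
  nlinarith

lemma MemH2.norm_rep_weakDeriv_sq_le_h2Norm {u : L2per L} (h : MemH2 u) :
    ‖rep (weakDeriv u)‖ ^ 2 ≤ 3 * h2Norm u ^ 2 := by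
  have h1 := h.isDeriv.1.norm_rep_deriv_sq_le h.isDeriv.2
  have h5 : ‖weakDeriv u‖ * ‖weakDeriv (weakDeriv u)‖ ≤ h2Norm u * h2Norm u :=
    mul_le_mul h.norm_weakDeriv_le_h2Norm (norm_weakDeriv_weakDeriv_le_h2Norm u) (norm_nonneg _)
      (h2Norm_nonneg u)
  nlinarith

lemma MemH2.sub {u v : L2per L} (hu : MemH2 u) (hv : MemH2 v) : MemH2 (u - v) :=
  ⟨_, _, (hu.isDeriv.1.sub hv.isDeriv.1).hasWeakDeriv, (hu.isDeriv.2.sub hv.isDeriv.2).hasWeakDeriv⟩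

section Trajectory

variable {w : ℝ → L2per L}

/-- A quantity whose increments are controlled by those of `w` in `H²_per` is continuous in time. -/
lemma continuous_of_norm_sub_sq_le {E : Type*} [NormedAddCommGroup E] {u : ℝ → E}
    (hY : MemY w) {C : ℝ} (h : ∀ s t, ‖u t - u s‖ ^ 2 ≤ C * h2Norm (w t - w s) ^ 2) :
    Continuous u := by
  rw [continuous_iff_continuousAt]
  intro s
  have h1 : Tendsto (fun t => √(C * h2Norm (w t - w s) ^ 2)) (𝓝 s) (𝓝 0) := by
    have := (((hY.continuous s).pow 2).const_mul C).sqrt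
    simpa using this
  rw [ContinuousAt, tendsto_iff_norm_sub_tendsto_zero]
  exact squeeze_zero (fun t => norm_nonneg _) (fun t => Real.le_sqrt_of_sq_le (h s t)) h1

lemma MemY.continuous_self (hY : MemY w) : Continuous w :=
  continuous_of_norm_sub_sq_le (C := 1) hY fun s t => by
    rw [one_mul]
    exact pow_le_pow_left₀ (norm_nonneg _) (norm_le_h2Norm _) 2

lemma MemY.continuous_weakDeriv_weakDeriv (hY : MemY w) :
    Continuous fun s => weakDeriv (weakDeriv (w s)) :=
  continuous_of_norm_sub_sq_le (C := 1) hY fun s t => by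
    rw [one_mul, ← (isDeriv_sub_of_memH2 (hY.memH2 t) (hY.memH2 s)).2]
    exact pow_le_pow_left₀ (norm_nonneg _) (norm_weakDeriv_weakDeriv_le_h2Norm _) 2

lemma MemY.continuous_rep (hY : MemY w) : Continuous fun s => rep (w s) :=
  continuous_of_norm_sub_sq_le hY fun s t => by
    rw [← (hY.memH2 t).isDeriv.1.rep_sub (hY.memH2 s).isDeriv.1]
    exact ((hY.memH2 t).sub (hY.memH2 s)).norm_rep_sq_le_h2Norm

lemma MemY.continuous_rep_weakDeriv (hY : MemY w) : Continuous fun s => rep (weakDeriv (w s)) :=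
  continuous_of_norm_sub_sq_le hY fun s t => by
    rw [← (hY.memH2 t).isDeriv.2.rep_sub (hY.memH2 s).isDeriv.2,
      ← (isDeriv_sub_of_memH2 (hY.memH2 t) (hY.memH2 s)).1]
    exact ((hY.memH2 t).sub (hY.memH2 s)).norm_rep_weakDeriv_sq_le_h2Norm

/-- The cubic term `|u|² u`. -/
def cubic (u : L2per L) : L2per L := mulL (rep u * star (rep u)) u

/-- The derivative `h ↦ 2 |u|² h + u² h̄` of the cubic term. -/
def cubicDeriv (u h : L2per L) : L2per L :=
  mulL (star (rep u) * (rep u + rep u)) h + mulL (rep u * rep u) (conjL h)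

lemma MemH2.toL2_rep {u : L2per L} (h : MemH2 u) : toL2 (rep u) = u := h.isDeriv.1.toL2_rep

lemma MemH2.toL2_rep_weakDeriv {u : L2per L} (h : MemH2 u) :
    toL2 (rep (weakDeriv u)) = weakDeriv u := h.isDeriv.2.toL2_rep

lemma MemH2.mulL_eq {u : L2per L} (h : MemH2 u) (F : C(AddCircle L, ℂ)) :
    mulL F u = toL2 (F * rep u) := by
  rw [← mulL_toL2, h.toL2_rep]

lemma MemH2.cubic_eq {u : L2per L} (h : MemH2 u) :
    cubic u = toL2 (rep u * star (rep u) * rep u) := h.mulL_eq _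

lemma MemH2.conjL_eq {u : L2per L} (h : MemH2 u) : conjL u = toL2 (star (rep u)) := by
  conv_lhs => rw [← h.toL2_rep]
  rw [conjL_toL2]

lemma cubic_sub {u v : L2per L} (hu : MemH2 u) (hv : MemH2 v) :
    cubic u - cubic v = mulL (star (rep u) * (rep u + rep v)) (u - v)
      + mulL (rep v * rep v) (conjL (u - v)) := by
  rw [hu.cubic_eq, hv.cubic_eq, map_sub conjL, hu.conjL_eq, hv.conjL_eq, map_sub (mulL _),
    hu.mulL_eq, hv.mulL_eq, ← map_sub, ← map_sub, ← map_sub, mulL_toL2, ← map_add]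
  congr 1; ring

/-- The cubic term of a trajectory in `H²_per` is differentiable in `L²_per` as soon as the
trajectory is. -/
lemma MemY.hasDerivAt_cubic (hY : MemY w) {s : ℝ} {w' : L2per L} (hw : HasDerivAt w w' s) :
    HasDerivAt (fun t => cubic (w t)) (cubicDeriv (w s) w') s := by
  rw [hasDerivAt_iff_tendsto_slope]
  have h1 := hasDerivAt_iff_tendsto_slope.mp hw
  have hW : Tendsto (fun t => mulL (star (rep (w t)) * (rep (w t) + rep (w s)))) (𝓝[≠] s)
      (𝓝 (mulL (star (rep (w s)) * (rep (w s) + rep (w s))))) := by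
    have hc := hY.continuous_rep
    have : Continuous fun t => mulL (star (rep (w t)) * (rep (w t) + rep (w s))) :=
      mulL.continuous.comp (hc.star.mul (hc.add continuous_const))
    exact (this.tendsto s).mono_left nhdsWithin_le_nhds
  have h2 := ((isBoundedBilinearMap_apply.continuous.tendsto (_, _)).comp (hW.prodMk_nhds h1)).add
    (((mulL (rep (w s) * rep (w s))).continuous.tendsto _).comp
      ((conjL.continuous.tendsto _).comp h1))
  refine h2.congr fun t => ?_
  rw [slope_def_module (fun t => cubic (w t)), cubic_sub (hY.memH2 t) (hY.memH2 s), smul_add]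
  simp only [Function.comp, slope_def_module]
  have hm : ∀ (F : C(AddCircle L, ℂ)) (a : ℝ) (u : L2per L), mulL F (a • u) = a • mulL F u :=
    fun F a u => (mulL F).map_smul_of_tower a u
  rw [hm, map_smul conjL, hm]

lemma inner_cubicDeriv_self {u h : L2per L} (hu : MemH2 u) :
    inner ℝ (cubicDeriv u h) u = 3 * inner ℝ h (cubic u) := by
  unfold cubicDeriv
  rw [inner_add_left, real_inner_mulL_left, real_inner_mulL_left, real_inner_conjL_left,
    conjL_mulL, hu.conjL_eq]
  have e1 : mulL (star (star (rep u) * (rep u + rep u))) u = (2 : ℝ) • cubic u := by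
    rw [hu.cubic_eq, two_smul, hu.mulL_eq, ← map_add]
    congr 1
    simp only [star_mul', star_add, star_star]; ring
  have e2 : mulL (star (star (rep u * rep u))) (toL2 (star (rep u))) = cubic u := by
    rw [hu.cubic_eq, mulL_toL2]
    congr 1
    simp only [star_star]; ring
  rw [e1, e2, real_inner_smul_right]; ring

lemma MemY.hasDerivAt_inner_cubic (hY : MemY w) {s : ℝ} {w' : L2per L} (hw : HasDerivAt w w' s) :
    HasDerivAt (fun t => inner ℝ (cubic (w t)) (w t)) (4 * inner ℝ w' (cubic (w s))) s := by
  refine ((hY.hasDerivAt_cubic hw).inner ℝ hw).congr_deriv ?_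
  rw [inner_cubicDeriv_self (hY.memH2 s), real_inner_comm w']; ring

/-- Although `w_s` has no more than `L²` regularity, `‖w_x‖²` is differentiable in time: its
increments are `-⟨w(t) - w(s), w_xx(t) + w_xx(s)⟩`. -/
lemma MemY.hasDerivAt_norm_sq_weakDeriv (hY : MemY w) {s : ℝ} {w' : L2per L}
    (hw : HasDerivAt w w' s) :
    HasDerivAt (fun t => ‖weakDeriv (w t)‖ ^ 2)
      (-(2 * inner ℝ w' (weakDeriv (weakDeriv (w s))))) s := by
  have hA := hY.continuous_weakDeriv_weakDeriv
  have h := hasDerivAt_of_increment (J := fun t => ‖weakDeriv (w t)‖ ^ 2)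
    (P := fun t => -(weakDeriv (weakDeriv (w t)) + weakDeriv (weakDeriv (w s)))) hw
    ((hA.add continuous_const).neg.tendsto s) fun t => ?_
  · refine h.congr_deriv ?_
    rw [inner_neg_right, inner_add_right]; ring
  · have h1 : ∀ t, ‖weakDeriv (w t)‖ ^ 2 = -inner ℝ (w t) (weakDeriv (weakDeriv (w t))) := fun t => by
      rw [← real_inner_self_eq_norm_sq,
        (hY.memH2 t).isDeriv.1.real_inner_eq (hY.memH2 t).isDeriv.2]
    have h2 : inner ℝ (w t) (weakDeriv (weakDeriv (w s))) = inner ℝ (w s) (weakDeriv (weakDeriv (w t))) := by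
      have e1 := (hY.memH2 t).isDeriv.1.real_inner_eq (hY.memH2 s).isDeriv.2
      have e2 := (hY.memH2 s).isDeriv.1.real_inner_eq (hY.memH2 t).isDeriv.2
      rw [real_inner_comm] at e2
      linarith
    simp only [h1]
    rw [inner_neg_right, inner_add_right, inner_sub_left, inner_sub_left]
    linarith

/-- The correction `Re ∫ ū² u_x²` of the second-order energy. -/
def corr (u : L2per L) : ℝ :=
  inner ℝ (toL2 (rep u * rep u * star (rep (weakDeriv u)))) (toL2 (rep (weakDeriv u)))

/-- The gradient of `corr` with respect to the real inner product of `L²_per`: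
`2 ū u_x² - 2 u² ū_xx - 4 u |u_x|²`. -/
def corrGrad (u : L2per L) : L2per L :=
  toL2 ((star (rep u) + star (rep u)) * rep (weakDeriv u) * rep (weakDeriv u))
    - mulL (rep u * rep u) (conjL (weakDeriv (weakDeriv u) + weakDeriv (weakDeriv u)))
    - toL2 ((rep (weakDeriv u) * rep u + rep u * rep (weakDeriv u))
        * star (rep (weakDeriv u) + rep (weakDeriv u)))

/-- The pairing of two continuous functions depends only on a pointwise product, so that
identities between such pairings reduce to commutative algebra. -/
lemma inner_toL2_eq_one (F G : C(AddCircle L, ℂ)) :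
    inner ℝ (toL2 F) (toL2 G) = inner ℝ (toL2 1) (toL2 (star F * G)) := by
  have := real_inner_mulL_left F (toL2 1) (toL2 G)
  rwa [mulL_toL2, mulL_toL2, mul_one] at this

/-- The increment of the correction as a pairing with `u - v`. An integration by parts has moved
the derivative off `(u - v)_x`. -/
lemma corr_sub {u v : L2per L} (hu : MemH2 u) (hv : MemH2 v) :
    corr u - corr v = inner ℝ (u - v)
      (toL2 ((star (rep u) + star (rep v)) * rep (weakDeriv u) * rep (weakDeriv u))
        - mulL (rep v * rep v) (conjL (weakDeriv (weakDeriv u) + weakDeriv (weakDeriv v)))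
        - toL2 ((rep (weakDeriv v) * rep v + rep v * rep (weakDeriv v))
          * star (rep (weakDeriv u) + rep (weakDeriv v)))) := by
  have hC : IsC1 (rep u - rep v) (rep (weakDeriv u) - rep (weakDeriv v)) := by
    rw [← hu.isDeriv.1.rep_sub hv.isDeriv.1, ← hu.isDeriv.2.rep_sub hv.isDeriv.2]
    exact (hu.isDeriv.1.sub hv.isDeriv.1).isC1_rep (hu.isDeriv.2.sub hv.isDeriv.2)
  have hCv : IsC1 (rep v) (rep (weakDeriv v)) := hv.isDeriv.1.isC1_rep hv.isDeriv.2
  have hFD := ((hCv.mul hCv).mul hC.star).isDeriv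
  have hb := hu.isDeriv.2.add hv.isDeriv.2
  have ibp := hFD.real_inner_eq hb
  have huv : u - v = toL2 (rep u - rep v) := by rw [map_sub, hu.toL2_rep, hv.toL2_rep]
  have e2 : inner ℝ (toL2 (rep v * rep v * star (rep u - rep v)))
      (weakDeriv (weakDeriv u) + weakDeriv (weakDeriv v))
      = inner ℝ (u - v)
        (mulL (rep v * rep v) (conjL (weakDeriv (weakDeriv u) + weakDeriv (weakDeriv v)))) := by
    rw [← mulL_toL2, real_inner_mulL_left, ← conjL_toL2, real_inner_conjL_left, conjL_mulL, star_star,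
      ← huv]
  rw [e2] at ibp
  have e3 : weakDeriv u + weakDeriv v = toL2 (rep (weakDeriv u) + rep (weakDeriv v)) := by
    rw [map_add, hu.toL2_rep_weakDeriv, hv.toL2_rep_weakDeriv]
  rw [e3, inner_toL2_eq_one] at ibp
  rw [inner_sub_right, inner_sub_right, ← neg_eq_iff_eq_neg.mpr ibp]
  have e4 : inner ℝ (u - v) (toL2 ((rep (weakDeriv v) * rep v + rep v * rep (weakDeriv v))
          * star (rep (weakDeriv u) + rep (weakDeriv v))))
      = inner ℝ (toL2 1) (toL2 ((star (rep (weakDeriv v) * rep v + rep v * rep (weakDeriv v))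
          * (rep u - rep v)) * (rep (weakDeriv u) + rep (weakDeriv v)))) := by
    have h1 : toL2 ((rep (weakDeriv v) * rep v + rep v * rep (weakDeriv v))
          * star (rep (weakDeriv u) + rep (weakDeriv v)))
        = conjL (toL2 (star (rep (weakDeriv v) * rep v + rep v * rep (weakDeriv v))
          * (rep (weakDeriv u) + rep (weakDeriv v)))) := by
      rw [conjL_toL2, star_mul', star_star]
    rw [h1, ← real_inner_conjL_left, huv, conjL_toL2, inner_toL2_eq_one, star_star]
    congr 2; ring
  rw [e4, huv, inner_toL2_eq_one]
  unfold corr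
  rw [inner_toL2_eq_one, inner_toL2_eq_one (rep v * rep v * _), sub_neg_eq_add, ← inner_add_right,
    ← inner_sub_right, ← inner_sub_right, ← map_add, ← map_sub, ← map_sub]
  congr 2
  simp only [star_mul', star_add, star_sub, star_star]
  ring

lemma MemY.hasDerivAt_corr (hY : MemY w) {s : ℝ} {w' : L2per L} (hw : HasDerivAt w w' s) :
    HasDerivAt (fun t => corr (w t)) (inner ℝ w' (corrGrad (w s))) s := by
  refine hasDerivAt_of_increment (J := fun t => corr (w t))
    (P := fun t => toL2 ((star (rep (w t)) + star (rep (w s))) * rep (weakDeriv (w t)) * rep (weakDeriv (w t)))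
        - mulL (rep (w s) * rep (w s)) (conjL (weakDeriv (weakDeriv (w t)) + weakDeriv (weakDeriv (w s))))
        - toL2 ((rep (weakDeriv (w s)) * rep (w s) + rep (w s) * rep (weakDeriv (w s)))
          * star (rep (weakDeriv (w t)) + rep (weakDeriv (w s))))) hw ?_
    (fun t => corr_sub (hY.memH2 t) (hY.memH2 s))
  have h1 := hY.continuous_rep
  have h2 := hY.continuous_rep_weakDeriv
  have h3 := hY.continuous_weakDeriv_weakDeriv
  refine Continuous.tendsto (Continuous.sub (Continuous.sub ?_ ?_) ?_) s
  · exact toL2.continuous.comp (((h1.star.add continuous_const).mul h2).mul h2)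
  · exact (mulL _).continuous.comp (conjL.continuous.comp (h3.add continuous_const))
  · exact toL2.continuous.comp (continuous_const.mul (h2.add continuous_const).star)

end Trajectory

/-! ### The nonlinear terms -/

lemma norm_cubic_le (u : L2per L) : ‖cubic u‖ ≤ ‖rep u‖ ^ 2 * ‖u‖ := by
  refine (norm_mulL_le _ _).trans ?_
  gcongr
  refine (norm_mul_le _ _).trans ?_
  rw [norm_star, pow_two]

lemma abs_corr_le {u : L2per L} (hu : MemH2 u) : |corr u| ≤ ‖rep u‖ ^ 2 * ‖weakDeriv u‖ ^ 2 := by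
  unfold corr
  refine (abs_real_inner_le_norm _ _).trans ?_
  rw [← mulL_toL2, ← conjL_toL2, hu.toL2_rep_weakDeriv]
  have h1 := norm_mulL_le (rep u * rep u) (conjL (weakDeriv u))
  have h2 := norm_mul_le (rep u) (rep u)
  rw [norm_conjL] at h1
  calc ‖mulL (rep u * rep u) (conjL (weakDeriv u))‖ * ‖weakDeriv u‖
      ≤ (‖rep u‖ * ‖rep u‖ * ‖weakDeriv u‖) * ‖weakDeriv u‖ := by gcongr; exact h1.trans (by gcongr)
    _ = _ := by ring

/-- The operator `h ↦ u² h̄`, which is symmetric for the real inner product. -/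
def sqConj (u h : L2per L) : L2per L := mulL (rep u * rep u) (conjL h)

lemma norm_sqConj_le (u h : L2per L) : ‖sqConj u h‖ ≤ ‖rep u‖ ^ 2 * ‖h‖ := by
  refine (norm_mulL_le _ _).trans ?_
  rw [norm_conjL, pow_two]
  gcongr
  exact norm_mul_le _ _

lemma sqConj_I_smul (u h : L2per L) : sqConj u (Complex.I • h) = -(Complex.I • sqConj u h) := by
  unfold sqConj
  rw [conjL_smul, Complex.conj_I, neg_smul, map_neg, map_smul]

lemma sqConj_sub (u g h : L2per L) : sqConj u (g - h) = sqConj u g - sqConj u h := by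
  unfold sqConj; rw [map_sub, map_sub]

lemma norm_cubicDeriv_le (u h : L2per L) : ‖cubicDeriv u h‖ ≤ 3 * ‖rep u‖ ^ 2 * ‖h‖ := by
  unfold cubicDeriv
  have h1 := norm_mulL_le (star (rep u) * (rep u + rep u)) h
  have h2 := norm_sqConj_le u h
  have h3 : ‖star (rep u) * (rep u + rep u)‖ ≤ 2 * ‖rep u‖ ^ 2 := by
    refine (norm_mul_le _ _).trans ?_
    rw [norm_star]
    nlinarith [norm_add_le (rep u) (rep u), norm_nonneg (rep u)]
  have h4 : ‖star (rep u) * (rep u + rep u)‖ * ‖h‖ ≤ 2 * ‖rep u‖ ^ 2 * ‖h‖ := by gcongr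
  refine (norm_add_le _ _).trans ?_
  unfold sqConj at h2
  linarith

lemma cubicDeriv_sub (u g h : L2per L) : cubicDeriv u (g - h) = cubicDeriv u g - cubicDeriv u h := by
  unfold cubicDeriv; rw [map_sub, map_sub, map_sub]; abel

/-- The part `2 |u|² h` of the derivative of the cubic term does not contribute to `⟨h, · i h⟩`. -/
lemma inner_cubicDeriv_I_smul (u h : L2per L) :
    inner ℝ h (cubicDeriv u (Complex.I • h)) = -inner ℝ h (Complex.I • sqConj u h) := by
  have h1 : cubicDeriv u (Complex.I • h)
      = Complex.I • mulL (star (rep u) * (rep u + rep u)) h - Complex.I • sqConj u h := by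
    have := sqConj_I_smul u h
    unfold cubicDeriv
    unfold sqConj at this ⊢
    rw [this, map_smul, sub_eq_add_neg]
  have h2 : inner ℝ h (Complex.I • mulL (star (rep u) * (rep u + rep u)) h) = 0 := by
    have e1 : inner ℝ h (Complex.I • mulL (star (rep u) * (rep u + rep u)) h)
        = - inner ℝ (Complex.I • h) (mulL (star (rep u) * (rep u + rep u)) h) := by
      rw [real_inner_I_smul_left, neg_neg]
    have e2 : star (star (rep u) * (rep u + rep u)) = star (rep u) * (rep u + rep u) := by
      simp only [star_mul', star_add, star_star]; ring
    have e3 := real_inner_mulL_left (star (rep u) * (rep u + rep u)) h (Complex.I • h)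
    rw [e2, map_smul, real_inner_comm] at e3
    linarith
  rw [h1, inner_sub_right, h2, zero_sub]

/-- The part of `corrGrad` that involves only first-order derivatives. -/
def corrGradLow (u : L2per L) : L2per L :=
  toL2 ((star (rep u) + star (rep u)) * rep (weakDeriv u) * rep (weakDeriv u))
    - toL2 ((rep (weakDeriv u) * rep u + rep u * rep (weakDeriv u))
        * star (rep (weakDeriv u) + rep (weakDeriv u)))

lemma corrGrad_eq (u : L2per L) :
    corrGrad u = corrGradLow u - (2 : ℝ) • sqConj u (weakDeriv (weakDeriv u)) := by
  unfold corrGrad corrGradLow sqConj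
  rw [two_smul, map_add conjL, map_add (mulL _)]; abel

lemma norm_corrGradLow_le {u : L2per L} (hu : MemH2 u) :
    ‖corrGradLow u‖ ≤ 6 * ‖rep u‖ * ‖rep (weakDeriv u)‖ * ‖weakDeriv u‖ := by
  unfold corrGradLow
  have e1 : toL2 ((star (rep u) + star (rep u)) * rep (weakDeriv u) * rep (weakDeriv u))
      = mulL ((star (rep u) + star (rep u)) * rep (weakDeriv u)) (weakDeriv u) := by
    rw [← mulL_toL2, hu.toL2_rep_weakDeriv]
  have e2 : toL2 ((rep (weakDeriv u) * rep u + rep u * rep (weakDeriv u))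
        * star (rep (weakDeriv u) + rep (weakDeriv u)))
      = mulL (rep (weakDeriv u) * rep u + rep u * rep (weakDeriv u))
        (conjL (weakDeriv u + weakDeriv u)) := by
    rw [← mulL_toL2, ← conjL_toL2, map_add toL2, hu.toL2_rep_weakDeriv]
  rw [e1, e2]
  have a := norm_nonneg (rep u)
  have b := norm_nonneg (rep (weakDeriv u))
  have h1 := norm_mulL_le ((star (rep u) + star (rep u)) * rep (weakDeriv u)) (weakDeriv u)
  have h2 := norm_mulL_le (rep (weakDeriv u) * rep u + rep u * rep (weakDeriv u))
        (conjL (weakDeriv u + weakDeriv u))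
  rw [norm_conjL] at h2
  have h3 : ‖(star (rep u) + star (rep u)) * rep (weakDeriv u)‖
      ≤ 2 * ‖rep u‖ * ‖rep (weakDeriv u)‖ := by
    refine (norm_mul_le _ _).trans ?_
    gcongr
    refine (norm_add_le _ _).trans ?_
    rw [norm_star]; linarith
  have h4 : ‖rep (weakDeriv u) * rep u + rep u * rep (weakDeriv u)‖
      ≤ 2 * ‖rep u‖ * ‖rep (weakDeriv u)‖ := by
    refine (norm_add_le _ _).trans ?_
    have i1 := norm_mul_le (rep (weakDeriv u)) (rep u)
    have i2 := norm_mul_le (rep u) (rep (weakDeriv u))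
    linarith
  have h5 : ‖weakDeriv u + weakDeriv u‖ ≤ 2 * ‖weakDeriv u‖ :=
    (norm_add_le _ _).trans (by linarith)
  have h6 : ‖(star (rep u) + star (rep u)) * rep (weakDeriv u)‖ * ‖weakDeriv u‖
      ≤ 2 * ‖rep u‖ * ‖rep (weakDeriv u)‖ * ‖weakDeriv u‖ := by gcongr
  have h7 : ‖rep (weakDeriv u) * rep u + rep u * rep (weakDeriv u)‖ * ‖weakDeriv u + weakDeriv u‖
      ≤ 2 * ‖rep u‖ * ‖rep (weakDeriv u)‖ * (2 * ‖weakDeriv u‖) := by gcongr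
  refine (norm_sub_le _ _).trans ?_
  linarith

/-! ### The equation and its balances -/

section Solution

variable {γ μ : ℝ} {m : ℕ} {f : L2per L} {v w : ℝ → L2per L}

/-- The residual `u_xx + |u|² u - f - i μ b` of the equation; at a solution `w`, with `b = v`, it
equals `-i (w_s + γ w + μ P_m w)`. -/
def resid (μ : ℝ) (f u b : L2per L) : L2per L :=
  weakDeriv (weakDeriv u) + cubic u - f - Complex.I • (μ • b)

/-- The linear damping `γ u + μ P_m u`. -/
def damp (γ μ : ℝ) (m : ℕ) (u : L2per L) : L2per L := γ • u + μ • Pm m u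

lemma coeFn_cubic {u : L2per L} (hu : MemH2 u) :
    cubic u =ᵐ[volume] fun x => ((‖u x‖ ^ 2 : ℝ) : ℂ) * u x := by
  have h1 := coeFn_toL2 (rep u)
  rw [hu.toL2_rep] at h1
  filter_upwards [coeFn_mulL (rep u * star (rep u)) u, h1] with x h2 h3
  unfold cubic
  rw [h2, h3, ← Complex.normSq_eq_norm_sq, ← Complex.mul_conj]
  rfl

/-- The equation, solved for `w_s`. -/
lemma IsBoundedSolution.deriv_eq (hw : IsBoundedSolution γ μ m f v w) (s : ℝ) :
    deriv w s = Complex.I • resid μ f (w s) (v s) - damp γ μ m (w s) := by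
  have key : Complex.I • deriv w s + weakDeriv (weakDeriv (w s)) + cubic (w s)
      + (Complex.I * (γ : ℂ)) • w s = f - (Complex.I * (μ : ℂ)) • (Pm m (w s) - v s) := by
    apply Lp.ext
    filter_upwards [hw.equation s, coeFn_cubic (hw.memY.memH2 s),
      Lp.coeFn_add (Complex.I • deriv w s + weakDeriv (weakDeriv (w s)) + cubic (w s))
        ((Complex.I * (γ : ℂ)) • w s),
      Lp.coeFn_add (Complex.I • deriv w s + weakDeriv (weakDeriv (w s))) (cubic (w s)),
      Lp.coeFn_add (Complex.I • deriv w s) (weakDeriv (weakDeriv (w s))),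
      Lp.coeFn_smul Complex.I (deriv w s), Lp.coeFn_smul (Complex.I * (γ : ℂ)) (w s),
      Lp.coeFn_sub f ((Complex.I * (μ : ℂ)) • (Pm m (w s) - v s)),
      Lp.coeFn_smul (Complex.I * (μ : ℂ)) (Pm m (w s) - v s),
      Lp.coeFn_sub (Pm m (w s)) (v s)] with x h0 h1 h2 h3 h4 h5 h6 h7 h8 h9
    rw [h2, Pi.add_apply, h3, Pi.add_apply, h4, Pi.add_apply, h5, h6, h7, Pi.sub_apply, h8,
      Pi.smul_apply, Pi.smul_apply, Pi.smul_apply, h9, Pi.sub_apply, h1]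
    simpa only [smul_eq_mul] using h0
  have h2 := congrArg (fun u => Complex.I • u) key
  simp only [smul_add, smul_sub, smul_smul, ← mul_assoc, Complex.I_mul_I] at h2
  unfold resid damp
  have hr : ∀ (a : ℝ) (u : L2per L), a • u = (a : ℂ) • u := fun a u => (RCLike.real_smul_eq_coe_smul a u)
  simp only [hr, smul_add, smul_sub, smul_smul, ← mul_assoc, Complex.I_mul_I]
  simp only [neg_mul, one_mul, neg_smul, one_smul, sub_neg_eq_add] at h2 ⊢
  linear_combination (norm := module) (-1 : ℂ) • h2

lemma real_inner_I_smul_cubic (u : L2per L) :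
    inner ℝ u (Complex.I • cubic u) = 0 := by
  have e1 := real_inner_mulL_left (rep u * star (rep u)) u (Complex.I • u)
  rw [star_mul', star_star, mul_comm (star (rep u)), map_smul, real_inner_comm,
    real_inner_I_smul_left] at e1
  unfold cubic
  linarith

lemma IsDeriv.real_inner_I_smul_eq_zero {u u' u'' : L2per L} (h : IsDeriv u u') (h' : IsDeriv u' u'') :
    inner ℝ u (Complex.I • u'') = 0 := by
  have e : inner ℂ u u'' = -inner ℂ u' u' := by rw [h.inner_eq h', neg_neg]
  rw [real_inner_eq_re, inner_smul_right, e, inner_self_eq_norm_sq_to_K]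
  have : ((‖u'‖ : ℂ) ^ 2).im = 0 := by rw [← Complex.ofReal_pow, Complex.ofReal_im]
  simp [this]

lemma MemX.real_inner_Pm (hv : MemX m v) (u : L2per L) (s : ℝ) :
    inner ℝ (Pm m u) (v s) = inner ℝ u (v s) := by
  rw [real_inner_Pm_left, Pm_of_mem (hv.mem_Hm s)]

lemma MemX.real_inner_Pm_I (hv : MemX m v) (u : L2per L) (s : ℝ) :
    inner ℝ (Pm m u) (Complex.I • v s) = inner ℝ u (Complex.I • v s) := by
  rw [real_inner_Pm_left, map_smul, Pm_of_mem (hv.mem_Hm s)]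

lemma IsBoundedSolution.hasDerivAt (hw : IsBoundedSolution γ μ m f v w) (s : ℝ) :
    HasDerivAt w (deriv w s) s := (hw.differentiable s).hasDerivAt

lemma MemX.hasDerivAt (hv : MemX m v) (s : ℝ) : HasDerivAt v (deriv v s) s :=
  (hv.contDiff.differentiable (by simp) s).hasDerivAt

/-- The balance of the `L²` norm. -/
lemma IsBoundedSolution.hasDerivAt_norm_sq (hw : IsBoundedSolution γ μ m f v w) (hv : MemX m v)
    (s : ℝ) :
    HasDerivAt (fun t => ‖w t‖ ^ 2)
      (2 * (-γ * ‖w s‖ ^ 2 - μ * ‖Pm m (w s)‖ ^ 2 - inner ℝ (w s) (Complex.I • f)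
        + μ * inner ℝ (Pm m (w s)) (v s))) s := by
  refine (hw.hasDerivAt s).norm_sq.congr_deriv ?_
  have h2 := hw.memY.memH2 s
  rw [hw.deriv_eq s]
  unfold resid damp
  rw [smul_sub, smul_sub, smul_add, smul_smul, Complex.I_mul_I, neg_one_smul]
  simp only [inner_sub_right, inner_add_right, inner_neg_right, real_inner_smul_right]
  rw [h2.isDeriv.1.real_inner_I_smul_eq_zero h2.isDeriv.2, real_inner_I_smul_cubic (w s),
    hv.real_inner_Pm, real_inner_self_eq_norm_sq]
  have : inner ℝ (w s) (Pm m (w s)) = ‖Pm m (w s)‖ ^ 2 := by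
    rw [← real_inner_self_eq_norm_sq, real_inner_Pm_left, Pm_Pm]
  rw [this]; ring

/-- The first-order energy
`‖u_x‖² - ½ ∫ |u|⁴ + 2 Re ⟨f, u⟩ + 2 μ Re ⟨u, i b⟩`, with gradient `-2 resid μ f u b` in `u`. -/
def energy (μ : ℝ) (f u b : L2per L) : ℝ :=
  ‖weakDeriv u‖ ^ 2 - 1 / 2 * inner ℝ (cubic u) u + 2 * inner ℝ f u + 2 * (μ * inner ℝ u (Complex.I • b))

/-- The balance of the first-order energy. -/
lemma IsBoundedSolution.hasDerivAt_energy (hw : IsBoundedSolution γ μ m f v w) (hv : MemX m v)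
    (s : ℝ) :
    HasDerivAt (fun t => energy μ f (w t) (v t))
      (2 * γ * (-‖weakDeriv (w s)‖ ^ 2 + inner ℝ (cubic (w s)) (w s) - inner ℝ f (w s)
          - μ * inner ℝ (w s) (Complex.I • v s))
        + 2 * μ * (-‖Pm m (weakDeriv (w s))‖ ^ 2 + inner ℝ (cubic (w s)) (Pm m (w s))
          - inner ℝ f (Pm m (w s)) - μ * inner ℝ (w s) (Complex.I • v s))
        + 2 * μ * inner ℝ (w s) (Complex.I • deriv v s)) s := by
  have hY := hw.memY
  have h2 := hY.memH2 s
  have hd := hw.hasDerivAt s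
  have hvd : HasDerivAt (fun t => Complex.I • v t) (Complex.I • deriv v s) s :=
    (hv.hasDerivAt s).const_smul Complex.I
  have D1 := hY.hasDerivAt_norm_sq_weakDeriv hd
  have D2 := (hY.hasDerivAt_inner_cubic hd).const_mul (1 / 2 : ℝ)
  have D3 := ((hasDerivAt_const s f).inner ℝ hd).const_mul (2 : ℝ)
  have D4 := ((hd.inner ℝ hvd).const_mul μ).const_mul (2 : ℝ)
  refine (((D1.sub D2).add D3).add D4).congr_deriv ?_
  have hg : inner ℝ (deriv w s) (resid μ f (w s) (v s))
      = -inner ℝ (damp γ μ m (w s)) (resid μ f (w s) (v s)) := by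
    conv_lhs => rw [hw.deriv_eq s]
    rw [inner_sub_left, real_inner_I_smul_self, zero_sub]
  have hA : inner ℝ (w s) (weakDeriv (weakDeriv (w s))) = -‖weakDeriv (w s)‖ ^ 2 := by
    rw [← real_inner_self_eq_norm_sq, h2.isDeriv.1.real_inner_eq h2.isDeriv.2, neg_neg]
  have hPA : inner ℝ (Pm m (w s)) (weakDeriv (weakDeriv (w s))) = -‖Pm m (weakDeriv (w s))‖ ^ 2 := by
    have e := (h2.isDeriv.1.Pm m).real_inner_eq h2.isDeriv.2
    have e2 : inner ℝ (Pm m (weakDeriv (w s))) (weakDeriv (w s)) = ‖Pm m (weakDeriv (w s))‖ ^ 2 := by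
      rw [← real_inner_self_eq_norm_sq, real_inner_Pm_left m (weakDeriv (w s)) (Pm m _), Pm_Pm,
        real_inner_Pm_left]
    linarith
  unfold resid damp at hg
  have hm : Complex.I • (μ • v s) = μ • (Complex.I • v s) := smul_comm _ _ _
  rw [hm] at hg
  simp only [inner_sub_right, inner_add_right, inner_add_left, real_inner_smul_right,
    real_inner_smul_left, hA, hPA, hv.real_inner_Pm_I] at hg
  rw [inner_zero_left, real_inner_comm (deriv w s) f]
  rw [real_inner_comm (w s) (cubic (w s)), real_inner_comm (Pm m (w s)) (cubic (w s)),
    real_inner_comm (w s) f, real_inner_comm (Pm m (w s)) f]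
  linear_combination (-2) * hg

/-- The second-order energy `½ (‖Z‖² + Re ∫ ū² u_x²)`, where `Z` is the residual. The correction
removes from the balance of `‖Z‖²` the term that is quadratic in `u_xx`. -/
def energyTwo (μ : ℝ) (f u b : L2per L) : ℝ := 1 / 2 * (‖resid μ f u b‖ ^ 2 + corr u)

lemma IsBoundedSolution.continuous_resid (hw : IsBoundedSolution γ μ m f v w) (hv : MemX m v) :
    Continuous fun s => resid μ f (w s) (v s) := by
  have h1 := hw.memY.continuous_weakDeriv_weakDeriv
  have h2 : Continuous fun s => cubic (w s) := by
    have : Differentiable ℝ fun s => cubic (w s) := fun s =>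
      (hw.memY.hasDerivAt_cubic (hw.hasDerivAt s)).differentiableAt
    exact this.continuous
  have h3 : Continuous v := hv.contDiff.continuous
  unfold resid
  fun_prop

/-- The balance of `‖Z‖²` for the residual `Z`. As `w_s = i Z - damp w`, formally
`Z_s = i Z_xx - (damp w)_xx + (|w|² w)_s - i μ v_s`; the term `Z_xx`, which need not be
square-integrable, is only used mode by mode. -/
lemma IsBoundedSolution.hasDerivAt_norm_sq_resid (hw : IsBoundedSolution γ μ m f v w)
    (hv : MemX m v) (s : ℝ) :
    HasDerivAt (fun t => ‖resid μ f (w t) (v t)‖ ^ 2)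
      (2 * inner ℝ (resid μ f (w s) (v s))
        (-(γ • weakDeriv (weakDeriv (w s)) + μ • Pm m (weakDeriv (weakDeriv (w s))))
          + cubicDeriv (w s) (deriv w s) - Complex.I • (μ • deriv v s))) s := by
  have hY := hw.memY
  have hcw := hY.continuous_self
  have hcA := hY.continuous_weakDeriv_weakDeriv
  have hcZ := hw.continuous_resid hv
  have hcv' : Continuous (deriv v) := hv.contDiff.continuous_deriv le_rfl
  have hcw' : Continuous (deriv w) := by
    have : deriv w = fun s => Complex.I • resid μ f (w s) (v s) - damp γ μ m (w s) :=
      funext hw.deriv_eq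
    rw [this]
    unfold damp
    fun_prop
  refine hasDerivAt_norm_sq_of_modes (lam := fun k => (2 * Real.pi * k / L) ^ 2)
    (g := fun s => -(γ • weakDeriv (weakDeriv (w s)) + μ • Pm m (weakDeriv (weakDeriv (w s))))
          + cubicDeriv (w s) (deriv w s) - Complex.I • (μ • deriv v s)) hcZ ?_ ?_ s
  · have hW := hY.continuous_rep
    have h1 : Continuous fun s => cubicDeriv (w s) (deriv w s) := by
      unfold cubicDeriv
      exact ((mulL.continuous.comp (hW.star.mul (hW.add hW))).clm_apply hcw').add
        ((mulL.continuous.comp (hW.mul hW)).clm_apply (conjL.continuous.comp hcw'))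
    fun_prop
  · intro k s
    have hsym : symb L k * symb L k = -(((2 * Real.pi * k / L) ^ 2 : ℝ) : ℂ) := by
      unfold symb
      push_cast
      have := Complex.I_sq
      linear_combination (2 * Real.pi * k / L) ^ 2 * this
    have hco : ∀ {u : ℝ → L2per L} {u' : L2per L}, HasDerivAt u u' s →
        HasDerivAt (fun t => coef (u t) k) (coef u' k) s := fun hu => by
      have := (hasDerivAt_const s (modeBasis L k)).inner ℂ hu
      simpa [coef] using this
    have hA : ∀ t, coef (weakDeriv (weakDeriv (w t))) k = symb L k * symb L k * coef (w t) k :=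
      fun t => by rw [(hY.memH2 t).isDeriv.2 k, (hY.memH2 t).isDeriv.1 k]; ring
    have D1 := (hco (hw.hasDerivAt s)).const_mul (symb L k * symb L k)
    have D2 := hco (((hY.hasDerivAt_cubic (hw.hasDerivAt s)).sub_const f).sub
      (((hv.hasDerivAt s).const_smul μ).const_smul Complex.I))
    have hZ : (fun t => coef (resid μ f (w t) (v t)) k) = fun t => symb L k * symb L k * coef (w t) k
        + coef (cubic (w t) - f - Complex.I • (μ • v t)) k := by
      ext t
      rw [← hA, ← coef_add]
      unfold resid
      congr 1; abel
    rw [hZ]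
    refine (D1.add D2).congr_deriv ?_
    have hr : ∀ (a : ℝ) (u : L2per L), coef (a • u) k = (a : ℂ) * coef u k := fun a u => by
      rw [← coef_smul]; rfl
    have hPA : coef (Pm m (weakDeriv (weakDeriv (w s)))) k
        = symb L k * symb L k * coef (Pm m (w s)) k := by
      rw [((hY.memH2 s).isDeriv.2.Pm m) k, ((hY.memH2 s).isDeriv.1.Pm m) k]; ring
    have hw' : coef (deriv w s) k = Complex.I * coef (resid μ f (w s) (v s)) k
        - (γ * coef (w s) k + μ * coef (Pm m (w s)) k) := by
      conv_lhs => rw [hw.deriv_eq s]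
      unfold damp
      rw [coef_sub, coef_smul, coef_add, hr, hr]
    have hneg : ∀ u : L2per L, coef (-u) k = -coef u k := fun u => inner_neg_right _ _
    rw [coef_sub, coef_sub, coef_add, hneg, coef_add, hr, hr, coef_smul, hr, hPA, hA]
    linear_combination (symb L k * symb L k) * hw' + Complex.I * coef (resid μ f (w s) (v s)) k * hsym

/-- The balance of the second-order energy. -/
lemma IsBoundedSolution.hasDerivAt_energyTwo (hw : IsBoundedSolution γ μ m f v w)
    (hv : MemX m v) (s : ℝ) :
    HasDerivAt (fun t => energyTwo μ f (w t) (v t))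
      (-γ * inner ℝ (resid μ f (w s) (v s)) (weakDeriv (weakDeriv (w s)))
        - μ * inner ℝ (resid μ f (w s) (v s)) (Pm m (weakDeriv (weakDeriv (w s))))
        - inner ℝ (resid μ f (w s) (v s)) (cubicDeriv (w s) (damp γ μ m (w s)))
        - μ * inner ℝ (resid μ f (w s) (v s)) (Complex.I • deriv v s)
        - inner ℝ (resid μ f (w s) (v s))
          (Complex.I • sqConj (w s) (resid μ f (w s) (v s) - weakDeriv (weakDeriv (w s))))
        + inner ℝ (damp γ μ m (w s)) (sqConj (w s) (weakDeriv (weakDeriv (w s))))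
        + 1 / 2 * inner ℝ (deriv w s) (corrGradLow (w s))) s := by
  have D1 := hw.hasDerivAt_norm_sq_resid hv s
  have D2 := hw.memY.hasDerivAt_corr (hw.hasDerivAt s)
  refine ((D1.add D2).const_mul (1 / 2 : ℝ)).congr_deriv ?_
  have h1 : inner ℝ (deriv w s) (corrGrad (w s)) = inner ℝ (deriv w s) (corrGradLow (w s))
      + 2 * inner ℝ (resid μ f (w s) (v s)) (Complex.I • sqConj (w s) (weakDeriv (weakDeriv (w s))))
      + 2 * inner ℝ (damp γ μ m (w s)) (sqConj (w s) (weakDeriv (weakDeriv (w s)))) := by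
    rw [corrGrad_eq, inner_sub_right, real_inner_smul_right]
    have : inner ℝ (deriv w s) (sqConj (w s) (weakDeriv (weakDeriv (w s))))
      = -inner ℝ (resid μ f (w s) (v s)) (Complex.I • sqConj (w s) (weakDeriv (weakDeriv (w s))))
        - inner ℝ (damp γ μ m (w s)) (sqConj (w s) (weakDeriv (weakDeriv (w s)))) := by
      conv_lhs => rw [hw.deriv_eq s]
      rw [inner_sub_left, real_inner_I_smul_left]
    rw [this]; ring
  have h2 : inner ℝ (resid μ f (w s) (v s)) (cubicDeriv (w s) (deriv w s))
      = -inner ℝ (resid μ f (w s) (v s)) (Complex.I • sqConj (w s) (resid μ f (w s) (v s)))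
        - inner ℝ (resid μ f (w s) (v s)) (cubicDeriv (w s) (damp γ μ m (w s))) := by
    conv_lhs => rw [hw.deriv_eq s]
    rw [cubicDeriv_sub, inner_sub_right, inner_cubicDeriv_I_smul]
  have hm : Complex.I • (μ • deriv v s) = μ • (Complex.I • deriv v s) := smul_comm _ _ _
  rw [h1, hm, sqConj_sub, smul_sub]
  simp only [inner_sub_right, inner_add_right, inner_neg_right, real_inner_smul_right, h2]
  ring

end Solution

/-! ### The `L²` estimates -/

section Bounds

variable {γ μ : ℝ} {m : ℕ} {f : L2per L} {v w : ℝ → L2per L}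

lemma MemX.norm_add_le_xNorm (hv : MemX m v) (s t : ℝ) : ‖v s‖ + ‖deriv v t‖ ≤ xNorm v := by
  obtain ⟨M, hM⟩ := hv.bounded
  obtain ⟨M', hM'⟩ := hv.bounded_deriv
  exact add_le_add (le_ciSup (f := fun s => ‖v s‖) ⟨M, by rintro _ ⟨s, rfl⟩; exact hM s⟩ s)
    (le_ciSup (f := fun s => ‖deriv v s‖) ⟨M', by rintro _ ⟨s, rfl⟩; exact hM' s⟩ t)

lemma MemX.norm_le (hv : MemX m v) (s : ℝ) : ‖v s‖ ≤ xNorm v := by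
  have := hv.norm_add_le_xNorm s s
  linarith [norm_nonneg (deriv v s)]

lemma MemX.norm_deriv_le (hv : MemX m v) (s : ℝ) : ‖deriv v s‖ ≤ xNorm v := by
  have := hv.norm_add_le_xNorm s s
  linarith [norm_nonneg (v s)]

lemma MemX.xNorm_nonneg (hv : MemX m v) : 0 ≤ xNorm v := (norm_nonneg _).trans (hv.norm_le 0)

lemma abs_real_inner_I_smul_le (a b : L2per L) : |inner ℝ a (Complex.I • b)| ≤ ‖a‖ * ‖b‖ := by
  have := abs_real_inner_le_norm a (Complex.I • b)
  rwa [norm_smul, Complex.norm_I, one_mul] at this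

/-- The `L²` bound without smallness of the high modes: only `γ` damps all of `w`. -/
lemma IsBoundedSolution.norm_le_R0Tilde (hw : IsBoundedSolution γ μ m f v w) (hv : MemX m v)
    (hγ : 0 < γ) (hμ : 0 ≤ μ) (s : ℝ) : ‖w s‖ ≤ R0Tilde γ ‖f‖ (xNorm v) μ := by
  have hV := hv.xNorm_nonneg
  obtain ⟨M, hM⟩ := hw.memY.bounded
  have key : ‖w s‖ ^ 2 ≤ (‖f‖ ^ 2 / γ + μ * xNorm v ^ 2) / γ := by
    refine le_div_of_deriv_add_le (y := fun t => ‖w t‖ ^ 2) (M := M ^ 2) hγ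
      (hw.hasDerivAt_norm_sq hv) (fun t => ?_) (fun t => ?_) s
    · exact pow_le_pow_left₀ (norm_nonneg _) ((norm_le_h2Norm _).trans (hM t)) 2
    · have h1 := neg_le_of_abs_le (abs_real_inner_I_smul_le (w t) f)
      have h2 := real_inner_le_norm (Pm m (w t)) (v t)
      have h3 : ‖Pm m (w t)‖ * ‖v t‖ ≤ ‖Pm m (w t)‖ * xNorm v := by
        gcongr; exact hv.norm_le t
      have h4 : 2 * (‖w t‖ * ‖f‖) ≤ γ * ‖w t‖ ^ 2 + ‖f‖ ^ 2 / γ := by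
        have : γ * ‖w t‖ ^ 2 + ‖f‖ ^ 2 / γ - 2 * (‖w t‖ * ‖f‖) = (γ * ‖w t‖ - ‖f‖) ^ 2 / γ := by
          field_simp; ring
        have : 0 ≤ (γ * ‖w t‖ - ‖f‖) ^ 2 / γ := by positivity
        linarith
      have h5 : μ * (2 * inner ℝ (Pm m (w t)) (v t)) ≤ μ * (‖Pm m (w t)‖ ^ 2 + xNorm v ^ 2) := by
        gcongr
        nlinarith [sq_nonneg (‖Pm m (w t)‖ - xNorm v)]
      have h6 : 0 ≤ μ * ‖Pm m (w t)‖ ^ 2 := by positivity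
      linarith
  refine le_of_sq_le_sq (key.trans ?_) (by unfold R0Tilde; positivity)
  have e1 : (√μ / √γ) ^ 2 = μ / γ := by rw [div_pow, Real.sq_sqrt hμ, Real.sq_sqrt hγ.le]
  have e2 : (‖f‖ ^ 2 / γ + μ * xNorm v ^ 2) / γ = (‖f‖ / γ) ^ 2 + (√μ / √γ) ^ 2 * xNorm v ^ 2 := by
    rw [e1]; field_simp
  have e3 : 0 ≤ ‖f‖ / γ * (√μ / √γ * xNorm v) := by positivity
  rw [e2]
  unfold R0Tilde
  nlinarith

/-- Once the high modes are at most `1`, the damping of the low modes acts on all of `w`. -/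
lemma IsBoundedSolution.norm_le_R0 (hw : IsBoundedSolution γ μ m f v w) (hv : MemX m v)
    (hγ : 0 < γ) (hμ : 0 ≤ μ) (hQ : ∀ s, ‖w s - Pm m (w s)‖ ≤ 1) (s : ℝ) :
    ‖w s‖ ≤ R0 γ ‖f‖ (xNorm v) μ := by
  have hV := hv.xNorm_nonneg
  have hγμ : 0 < γ + μ := by linarith
  obtain ⟨M, hM⟩ := hw.memY.bounded
  have key : ‖w s‖ ^ 2 ≤ (‖f‖ ^ 2 / γ + μ * xNorm v ^ 2 + μ) / (γ + μ) := by
    refine le_div_of_deriv_add_le (y := fun t => ‖w t‖ ^ 2) (M := M ^ 2) hγμ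
      (hw.hasDerivAt_norm_sq hv) (fun t => ?_) (fun t => ?_) s
    · exact pow_le_pow_left₀ (norm_nonneg _) ((norm_le_h2Norm _).trans (hM t)) 2
    · have h1 := neg_le_of_abs_le (abs_real_inner_I_smul_le (w t) f)
      have h2 := real_inner_le_norm (Pm m (w t)) (v t)
      have h3 : ‖Pm m (w t)‖ * ‖v t‖ ≤ ‖Pm m (w t)‖ * xNorm v := by
        gcongr; exact hv.norm_le t
      have h4 : 2 * (‖w t‖ * ‖f‖) ≤ γ * ‖w t‖ ^ 2 + ‖f‖ ^ 2 / γ := by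
        have : γ * ‖w t‖ ^ 2 + ‖f‖ ^ 2 / γ - 2 * (‖w t‖ * ‖f‖) = (γ * ‖w t‖ - ‖f‖) ^ 2 / γ := by
          field_simp; ring
        have : 0 ≤ (γ * ‖w t‖ - ‖f‖) ^ 2 / γ := by positivity
        linarith
      have h5 : μ * (2 * inner ℝ (Pm m (w t)) (v t)) ≤ μ * (‖Pm m (w t)‖ ^ 2 + xNorm v ^ 2) := by
        gcongr
        nlinarith [sq_nonneg (‖Pm m (w t)‖ - xNorm v)]
      have h6 : μ * (‖w t‖ ^ 2 - 1) ≤ μ * ‖Pm m (w t)‖ ^ 2 := by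
        gcongr
        rw [norm_sq_Pm]
        have : ‖w t - Pm m (w t)‖ ^ 2 ≤ 1 := pow_le_one₀ (norm_nonneg _) (hQ t)
        linarith
      linarith
  refine le_of_sq_le_sq (key.trans ?_) (by unfold R0; positivity)
  have e1 : √(μ / (γ + μ)) ^ 2 = μ / (γ + μ) := Real.sq_sqrt (by positivity)
  have e0 : √(γ * (γ + μ)) ^ 2 = γ * (γ + μ) := Real.sq_sqrt (by positivity)
  have e2 : (‖f‖ ^ 2 / γ + μ * xNorm v ^ 2 + μ) / (γ + μ) = (‖f‖ / √(γ * (γ + μ))) ^ 2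
      + √(μ / (γ + μ)) ^ 2 * xNorm v ^ 2 + √(μ / (γ + μ)) ^ 2 := by
    rw [e1, div_pow, e0]; field_simp
  have e3 : 0 ≤ ‖f‖ / √(γ * (γ + μ)) * (√(μ / (γ + μ)) * xNorm v) := by positivity
  have e4 : 0 ≤ ‖f‖ / √(γ * (γ + μ)) * √(μ / (γ + μ)) := by positivity
  have e5 : 0 ≤ √(μ / (γ + μ)) * xNorm v * √(μ / (γ + μ)) := by positivity
  rw [e2]
  unfold R0
  nlinarith

/-! ### The `H¹` estimates -/

lemma inner_cubic_self_nonneg (u : L2per L) : 0 ≤ inner ℝ (cubic u) u := by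
  unfold cubic
  rw [← mulL_mulL, real_inner_mulL_left, real_inner_self_eq_norm_sq]
  positivity

lemma abs_inner_cubic_le {u g : L2per L} (h : IsDeriv u g) {R : ℝ} (hR : ‖u‖ ≤ R) {b : L2per L}
    (hb : ‖b‖ ≤ R) : |inner ℝ (cubic u) b| ≤ 1 / L * R ^ 4 + 2 * R ^ 3 * ‖g‖ := by
  have hL0 := hL.out
  have hR0 : 0 ≤ R := (norm_nonneg _).trans hR
  have h1 := norm_cubic_le u
  have h2 := h.norm_rep_sq_le
  have h3 : ‖rep u‖ ^ 2 ≤ R ^ 2 / L + 2 * R * ‖g‖ := h2.trans (by gcongr)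
  calc |inner ℝ (cubic u) b| ≤ ‖cubic u‖ * ‖b‖ := abs_real_inner_le_norm _ _
    _ ≤ ((R ^ 2 / L + 2 * R * ‖g‖) * R) * R := by
        gcongr
        exact h1.trans (by gcongr)
    _ = _ := by ring

lemma IsBoundedSolution.energy_le_of_bounded (hw : IsBoundedSolution γ μ m f v w)
    (hv : MemX m v) (hμ : 0 ≤ μ) : ∃ M, ∀ s, energy μ f (w s) (v s) ≤ M := by
  obtain ⟨M, hM⟩ := hw.memY.bounded
  refine ⟨M ^ 2 + 2 * (‖f‖ * M) + 2 * (μ * (M * xNorm v)), fun s => ?_⟩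
  have h1 : ‖w s‖ ≤ M := (norm_le_h2Norm _).trans (hM s)
  have h2 : ‖weakDeriv (w s)‖ ≤ M := ((hw.memY.memH2 s).norm_weakDeriv_le_h2Norm).trans (hM s)
  have hM0 := (norm_nonneg _).trans h1
  have h3 := inner_cubic_self_nonneg (w s)
  have h4 : inner ℝ f (w s) ≤ ‖f‖ * M := (real_inner_le_norm _ _).trans (by gcongr)
  have h5 : inner ℝ (w s) (Complex.I • v s) ≤ M * xNorm v :=
    (le_of_abs_le (abs_real_inner_I_smul_le _ _)).trans (by gcongr; exact hv.norm_le s)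
  have h6 : ‖weakDeriv (w s)‖ ^ 2 ≤ M ^ 2 := by gcongr
  have h7 : μ * inner ℝ (w s) (Complex.I • v s) ≤ μ * (M * xNorm v) := by gcongr
  unfold energy
  linarith

/-- The `H¹` bound that follows from an `L²` bound, without use of the damping by `P_m`. -/
lemma IsBoundedSolution.h1Norm_le_R1Of (hw : IsBoundedSolution γ μ m f v w) (hv : MemX m v)
    (hγ : 0 < γ) (hμ : 0 ≤ μ) {c R : ℝ} (hc : 1 / L + 2 ≤ c) (hR : ∀ s, ‖w s‖ ≤ R) (s : ℝ) :
    h1Norm (w s) ≤ R1Of c γ ‖f‖ (xNorm v) μ R := by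
  have hL0 := hL.out
  have hβ : 0 < 1 / L := by positivity
  have hR0 : 0 ≤ R := (norm_nonneg _).trans (hR 0)
  have hV := hv.xNorm_nonneg
  obtain ⟨M, hM⟩ := hw.energy_le_of_bounded hv hμ
  set F := ‖f‖ with hF
  have hF0 : 0 ≤ F := norm_nonneg f
  set V := xNorm v
  have hp : ∀ t, 1 / 2 * inner ℝ (cubic (w t)) (w t)
      ≤ 1 / 2 * c * R ^ 4 + R ^ 3 * ‖weakDeriv (w t)‖ := fun t => by
    have h := le_of_abs_le (abs_inner_cubic_le (hw.memY.memH2 t).isDeriv.1 (hR t) (hR t))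
    have h2 : 1 / L * R ^ 4 ≤ c * R ^ 4 := by gcongr; linarith
    linarith
  have ha : ∀ t, |inner ℝ f (w t)| ≤ F * R := fun t =>
    (abs_real_inner_le_norm _ _).trans (by gcongr; exact hR t)
  have hd : ∀ t, |inner ℝ f (Pm m (w t))| ≤ F * R := fun t =>
    (abs_real_inner_le_norm _ _).trans (by gcongr; exact (norm_Pm_le _ _).trans (hR t))
  have hb : ∀ t, |inner ℝ (w t) (Complex.I • v t)| ≤ R * V := fun t =>
    (abs_real_inner_I_smul_le _ _).trans (by gcongr; exacts [hR t, hv.norm_le t])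
  have he : ∀ t, |inner ℝ (w t) (Complex.I • deriv v t)| ≤ R * V := fun t =>
    (abs_real_inner_I_smul_le _ _).trans (by gcongr; exacts [hR t, hv.norm_deriv_le t])
  -- `c² R⁶` dominates the square of the coefficient of `‖w_x‖`
  have hc2 : 4 ≤ c ^ 2 := by nlinarith
  have hR6 : 4 * R ^ 6 ≤ c ^ 2 * R ^ 6 := by gcongr
  have key : energy μ f (w s) (v s)
      ≤ (K1Of c γ F V μ R + 7 / 2 * γ * K2Of (1 / 7) c F V μ R) / (γ / 2) := by
    -- the rate `γ / 2` leaves a multiple of `γ ‖w_x‖²` for the absorption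
    refine le_div_of_deriv_add_le (half_pos hγ) (hw.hasDerivAt_energy hv) hM (fun t => ?_) s
    have h1 := hp t
    have h2 := abs_le.mp (ha t)
    have h3 := abs_le.mp (hd t)
    have h4 := abs_le.mp (hb t)
    have h5 := abs_le.mp (he t)
    have h6 := le_of_abs_le (abs_inner_cubic_le (hw.memY.memH2 t).isDeriv.1 (hR t)
      ((norm_Pm_le m (w t)).trans (hR t)))
    set x := ‖weakDeriv (w t)‖
    -- the terms in `x` are absorbed by the damping
    have y1 : γ * (7 / 2 * (R ^ 3 * x)) ≤ γ * (1 / 2 * x ^ 2 + 49 / 8 * R ^ 6) := by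
      gcongr; nlinarith [sq_nonneg (x - 7 / 2 * R ^ 3)]
    have y2 : 4 * μ * R ^ 3 * x ≤ γ * x ^ 2 + 4 * (μ ^ 2 * R ^ 6 / γ) := by
      have : γ * x ^ 2 + 4 * (μ ^ 2 * R ^ 6 / γ) - 4 * μ * R ^ 3 * x = (γ * x - 2 * μ * R ^ 3) ^ 2 / γ := by
        field_simp; ring
      have : 0 ≤ (γ * x - 2 * μ * R ^ 3) ^ 2 / γ := by positivity
      linarith
    have y3 : 2 * μ * (1 / L) * R ^ 4 ≤ γ * R ^ 2 + (1 / L) ^ 2 * (μ ^ 2 * R ^ 6 / γ) := by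
      have : γ * R ^ 2 + (1 / L) ^ 2 * (μ ^ 2 * R ^ 6 / γ) - 2 * μ * (1 / L) * R ^ 4
          = (γ * R - (1 / L) * μ * R ^ 3) ^ 2 / γ := by
        field_simp; ring
      have : 0 ≤ (γ * R - (1 / L) * μ * R ^ 3) ^ 2 / γ := by positivity
      linarith
    have y4 : (4 + (1 / L) ^ 2) * (μ ^ 2 * R ^ 6 / γ) ≤ μ ^ 2 * c ^ 2 * R ^ 6 / γ := by
      have : 4 + (1 / L) ^ 2 ≤ c ^ 2 := by nlinarith
      have h := mul_le_mul_of_nonneg_right this (by positivity : 0 ≤ μ ^ 2 * R ^ 6 / γ)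
      refine h.trans (le_of_eq ?_)
      ring
    have z1 : γ * (7 / 2 * (1 / 2 * inner ℝ (cubic (w t)) (w t)))
        ≤ γ * (7 / 2 * (1 / 2 * c * R ^ 4 + R ^ 3 * x)) := by gcongr
    have z2 : 2 * μ * inner ℝ (cubic (w t)) (Pm m (w t))
        ≤ 2 * μ * (1 / L * R ^ 4 + 2 * R ^ 3 * x) := by gcongr
    have z3 : γ * (-inner ℝ f (w t)) ≤ γ * (F * R) := by gcongr; linarith
    have z4 : 2 * μ * (-inner ℝ f (Pm m (w t))) ≤ 2 * μ * (F * R) := by gcongr; linarith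
    have z5 : (γ * μ + 2 * μ ^ 2) * (-inner ℝ (w t) (Complex.I • v t)) ≤ (γ * μ + 2 * μ ^ 2) * (R * V) := by
      gcongr; linarith
    have z6 : 2 * μ * inner ℝ (w t) (Complex.I • deriv v t) ≤ 2 * μ * (R * V) := by
      gcongr; linarith
    have z7 : 0 ≤ 2 * μ * ‖Pm m (weakDeriv (w t))‖ ^ 2 := by positivity
    have z8 : γ * (4 * R ^ 6) ≤ γ * (c ^ 2 * R ^ 6) := by gcongr
    have z9 : 0 ≤ γ * F * R := by positivity
    have z10 : 0 ≤ γ * μ * V * R := by positivity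
    have z11 : 0 ≤ γ * R ^ 2 := by positivity
    unfold energy K1Of K2Of
    ring_nf at y1 y2 y3 y4 z1 z2 z3 z4 z5 z6 z7 z8 z9 z10 z11 ⊢
    linarith
  have e1 : (K1Of c γ F V μ R + 7 / 2 * γ * K2Of (1 / 7) c F V μ R) / (γ / 2)
      = 2 / γ * K1Of c γ F V μ R + 7 * K2Of (1 / 7) c F V μ R := by field_simp
  rw [e1] at key
  have h1 := hp s
  have h2 := abs_le.mp (ha s)
  have h4 := abs_le.mp (hb s)
  have hw2 : ‖w s‖ ^ 2 ≤ R ^ 2 := by gcongr; exact hR s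
  have hμb : μ * (-inner ℝ (w s) (Complex.I • v s)) ≤ μ * (R * V) := by gcongr; linarith
  unfold energy at key
  set x := ‖weakDeriv (w s)‖
  have y1 : R ^ 3 * x ≤ 1 / 7 * x ^ 2 + 7 / 4 * R ^ 6 := by
    nlinarith [sq_nonneg (x - 7 / 2 * R ^ 3)]
  unfold h1Norm R1Of
  apply Real.sqrt_le_sqrt
  have e2 : 28 / 3 * K2Of (1 / 7) c F V μ R + 7 / (3 * γ) * K1Of c γ F V μ R
      = 7 / 6 * ((2 / γ * K1Of c γ F V μ R + 7 * K2Of (1 / 7) c F V μ R) + K2Of (1 / 7) c F V μ R) := by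
    field_simp; ring
  rw [e2]
  have e3 : K2Of (1 / 7) c F V μ R = 7 / 16 * (c ^ 2 * R ^ 6) + 1 / 2 * c * R ^ 4 + 2 * F * R
      + 2 * μ * V * R + 6 / 7 * R ^ 2 := by
    unfold K2Of; ring
  nlinarith

lemma R0_nonneg {F V : ℝ} (hF : 0 ≤ F) (hV : 0 ≤ V) : 0 ≤ R0 γ F V μ := by
  unfold R0; positivity

lemma mul_le_add_mul_R0 (hγ : 0 < γ) (hμ : 0 ≤ μ) {F V : ℝ} (hF : 0 ≤ F) (hV : 0 ≤ V) :
    μ * V ≤ (γ + μ) * R0 γ F V μ := by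
  have hγμ : 0 < γ + μ := by linarith
  have h1 : √(μ / (γ + μ)) * V ≤ R0 γ F V μ := by
    unfold R0
    have : 0 ≤ F / √(γ * (γ + μ)) := by positivity
    have : 0 ≤ √(μ / (γ + μ)) := by positivity
    linarith
  have h2 : μ / (γ + μ) ≤ √(μ / (γ + μ)) := by
    apply Real.le_sqrt_of_sq_le
    rw [pow_two]
    exact mul_le_of_le_one_left (by positivity) (by rw [div_le_one hγμ]; linarith)
  have h3 : μ / (γ + μ) * V ≤ R0 γ F V μ := le_trans (by gcongr) h1
  have h4 : μ * V = (γ + μ) * (μ / (γ + μ) * V) := by field_simp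
  rw [h4]
  gcongr

/-- The last summand of `R0`, which stands for the high modes, bounds `R0` below for `γ ≤ μ`. -/
lemma half_le_R0_sq (hγ : 0 < γ) (hμ : γ ≤ μ) {F V : ℝ} (hF : 0 ≤ F) (hV : 0 ≤ V) :
    1 / 2 ≤ R0 γ F V μ ^ 2 := by
  have hγμ : 0 < γ + μ := by linarith
  have h1 : √(μ / (γ + μ)) ≤ R0 γ F V μ := by
    unfold R0
    have : 0 ≤ F / √(γ * (γ + μ)) := by positivity
    have : 0 ≤ √(μ / (γ + μ)) * V := by positivity
    linarith
  have h2 : √(μ / (γ + μ)) ^ 2 = μ / (γ + μ) := Real.sq_sqrt (div_nonneg (by linarith) hγμ.le)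
  have h3 : 1 / 2 ≤ μ / (γ + μ) := by rw [div_le_div_iff₀ (by norm_num) hγμ]; linarith
  calc (1 : ℝ) / 2 ≤ √(μ / (γ + μ)) ^ 2 := by rw [h2]; exact h3
    _ ≤ _ := by gcongr

/-- The quartic and sextic terms of the `H¹` balance. For `μ ≤ γ` the quartic term is absorbed by
the one with factor `γ`, and for `γ ≤ μ` by the sextic one, as `R` is then bounded below. -/
lemma quartic_le {γ μ c β R : ℝ} (hγ : 0 ≤ γ) (hμ : 0 ≤ μ) (hβ : 0 ≤ β) (hc : 3 * β ≤ c)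
    (hc2 : 6 * β + 6 ≤ c ^ 2) (hhalf : γ ≤ μ → 1 / 2 ≤ R ^ 2) :
    3 / 2 * γ * β * R ^ 4 + 2 * μ * β * R ^ 4 + 4 * μ * R ^ 6
      ≤ 3 / 2 * γ * c * R ^ 4 + 2 / 3 * μ * (c ^ 2 * R ^ 6) := by
  have hR6 : 0 ≤ R ^ 6 := by positivity
  have hR4 : 0 ≤ R ^ 4 := by positivity
  have i1 : 3 * β * (γ * R ^ 4) ≤ c * (γ * R ^ 4) := by gcongr
  have i2 : μ * ((6 * β + 6) * R ^ 6) ≤ μ * (c ^ 2 * R ^ 6) := by gcongr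
  have i3 : 0 ≤ μ * (β * R ^ 6) := by positivity
  have i4 : 0 ≤ γ * (β * R ^ 4) := by positivity
  rcases le_total γ μ with h | h
  · have i5 : μ * β * R ^ 4 * (1 / 2) ≤ μ * β * R ^ 4 * R ^ 2 := by
      gcongr; exact hhalf h
    ring_nf at i1 i2 i3 i4 i5 ⊢
    linarith
  · have i5 : μ * (β * R ^ 4) ≤ γ * (β * R ^ 4) := by gcongr
    ring_nf at i1 i2 i3 i4 i5 ⊢
    linarith

/-- The balance of the first-order energy, once the high modes of `w` and `w_x` are small. Here
`x = ‖w_x‖`, `g = ∫ |w|⁴`, `n = ⟨|w|² w, P_m w⟩`, `a = ⟨f, w⟩`, `d = ⟨f, P_m w⟩`,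
`σ = ⟨w, i v⟩`, `e = ⟨w, i v_s⟩` and `Y = ‖P_m w_x‖²`. -/
lemma damped_balance {γ μ c β R F V x g n a d σ e Y : ℝ} (hγ : 0 ≤ γ) (hμ : 0 ≤ μ) (hβ : 0 ≤ β)
    (hR : 0 ≤ R) (hF : 0 ≤ F) (hV : 0 ≤ V) (hc : 3 * β ≤ c) (hc2 : 6 * β + 6 ≤ c ^ 2)
    (hhalf : γ ≤ μ → 1 / 2 ≤ R ^ 2) (hVR : μ * V ≤ (γ + μ) * R) (hg0 : 0 ≤ g)
    (hg : 1 / 2 * g ≤ 1 / 2 * β * R ^ 4 + R ^ 3 * x) (hn : n ≤ β * R ^ 4 + 2 * R ^ 3 * x)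
    (ha : a ≤ F * R) (had : 2 * μ * (a - d) ≤ 4 / 3 * μ * F * R + 2 * γ * F * R) (he : e ≤ R * V)
    (hY : x ^ 2 - 2 / 3 ≤ Y) :
    2 * γ * (-x ^ 2 + g - a - μ * σ) + 2 * μ * (-Y + n - d - μ * σ) + 2 * μ * e
        + (γ + μ) * (x ^ 2 - 1 / 2 * g + 2 * a + 2 * (μ * σ))
      ≤ 3 * γ * (3 / 16 * (c ^ 2 * R ^ 6) + 1 / 2 * c * R ^ 4 + 2 * F * R + 2 * μ * V * R
          + 2 / 3 * R ^ 2)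
        + 2 / 3 * (6 * γ * F * R + 6 * μ * γ * V * R + μ * (c ^ 2 * R ^ 6 + R ^ 2) + 2 * μ
          + 2 * μ * F * R + 2 * μ * V * R) := by
  have hR4 := quartic_le hγ hμ hβ hc hc2 hhalf
  have hVR2 : μ * V * R ≤ (γ + μ) * R * R := by gcongr
  have hc4 : 4 * R ^ 6 ≤ c ^ 2 * R ^ 6 := by gcongr; linarith
  have y0 : 3 * (R ^ 3 * x) ≤ x ^ 2 + 9 / 16 * (c ^ 2 * R ^ 6) := by
    have := sq_nonneg (x - 3 / 2 * R ^ 3)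
    ring_nf at this hc4 ⊢
    linarith
  have y1 : γ * (3 * (R ^ 3 * x)) ≤ γ * (x ^ 2 + 9 / 16 * (c ^ 2 * R ^ 6)) := by gcongr
  have y2 : μ * (4 * R ^ 3 * x) ≤ μ * (x ^ 2 + 4 * R ^ 6) := by
    gcongr
    have := sq_nonneg (x - 2 * R ^ 3)
    ring_nf at this ⊢
    linarith
  have z1 : γ * (3 * (1 / 2 * g)) ≤ γ * (3 * (1 / 2 * β * R ^ 4 + R ^ 3 * x)) := by gcongr
  have z1' : 0 ≤ μ * g := by positivity
  have z2 : 2 * μ * n ≤ 2 * μ * (β * R ^ 4 + 2 * R ^ 3 * x) := by gcongr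
  have z3 : 2 * γ * a ≤ 2 * γ * (F * R) := by gcongr
  have z6 : 2 * μ * e ≤ 2 * μ * (R * V) := by gcongr
  have z7 : 2 * μ * (x ^ 2 - 2 / 3) ≤ 2 * μ * Y := by gcongr
  have z9 : 0 ≤ γ * F * R := by positivity
  have z10 : 0 ≤ γ * μ * V * R := by positivity
  have z11 : 0 ≤ γ * R ^ 2 := by positivity
  ring_nf at y1 y2 hR4 hVR2 had z1 z1' z2 z3 z6 z7 z9 z10 z11 ⊢
  linarith

/-- The `H¹` bound that uses the damping by `P_m`: the high modes of `w` and of `w_x` have to be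
small. -/
lemma IsBoundedSolution.h1Norm_le_R1 (hw : IsBoundedSolution γ μ m f v w) (hv : MemX m v)
    (hγ : 0 < γ) (hμ : 0 ≤ μ) {c : ℝ} (hc : 3 * (1 / L) + 3 ≤ c)
    (hR : ∀ s, ‖w s‖ ≤ R0 γ ‖f‖ (xNorm v) μ) (hQ : ∀ s, ‖w s - Pm m (w s)‖ ≤ 4 / 9)
    (hQ' : ∀ s, ‖weakDeriv (w s) - Pm m (weakDeriv (w s))‖ ^ 2 ≤ 2 / 3) (s : ℝ) :
    h1Norm (w s) ≤ R1 c γ ‖f‖ (xNorm v) μ := by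
  have hL0 := hL.out
  have hβ : 0 < 1 / L := by positivity
  have hV := hv.xNorm_nonneg
  have hγμ : 0 < γ + μ := by linarith
  have hVR := mul_le_add_mul_R0 (γ := γ) hγ hμ (norm_nonneg f) hV
  have hhalf := fun h : γ ≤ μ => half_le_R0_sq hγ h (norm_nonneg f) hV
  obtain ⟨M, hM⟩ := hw.energy_le_of_bounded hv hμ
  unfold R1
  have hK1 : K1 c γ ‖f‖ (xNorm v) μ = 6 * γ * ‖f‖ * R0 γ ‖f‖ (xNorm v) μ
    + 6 * μ * γ * xNorm v * R0 γ ‖f‖ (xNorm v) μ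
    + μ * (c ^ 2 * R0 γ ‖f‖ (xNorm v) μ ^ 6 + R0 γ ‖f‖ (xNorm v) μ ^ 2) + 2 * μ
    + 2 * μ * ‖f‖ * R0 γ ‖f‖ (xNorm v) μ + 2 * μ * xNorm v * R0 γ ‖f‖ (xNorm v) μ := rfl
  have hK2 : K2 c γ ‖f‖ (xNorm v) μ = 3 / 16 * (c ^ 2 * R0 γ ‖f‖ (xNorm v) μ ^ 6)
      + 1 / 2 * c * R0 γ ‖f‖ (xNorm v) μ ^ 4 + 2 * ‖f‖ * R0 γ ‖f‖ (xNorm v) μ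
      + 2 * μ * xNorm v * R0 γ ‖f‖ (xNorm v) μ + 2 / 3 * R0 γ ‖f‖ (xNorm v) μ ^ 2 := by
    unfold K2 K2Of; ring
  set k1 := K1 c γ ‖f‖ (xNorm v) μ
  set k2 := K2 c γ ‖f‖ (xNorm v) μ
  set R := R0 γ ‖f‖ (xNorm v) μ
  have hR0 : 0 ≤ R := (norm_nonneg _).trans (hR 0)
  set F := ‖f‖ with hF
  have hF0 : 0 ≤ F := norm_nonneg f
  set V := xNorm v
  have hp : ∀ t, 1 / 2 * inner ℝ (cubic (w t)) (w t)
      ≤ 1 / 2 * (1 / L) * R ^ 4 + R ^ 3 * ‖weakDeriv (w t)‖ := fun t => by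
    have h := le_of_abs_le (abs_inner_cubic_le (hw.memY.memH2 t).isDeriv.1 (hR t) (hR t))
    linarith
  have ha : ∀ t, |inner ℝ f (w t)| ≤ F * R := fun t =>
    (abs_real_inner_le_norm _ _).trans (by gcongr; exact hR t)
  have hb : ∀ t, |inner ℝ (w t) (Complex.I • v t)| ≤ R * V := fun t =>
    (abs_real_inner_I_smul_le _ _).trans (by gcongr; exacts [hR t, hv.norm_le t])
  have he : ∀ t, |inner ℝ (w t) (Complex.I • deriv v t)| ≤ R * V := fun t =>
    (abs_real_inner_I_smul_le _ _).trans (by gcongr; exacts [hR t, hv.norm_deriv_le t])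
  have hc2 : 6 * (1 / L) + 6 ≤ c ^ 2 := by nlinarith
  have hR6 : (6 * (1 / L) + 6) * R ^ 6 ≤ c ^ 2 * R ^ 6 := by gcongr
  have hLR6 : 0 ≤ 1 / L * R ^ 6 := by positivity
  have hR6' : 0 ≤ R ^ 6 := by positivity
  have key : energy μ f (w s) (v s) ≤ (3 * γ * k2 + 2 / 3 * k1) / (γ + μ) := by
    refine le_div_of_deriv_add_le hγμ (hw.hasDerivAt_energy hv) hM (fun t => ?_) s
    have h1 := hp t
    have h2 := abs_le.mp (ha t)
    have h5 := abs_le.mp (he t)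
    have h6 := le_of_abs_le (abs_inner_cubic_le (hw.memY.memH2 t).isDeriv.1 (hR t)
      ((norm_Pm_le m (w t)).trans (hR t)))
    have hQ2 := hQ' t
    have hP := norm_sq_Pm m (weakDeriv (w t))
    have hp0 := inner_cubic_self_nonneg (w t)
    have hfQ : inner ℝ f (w t) - inner ℝ f (Pm m (w t)) ≤ F * ‖w t - Pm m (w t)‖ := by
      rw [← inner_sub_right]; exact real_inner_le_norm _ _
    -- the forcing on the high modes
    have hFQ : 2 * μ * (F * ‖w t - Pm m (w t)‖) ≤ 4 / 3 * μ * F * R + 2 * γ * F * R := by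
      have i0 : 0 ≤ γ * F * R := by positivity
      rcases le_total γ μ with h | h
      -- `4 / 9 ≤ 2 / 3 * R`, because `1 / 2 ≤ R ^ 2`
      · have hR23 : 2 / 3 ≤ R := by nlinarith [hhalf h]
        have : 2 * μ * (F * ‖w t - Pm m (w t)‖) ≤ 2 * μ * (F * (2 / 3 * R)) := by
          gcongr; exact (hQ t).trans (by linarith)
        linarith
      · have i1 : 2 * μ * (F * ‖w t - Pm m (w t)‖) ≤ 2 * μ * (F * R) := by
          gcongr; exact (norm_sub_Pm_le _ _).trans (hR t)
        have i2 : μ * (F * R) ≤ γ * (F * R) := by gcongr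
        have i3 : 0 ≤ μ * (F * R) := by positivity
        linarith
    rw [hK1, hK2]
    exact damped_balance hγ.le hμ hβ.le hR0 hF0 hV (by linarith) hc2 hhalf hVR hp0 h1 h6 h2.2
      ((mul_le_mul_of_nonneg_left hfQ (by positivity)).trans hFQ) h5.2 (by linarith)
  have h1 := hp s
  have h2 := abs_le.mp (ha s)
  have h4 := abs_le.mp (hb s)
  have hw2 : ‖w s‖ ^ 2 ≤ R ^ 2 := by gcongr; exact hR s
  have hμb : μ * (-inner ℝ (w s) (Complex.I • v s)) ≤ μ * (R * V) := by gcongr; linarith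
  have hR4 : 1 / L * R ^ 4 ≤ c * R ^ 4 := by gcongr; linarith
  unfold energy at key
  set x := ‖weakDeriv (w s)‖
  have y1 : R ^ 3 * x ≤ 1 / 3 * x ^ 2 + 3 / 16 * (c ^ 2 * R ^ 6) := by
    have := sq_nonneg (x - 3 / 2 * R ^ 3)
    ring_nf at this hR6 hLR6 hR6' ⊢
    linarith
  unfold h1Norm
  apply Real.sqrt_le_sqrt
  have e2 : ((3 / 2 * μ + 6 * γ) * k2 + k1) / (γ + μ)
      = 3 / 2 * ((3 * γ * k2 + 2 / 3 * k1) / (γ + μ) + k2) := by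
    field_simp; ring
  rw [e2]
  linarith

end Bounds

/-! ### The `H²` estimate -/

/-- A form of Young's inequality with exponents `4/3` and `4`, free of fractional powers: from
`t² ≤ C q u³` it follows that `t ≤ γ u² / 6 + 27 C² q² / γ³`. -/
lemma le_of_sq_le_mul_pow_three {γ C q u t : ℝ} (hγ : 0 < γ) (h : t ^ 2 ≤ C * q * u ^ 3) :
    t ≤ γ * u ^ 2 / 6 + 27 * (C ^ 2 * q ^ 2 / γ ^ 3) := by
  refine le_of_sq_le_sq (h.trans ?_) (by positivity)
  have h1 : C * q * u ≤ γ ^ 2 * u ^ 2 / 36 + 9 * (C ^ 2 * q ^ 2 / γ ^ 2) := by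
    have : γ ^ 2 * u ^ 2 / 36 + 9 * (C ^ 2 * q ^ 2 / γ ^ 2) - C * q * u
        = (γ * u / 6 - 3 * (C * q / γ)) ^ 2 := by
      field_simp; ring
    have := sq_nonneg (γ * u / 6 - 3 * (C * q / γ))
    linarith
  have h2 : C * q * u ^ 3 ≤ u ^ 2 * (γ ^ 2 * u ^ 2 / 36 + 9 * (C ^ 2 * q ^ 2 / γ ^ 2)) := by
    have := mul_le_mul_of_nonneg_left h1 (sq_nonneg u)
    linarith
  have h3 : (γ * u ^ 2 / 6 + 27 * (C ^ 2 * q ^ 2 / γ ^ 3)) ^ 2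
      = u ^ 2 * (γ ^ 2 * u ^ 2 / 36 + 9 * (C ^ 2 * q ^ 2 / γ ^ 2))
        + (27 * (C ^ 2 * q ^ 2 / γ ^ 3)) ^ 2 := by
    field_simp; ring
  rw [h3]
  linarith [sq_nonneg (27 * (C ^ 2 * q ^ 2 / γ ^ 3))]

lemma mul_le_young {γ a b : ℝ} (hγ : 0 < γ) : a * b ≤ γ * b ^ 2 / 12 + 3 * (a ^ 2 / γ) := by
  have : γ * b ^ 2 / 12 + 3 * (a ^ 2 / γ) - a * b = 3 / γ * (γ * b / 6 - a) ^ 2 := by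
    field_simp; ring
  have : 0 ≤ 3 / γ * (γ * b / 6 - a) ^ 2 := by positivity
  linarith

/-- The terms of the second-order balance that are controlled by `R S M u`. -/
lemma cross_terms_le {κ R S M0 M z y n a τ u : ℝ} (hκ : 2 ≤ κ) (hR : 0 ≤ R) (hS : 0 ≤ S)
    (hM00 : 0 ≤ M0) (hM0M : M0 ≤ M) (hz : 0 ≤ z) (hn : 0 ≤ n) (hy0 : 0 ≤ y) (hzu : z ≤ u)
    (hy : y ≤ u) (hnM : n ≤ κ * M) (ha : a ≤ κ * (R * S)) (hτ : τ ≤ 11 * κ * (R * S) * y) :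
    3 * a * M0 * z + a * n * z + a * M0 * y + 1 / 2 * M0 * τ ≤ 6 * κ ^ 2 * (R * S * M) * u := by
  have hM : 0 ≤ M := hM00.trans hM0M
  have hu : 0 ≤ u := hz.trans hzu
  have hRS : 0 ≤ R * S := by positivity
  have i1 : a * (M0 * z) ≤ κ * (R * S) * (M * u) := by gcongr
  have i2 : a * (n * z) ≤ κ * (R * S) * (κ * M * u) := by gcongr
  have i3 : a * (M0 * y) ≤ κ * (R * S) * (M * u) := by gcongr
  have i4 : M0 * τ ≤ M * (11 * κ * (R * S) * u) := by
    refine (mul_le_mul_of_nonneg_left hτ hM00).trans ?_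
    gcongr
  have i5 := mul_le_mul_of_nonneg_right hκ (by positivity : 0 ≤ κ * (R * S * (M * u)))
  have i6 : 0 ≤ κ * κ * (R * S * (M * u)) := by positivity
  linarith

lemma K6Of_one_eq {γ μ R S V F : ℝ} (hR : 0 ≤ R) :
    K6Of 1 γ F V μ R S = 2 * ((R * S ^ 4) ^ 2 / γ ^ 3)
      + 2 * ((R * S * (R ^ 2 * S + (γ + μ) * R + μ * V + F)) ^ 2 / γ) + (μ * V) ^ 2 / γ
      + γ * (μ * V) ^ 2 + γ * F ^ 2 + μ * (R ^ 2 * S) ^ 2 + μ * F ^ 2 + μ * (μ * V) ^ 2 := by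
  have e : (√R * S ^ 2) ^ 4 = (R * S ^ 4) ^ 2 := by
    have : √R ^ 4 = R ^ 2 := by
      rw [show √R ^ 4 = (√R ^ 2) ^ 2 by ring, Real.sq_sqrt hR]
    rw [mul_pow, this]; ring
  unfold K6Of K5Of
  rw [e]
  ring

/-- The comparison of the absorbed terms with `K6Of`; `X1`, `X2`, `X3` are its first three
terms. -/
lemma absorbed_le {κ γ μ X1 X2 X3 N2 r F G : ℝ} (hκ : 2 ≤ κ) (hγ : 0 ≤ γ) (hμ : 0 ≤ μ)
    (h1 : 0 ≤ X1) (h2 : 0 ≤ X2) (h3 : 0 ≤ X3) (hr : γ * r ^ 2 ≤ X2)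
    (hN : N2 ≤ 3 * (κ ^ 2 * r ^ 2 + F ^ 2 + G ^ 2)) :
    10 / 3 * (γ * N2) + μ * N2 / 4 + 108 * (κ ^ 4 * X2) + 3 * X3 + 27 / 2 * (14641 * (κ ^ 4 * X1))
      ≤ 100000 * κ ^ 4 * (2 * X1 + 2 * X2 + X3 + γ * G ^ 2 + γ * F ^ 2 + μ * r ^ 2 + μ * F ^ 2
        + μ * G ^ 2) := by
  have hk2 : 4 ≤ κ ^ 2 := by nlinarith
  have hk4 : 4 * κ ^ 2 ≤ κ ^ 4 := by
    have := mul_le_mul_of_nonneg_right hk2 (sq_nonneg κ)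
    linarith
  have hk4' : 16 ≤ κ ^ 4 := by linarith
  have s3 := mul_le_mul_of_nonneg_left hN hγ
  have s4 := mul_le_mul_of_nonneg_left hN hμ
  have g2 : κ ^ 2 * (γ * r ^ 2) ≤ κ ^ 2 * X2 := by gcongr
  have m1 := mul_le_mul_of_nonneg_right hk4' h1
  have m2 := mul_le_mul_of_nonneg_right hk4 h2
  have m2' := mul_le_mul_of_nonneg_right hk4' h2
  have m3 := mul_le_mul_of_nonneg_right hk4' h3
  have m4 := mul_le_mul_of_nonneg_right hk4' (by positivity : 0 ≤ γ * G ^ 2)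
  have m5 := mul_le_mul_of_nonneg_right hk4' (by positivity : 0 ≤ γ * F ^ 2)
  have m6 := mul_le_mul_of_nonneg_right hk4 (by positivity : 0 ≤ μ * r ^ 2)
  have m6' := mul_le_mul_of_nonneg_right hk4' (by positivity : 0 ≤ μ * r ^ 2)
  have m7 := mul_le_mul_of_nonneg_right hk4' (by positivity : 0 ≤ μ * F ^ 2)
  have m8 := mul_le_mul_of_nonneg_right hk4' (by positivity : 0 ≤ μ * G ^ 2)
  have p4 : 0 ≤ γ * G ^ 2 := by positivity
  have p5 : 0 ≤ γ * F ^ 2 := by positivity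
  have p6 : 0 ≤ μ * r ^ 2 := by positivity
  have p7 : 0 ≤ μ * F ^ 2 := by positivity
  have p8 : 0 ≤ μ * G ^ 2 := by positivity
  linarith

/-- The term `γ (R² S)²` is already present in `K5Of`. -/
lemma sq_le_K5_term {γ μ R S V F : ℝ} (hγ : 0 < γ) (hμ : 0 ≤ μ) (hR : 0 ≤ R) (hS : 0 ≤ S)
    (hV : 0 ≤ V) (hF : 0 ≤ F) :
    γ * (R ^ 2 * S) ^ 2 ≤ (R * S * (R ^ 2 * S + (γ + μ) * R + μ * V + F)) ^ 2 / γ := by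
  rw [le_div_iff₀ hγ]
  have : γ * (R ^ 2 * S) ≤ R * S * (R ^ 2 * S + (γ + μ) * R + μ * V + F) := by
    have : 0 ≤ R * S * (R ^ 2 * S + μ * R + μ * V + F) := by positivity
    linarith
  calc γ * (R ^ 2 * S) ^ 2 * γ = (γ * (R ^ 2 * S)) ^ 2 := by ring
    _ ≤ _ := by gcongr

/-- The absorption argument in the balance of the second-order energy. Here `z = ‖Z‖`,
`y = ‖w_xx‖`, `n = ‖Z - w_xx‖`, `a = ‖w‖_∞²`, and `τ` is the norm of the part of the gradient of
the correction that is of first order. -/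
lemma second_order_balance {γ μ κ R S V F z y n a τ : ℝ} (hγ : 0 < γ) (hμ : 0 ≤ μ) (hκ : 2 ≤ κ)
    (hR : 0 ≤ R) (hS : 0 ≤ S) (hV : 0 ≤ V) (hF : 0 ≤ F) (hz : 0 ≤ z) (hn : 0 ≤ n)
    (hy : y ≤ z + n) (hnM : n ≤ κ * (R ^ 2 * S + (γ + μ) * R + μ * V + F))
    (hn2 : n ^ 2 ≤ 3 * (κ ^ 2 * (R ^ 2 * S) ^ 2 + F ^ 2 + (μ * V) ^ 2))
    (ha : a ≤ κ * (R * S)) (hτ : τ ≤ 11 * κ * (R * S) * y)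
    (hτ2 : τ ^ 2 ≤ 121 * κ ^ 2 * (R * S ^ 4) * y) (hy0 : 0 ≤ y) :
    -γ * z ^ 2 + γ * (z * n) + μ * n ^ 2 / 4 + 3 * a * ((γ + μ) * R) * z + μ * V * z + a * n * z
        + a * ((γ + μ) * R) * y + 1 / 2 * (z + (γ + μ) * R) * τ
      ≤ -(1 / 2) * γ * z ^ 2 + 100000 * κ ^ 4 * K6Of 1 γ F V μ R S := by
  have hM00 : 0 ≤ (γ + μ) * R := by positivity
  have hM0M : (γ + μ) * R ≤ R ^ 2 * S + (γ + μ) * R + μ * V + F := by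
    have : 0 ≤ R ^ 2 * S + μ * V + F := by positivity
    linarith
  have h3 := sq_le_K5_term hγ hμ hR hS hV hF
  rw [K6Of_one_eq hR]
  have t1 := cross_terms_le (u := z + n) hκ hR hS hM00 hM0M hz hn hy0 (by linarith) hy hnM ha hτ
  generalize R ^ 2 * S + (γ + μ) * R + μ * V + F = M at *
  generalize (γ + μ) * R = M0 at *
  have hu2 : γ * (z + n) ^ 2 ≤ γ * (2 * z ^ 2 + 2 * n ^ 2) := by
    gcongr; linarith [sq_nonneg (z - n)]
  have t1' := mul_le_young (a := 6 * κ ^ 2 * (R * S * M)) (b := z + n) hγ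
  have t2 : γ * (z * n) ≤ γ * z ^ 2 / 12 + 3 * (γ * n ^ 2) := by
    have := mul_nonneg hγ.le (sq_nonneg (z - 6 * n))
    linarith
  have t3 := mul_le_young (a := μ * V) (b := z) hγ
  have t4 : z * τ ≤ γ * (z + n) ^ 2 / 6 + 27 * ((121 * κ ^ 2) ^ 2 * (R * S ^ 4) ^ 2 / γ ^ 3) := by
    apply le_of_sq_le_mul_pow_three hγ
    rw [mul_pow]
    calc z ^ 2 * τ ^ 2 ≤ (z + n) ^ 2 * (121 * κ ^ 2 * (R * S ^ 4) * (z + n)) := by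
          gcongr
          · linarith
          · exact hτ2.trans (by gcongr)
      _ = _ := by ring
  have f1 : (6 * κ ^ 2 * (R * S * M)) ^ 2 / γ = 36 * (κ ^ 4 * ((R * S * M) ^ 2 / γ)) := by ring
  have f2 : (121 * κ ^ 2) ^ 2 * (R * S ^ 4) ^ 2 / γ ^ 3
      = 14641 * (κ ^ 4 * ((R * S ^ 4) ^ 2 / γ ^ 3)) := by
    ring
  rw [f1] at t1'
  rw [f2] at t4
  have p1 : 0 ≤ (R * S ^ 4) ^ 2 / γ ^ 3 := by positivity
  have p2 : 0 ≤ (R * S * M) ^ 2 / γ := by positivity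
  have p3 : 0 ≤ (μ * V) ^ 2 / γ := by positivity
  have final := absorbed_le hκ hγ.le hμ p1 p2 p3 h3 hn2
  refine le_trans ?_ (add_le_add le_rfl final)
  generalize (R * S ^ 4) ^ 2 / γ ^ 3 = X1 at *
  generalize (μ * V) ^ 2 / γ = X3 at *
  generalize (R * S * M) ^ 2 / γ = X2 at *
  linarith

section Bounds

variable {γ μ : ℝ} {m : ℕ} {f : L2per L} {v w : ℝ → L2per L}

lemma norm_le_h1Norm (u : L2per L) : ‖u‖ ≤ h1Norm u :=
  Real.le_sqrt_of_sq_le (by nlinarith [sq_nonneg ‖weakDeriv u‖])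

lemma norm_weakDeriv_le_h1Norm (u : L2per L) : ‖weakDeriv u‖ ≤ h1Norm u :=
  Real.le_sqrt_of_sq_le (by nlinarith [sq_nonneg ‖u‖])

lemma norm_rep_sq_le_mul {u g : L2per L} (h : IsDeriv u g) {R S : ℝ} (hR : ‖u‖ ≤ R)
    (hS : h1Norm u ≤ S) : ‖rep u‖ ^ 2 ≤ (1 / L + 2) * (R * S) := by
  have hL0 := hL.out
  have h1 := h.norm_rep_sq_le
  rw [← h.weakDeriv_eq] at h1
  have h2 := (norm_le_h1Norm u).trans hS
  have h3 := (norm_weakDeriv_le_h1Norm u).trans hS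
  have hR0 := (norm_nonneg _).trans hR
  rw [pow_two ‖u‖, mul_assoc] at h1
  calc ‖rep u‖ ^ 2 ≤ ‖u‖ * ‖u‖ / L + 2 * (‖u‖ * ‖weakDeriv u‖) := h1
    _ ≤ R * S / L + 2 * (R * S) := by gcongr
    _ = _ := by ring

lemma norm_cubic_le_mul {u g : L2per L} (h : IsDeriv u g) {R S : ℝ} (hR : ‖u‖ ≤ R)
    (hS : h1Norm u ≤ S) : ‖cubic u‖ ≤ (1 / L + 2) * (R ^ 2 * S) := by
  have h0 := norm_rep_sq_le_mul h hR hS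
  have hR0 := (norm_nonneg _).trans hR
  calc ‖cubic u‖ ≤ ‖rep u‖ ^ 2 * ‖u‖ := norm_cubic_le u
    _ ≤ (1 / L + 2) * (R * S) * R := by gcongr; exact (sq_nonneg _).trans h0
    _ = _ := by ring

lemma norm_corrGradLow_bounds {u : L2per L} (h : MemH2 u) {R S : ℝ} (hR : ‖u‖ ≤ R)
    (hS : h1Norm u ≤ S) :
    ‖corrGradLow u‖ ≤ 11 * (1 / L + 2) * (R * S) * ‖weakDeriv (weakDeriv u)‖ ∧
    ‖corrGradLow u‖ ^ 2 ≤ 121 * (1 / L + 2) ^ 2 * (R * S ^ 4) * ‖weakDeriv (weakDeriv u)‖ := by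
  have hL0 := hL.out
  have hβ : 0 < 1 / L := by positivity
  have hR0 := (norm_nonneg _).trans hR
  have hB := (norm_weakDeriv_le_h1Norm u).trans hS
  have hS0 := (norm_nonneg _).trans hB
  have h1 := norm_corrGradLow_le h
  have h2 := norm_rep_sq_le_mul h.isDeriv.1 hR hS
  have h3 := h.isDeriv.1.norm_rep_deriv_sq_le h.isDeriv.2
  have h4 : ‖weakDeriv u‖ ^ 2 ≤ R * ‖weakDeriv (weakDeriv u)‖ :=
    (h.isDeriv.1.norm_sq_le h.isDeriv.2).trans (by gcongr)
  set κ := 1 / L + 2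
  set y := ‖weakDeriv (weakDeriv u)‖
  set b := ‖weakDeriv u‖
  have hy : 0 ≤ y := norm_nonneg _
  have hb : 0 ≤ b := norm_nonneg _
  have hκ : 2 ≤ κ := by linarith
  have hκ2 : 108 * κ ≤ 121 * κ ^ 2 := by nlinarith
  have h5 : ‖corrGradLow u‖ ^ 2 ≤ 108 * κ * (R * S) * b ^ 3 * y := by
    calc ‖corrGradLow u‖ ^ 2 ≤ (6 * ‖rep u‖ * ‖rep (weakDeriv u)‖ * b) ^ 2 := by gcongr
      _ = 36 * (‖rep u‖ ^ 2 * ‖rep (weakDeriv u)‖ ^ 2) * b ^ 2 := by ring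
      _ ≤ 36 * (κ * (R * S) * (3 * b * y)) * b ^ 2 := by gcongr
      _ = _ := by ring
  refine ⟨le_of_sq_le_sq (h5.trans ?_) (by positivity), h5.trans ?_⟩
  · calc 108 * κ * (R * S) * b ^ 3 * y = 108 * κ * (R * S) * (b * b ^ 2) * y := by ring
      _ ≤ 108 * κ * (R * S) * (S * (R * y)) * y := by gcongr
      _ = 108 * κ * ((R * S * y) ^ 2) := by ring
      _ ≤ 121 * κ ^ 2 * ((R * S * y) ^ 2) := by gcongr
      _ = _ := by ring
  · calc 108 * κ * (R * S) * b ^ 3 * y ≤ 121 * κ ^ 2 * (R * S) * S ^ 3 * y := by gcongr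
      _ = _ := by ring

lemma norm_damp_le (hγ : 0 ≤ γ) (hμ : 0 ≤ μ) {u : L2per L} {R : ℝ} (hR : ‖u‖ ≤ R) :
    ‖damp γ μ m u‖ ≤ (γ + μ) * R := by
  unfold damp
  refine (norm_add_le _ _).trans ?_
  rw [norm_smul, norm_smul, Real.norm_of_nonneg hγ, Real.norm_of_nonneg hμ, add_mul]
  gcongr
  exact (norm_Pm_le _ _).trans hR

set_option maxHeartbeats 1000000 in
/-- The `H²` bound that follows from bounds in `L²` and `H¹`. -/
lemma IsBoundedSolution.norm_weakDeriv_weakDeriv_sq_le (hw : IsBoundedSolution γ μ m f v w)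
    (hv : MemX m v) (hγ : 0 < γ) (hμ : 0 ≤ μ) {R S : ℝ} (hR : ∀ s, ‖w s‖ ≤ R)
    (hS : ∀ s, h1Norm (w s) ≤ S) (s : ℝ) :
    ‖weakDeriv (weakDeriv (w s))‖ ^ 2 ≤ 200000 * (1 / L + 2) ^ 4 *
      (4 * K6Of 1 γ ‖f‖ (xNorm v) μ R S / γ + 4 * K7Of 1 ‖f‖ (xNorm v) μ R S) := by
  have hL0 := hL.out
  have hβ : 0 < 1 / L := by positivity
  have hR0 : 0 ≤ R := (norm_nonneg _).trans (hR 0)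
  have hS0 : 0 ≤ S := (norm_nonneg _).trans ((norm_le_h1Norm _).trans (hS 0))
  have hV := hv.xNorm_nonneg
  obtain ⟨M, hM⟩ := hw.memY.bounded
  have hrep : ∀ t, ‖rep (w t)‖ ^ 2 ≤ (1 / L + 2) * (R * S) := fun t =>
    norm_rep_sq_le_mul (hw.memY.memH2 t).isDeriv.1 (hR t) (hS t)
  have hcub : ∀ t, ‖cubic (w t)‖ ≤ (1 / L + 2) * (R ^ 2 * S) := fun t =>
    norm_cubic_le_mul (hw.memY.memH2 t).isDeriv.1 (hR t) (hS t)
  have hlow := fun t => norm_corrGradLow_bounds (hw.memY.memH2 t) (hR t) (hS t)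
  set κ := 1 / L + 2
  have hκ : 2 ≤ κ := by linarith
  set F := ‖f‖ with hF
  have hF0 : 0 ≤ F := norm_nonneg f
  set V := xNorm v
  set Z := fun t => resid μ f (w t) (v t) with hZ
  set A := fun t => weakDeriv (weakDeriv (w t)) with hA
  have hμv : ∀ t, ‖Complex.I • (μ • v t)‖ ≤ μ * V := fun t => by
    rw [norm_smul, norm_smul, Complex.norm_I, one_mul, Real.norm_of_nonneg hμ]
    gcongr; exact hv.norm_le t
  have hG : ∀ t, ‖Z t - A t‖ ≤ κ * (R ^ 2 * S) + F + μ * V := fun t => by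
    have e : Z t - A t = cubic (w t) - f - Complex.I • (μ • v t) := by
      simp only [hZ, hA, resid]; abel
    rw [e]
    refine (norm_sub_le _ _).trans (add_le_add ((norm_sub_le _ _).trans ?_) (hμv t))
    exact add_le_add (hcub t) le_rfl
  have hy : ∀ t, ‖A t‖ ≤ ‖Z t‖ + ‖Z t - A t‖ := fun t => by
    have := norm_sub_le (Z t) (Z t - A t)
    rwa [sub_sub_cancel] at this
  have hG2 : ∀ t, ‖Z t - A t‖ ^ 2 ≤ 3 * (κ ^ 2 * (R ^ 2 * S) ^ 2 + F ^ 2 + (μ * V) ^ 2) := fun t => by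
    calc ‖Z t - A t‖ ^ 2 ≤ (κ * (R ^ 2 * S) + F + μ * V) ^ 2 := by gcongr; exact hG t
      _ ≤ _ := by
        nlinarith [sq_nonneg (κ * (R ^ 2 * S) - F), sq_nonneg (F - μ * V),
          sq_nonneg (κ * (R ^ 2 * S) - μ * V)]
  have hGM : ∀ t, ‖Z t - A t‖ ≤ κ * (R ^ 2 * S + (γ + μ) * R + μ * V + F) := fun t => by
    refine (hG t).trans ?_
    have h1 : F ≤ κ * F := by nlinarith
    have h2 : μ * V ≤ κ * (μ * V) := by
      have : 0 ≤ μ * V := by positivity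
      nlinarith
    have h3 : 0 ≤ κ * ((γ + μ) * R) := by positivity
    linarith
  have hcorr : ∀ t, |corr (w t)| ≤ κ * (R * S ^ 3) := fun t => by
    calc |corr (w t)| ≤ ‖rep (w t)‖ ^ 2 * ‖weakDeriv (w t)‖ ^ 2 := abs_corr_le (hw.memY.memH2 t)
      _ ≤ κ * (R * S) * S ^ 2 := by
        gcongr
        exacts [hrep t, (norm_weakDeriv_le_h1Norm _).trans (hS t)]
      _ = _ := by ring
  have hΨ : energyTwo μ f (w s) (v s)
      ≤ (100000 * κ ^ 4 * K6Of 1 γ F V μ R S + 1 / 2 * γ * (κ * (R * S ^ 3))) / γ := by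
    refine le_div_of_deriv_add_le (y := fun t => energyTwo μ f (w t) (v t))
      (M := 1 / 2 * ((M + (κ * (R ^ 2 * S) + F + μ * V)) ^ 2 + κ * (R * S ^ 3))) hγ
      (hw.hasDerivAt_energyTwo hv) (fun t => ?_) (fun t => ?_) s
    · have h1 : ‖Z t‖ ≤ M + (κ * (R ^ 2 * S) + F + μ * V) := by
        have h2 := norm_add_le (A t) (Z t - A t)
        rw [add_sub_cancel] at h2
        have h3 : ‖A t‖ ≤ M := (norm_weakDeriv_weakDeriv_le_h2Norm _).trans (hM t)
        linarith [hG t]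
      have h2 : ‖Z t‖ ^ 2 ≤ (M + (κ * (R ^ 2 * S) + F + μ * V)) ^ 2 := by gcongr
      unfold energyTwo
      have := le_of_abs_le (hcorr t)
      linarith
    · have hbal := second_order_balance hγ hμ hκ hR0 hS0 hV hF0 (norm_nonneg (Z t))
        (norm_nonneg (Z t - A t)) (hy t) (hGM t) (hG2 t) (hrep t) (hlow t).1 (hlow t).2
        (norm_nonneg _)
      have hdamp : ‖damp γ μ m (w t)‖ ≤ (γ + μ) * R := norm_damp_le hγ.le hμ (hR t)
      have hM00 : 0 ≤ (γ + μ) * R := by positivity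
      have hAZ : A t = Z t - (Z t - A t) := by abel
      have b1 : -γ * inner ℝ (Z t) (A t) ≤ -γ * ‖Z t‖ ^ 2 + γ * (‖Z t‖ * ‖Z t - A t‖) := by
        have h1 : inner ℝ (Z t) (A t) = ‖Z t‖ ^ 2 - inner ℝ (Z t) (Z t - A t) := by
          rw [inner_sub_right, real_inner_self_eq_norm_sq]; ring
        have h2 := mul_le_mul_of_nonneg_left (real_inner_le_norm (Z t) (Z t - A t)) hγ.le
        rw [h1]; linarith
      have b2 : -(μ * inner ℝ (Z t) (Pm m (A t))) ≤ μ * ‖Z t - A t‖ ^ 2 / 4 := by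
        have h1 : inner ℝ (Z t) (Pm m (A t)) = ‖Pm m (Z t)‖ ^ 2 - inner ℝ (Pm m (Z t)) (Z t - A t) := by
          have e1 : inner ℝ (Pm m (Z t)) (Z t) = ‖Pm m (Z t)‖ ^ 2 := by
            rw [← real_inner_self_eq_norm_sq, real_inner_Pm_left m (Z t) (Pm m _), Pm_Pm,
              real_inner_Pm_left]
          rw [inner_sub_right, e1, real_inner_Pm_left m (Z t) (A t)]; ring
        have h2 := real_inner_le_norm (Pm m (Z t)) (Z t - A t)
        have h3 : -inner ℝ (Z t) (Pm m (A t)) ≤ ‖Z t - A t‖ ^ 2 / 4 := by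
          rw [h1]
          nlinarith [sq_nonneg (‖Pm m (Z t)‖ - ‖Z t - A t‖ / 2)]
        have := mul_le_mul_of_nonneg_left h3 hμ
        linarith
      have b3 : -inner ℝ (Z t) (cubicDeriv (w t) (damp γ μ m (w t)))
          ≤ 3 * ‖rep (w t)‖ ^ 2 * ((γ + μ) * R) * ‖Z t‖ := by
        refine (neg_le_abs _).trans ((abs_real_inner_le_norm _ _).trans ?_)
        rw [mul_comm]
        gcongr
        exact (norm_cubicDeriv_le _ _).trans (by gcongr)
      have b4 : -(μ * inner ℝ (Z t) (Complex.I • deriv v t)) ≤ μ * V * ‖Z t‖ := by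
        have h1 := (neg_le_abs _).trans (abs_real_inner_I_smul_le (Z t) (deriv v t))
        have h2 : ‖Z t‖ * ‖deriv v t‖ ≤ ‖Z t‖ * V := by gcongr; exact hv.norm_deriv_le t
        have := mul_le_mul_of_nonneg_left (h1.trans h2) hμ
        linarith
      have b5 : -inner ℝ (Z t) (Complex.I • sqConj (w t) (Z t - A t))
          ≤ ‖rep (w t)‖ ^ 2 * ‖Z t - A t‖ * ‖Z t‖ := by
        refine (neg_le_abs _).trans ((abs_real_inner_I_smul_le _ _).trans ?_)
        rw [mul_comm]
        gcongr
        exact norm_sqConj_le _ _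
      have b6 : inner ℝ (damp γ μ m (w t)) (sqConj (w t) (A t))
          ≤ ‖rep (w t)‖ ^ 2 * ((γ + μ) * R) * ‖A t‖ := by
        refine (real_inner_le_norm _ _).trans ?_
        calc ‖damp γ μ m (w t)‖ * ‖sqConj (w t) (A t)‖
            ≤ ((γ + μ) * R) * (‖rep (w t)‖ ^ 2 * ‖A t‖) := by
              gcongr; exact norm_sqConj_le _ _
          _ = _ := by ring
      have b7 : inner ℝ (deriv w t) (corrGradLow (w t))
          ≤ (‖Z t‖ + (γ + μ) * R) * ‖corrGradLow (w t)‖ := by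
        refine (real_inner_le_norm _ _).trans ?_
        gcongr
        rw [hw.deriv_eq t]
        refine (norm_sub_le _ _).trans ?_
        rw [norm_smul, Complex.norm_I, one_mul]
        exact add_le_add le_rfl hdamp
      have b8 := mul_le_mul_of_nonneg_left (le_of_abs_le (hcorr t)) hγ.le
      simp only [energyTwo]
      change _ + γ * (1 / 2 * (‖Z t‖ ^ 2 + corr (w t))) ≤ _
      change -γ * inner ℝ (Z t) (A t) - μ * inner ℝ (Z t) (Pm m (A t))
        - inner ℝ (Z t) (cubicDeriv (w t) (damp γ μ m (w t)))
        - μ * inner ℝ (Z t) (Complex.I • deriv v t)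
        - inner ℝ (Z t) (Complex.I • sqConj (w t) (Z t - A t))
        + inner ℝ (damp γ μ m (w t)) (sqConj (w t) (A t))
        + 1 / 2 * inner ℝ (deriv w t) (corrGradLow (w t)) + _ ≤ _
      change _ ≤ -(1 / 2) * γ * ‖Z t‖ ^ 2 + _ at hbal
      change -γ * ‖Z t‖ ^ 2 + γ * (‖Z t‖ * ‖Z t - A t‖) + μ * ‖Z t - A t‖ ^ 2 / 4
        + 3 * ‖rep (w t)‖ ^ 2 * ((γ + μ) * R) * ‖Z t‖ + μ * V * ‖Z t‖
        + ‖rep (w t)‖ ^ 2 * ‖Z t - A t‖ * ‖Z t‖ + ‖rep (w t)‖ ^ 2 * ((γ + μ) * R) * ‖A t‖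
        + 1 / 2 * (‖Z t‖ + (γ + μ) * R) * ‖corrGradLow (w t)‖ ≤ _ at hbal
      linarith
  have e1 : (100000 * κ ^ 4 * K6Of 1 γ F V μ R S + 1 / 2 * γ * (κ * (R * S ^ 3))) / γ
      = 100000 * κ ^ 4 * (K6Of 1 γ F V μ R S / γ) + 1 / 2 * (κ * (R * S ^ 3)) := by
    field_simp
  rw [e1] at hΨ
  unfold energyTwo at hΨ
  have h1 := neg_le_of_abs_le (hcorr s)
  have h2 : ‖A s‖ ^ 2 ≤ 2 * ‖Z s‖ ^ 2 + 2 * ‖Z s - A s‖ ^ 2 := by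
    calc ‖A s‖ ^ 2 ≤ (‖Z s‖ + ‖Z s - A s‖) ^ 2 := by gcongr; exact hy s
      _ ≤ _ := by nlinarith [sq_nonneg (‖Z s‖ - ‖Z s - A s‖)]
  have h3 := hG2 s
  have h4 : (R ^ 2 * S) ^ 2 ≤ K6Of 1 γ F V μ R S / γ := by
    rw [le_div_iff₀ hγ, mul_comm, K6Of_one_eq hR0]
    have i2 := sq_le_K5_term hγ hμ hR0 hS0 hV hF0
    have i3 : 0 ≤ 2 * ((R * S ^ 4) ^ 2 / γ ^ 3)
      + (R * S * (R ^ 2 * S + (γ + μ) * R + μ * V + F)) ^ 2 / γ + (μ * V) ^ 2 / γ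
      + γ * (μ * V) ^ 2 + γ * F ^ 2 + μ * (R ^ 2 * S) ^ 2 + μ * F ^ 2 + μ * (μ * V) ^ 2 := by
      positivity
    linarith
  have hk : 0 ≤ K6Of 1 γ F V μ R S / γ := (sq_nonneg _).trans h4
  have e7 : K7Of 1 F V μ R S = R * S ^ 3 + F ^ 2 + (μ * V) ^ 2 := by unfold K7Of; ring
  rw [e7, mul_div_assoc]
  generalize K6Of 1 γ F V μ R S / γ = X at *
  have hk2 : κ ^ 2 * (R ^ 2 * S) ^ 2 ≤ κ ^ 2 * X := by gcongr
  have hκ2 : 4 ≤ κ ^ 2 := by nlinarith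
  have hκ4 : 4 * κ ^ 2 ≤ κ ^ 4 := by nlinarith [sq_nonneg κ]
  have hκ1 : κ ≤ κ ^ 4 := by nlinarith
  have hκ0 : 16 ≤ κ ^ 4 := by linarith
  have q1 : 0 ≤ R * S ^ 3 := by positivity
  have m1 := mul_le_mul_of_nonneg_right hκ4 hk
  have m2 := mul_le_mul_of_nonneg_right hκ1 q1
  have m3 := mul_le_mul_of_nonneg_right hκ0 (sq_nonneg F)
  have m4 := mul_le_mul_of_nonneg_right hκ0 (sq_nonneg (μ * V))
  have m5 : 0 ≤ κ ^ 4 * X := by positivity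
  have m6 : 0 ≤ κ ^ 4 * (R * S ^ 3) := by positivity
  change ‖A s‖ ^ 2 ≤ _
  change 1 / 2 * (‖Z s‖ ^ 2 + corr (w s)) ≤ _ at hΨ
  linarith [sq_nonneg F, sq_nonneg (μ * V)]

end Bounds

/-! ### Growth of the bounds in `μ` -/

lemma R0_le {γ μ F V : ℝ} (hγ : 0 < γ) (hμ : 0 ≤ μ) (hF : 0 ≤ F) (hV : 0 ≤ V) :
    R0 γ F V μ ≤ F / γ + V + 1 := by
  have hγμ : 0 < γ + μ := by linarith
  have h1 : √(μ / (γ + μ)) ≤ 1 :=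
    Real.sqrt_le_one.mpr ((div_le_one hγμ).mpr (by linarith))
  have h2 : γ ≤ √(γ * (γ + μ)) := Real.le_sqrt_of_sq_le (by nlinarith)
  unfold R0
  gcongr
  exact mul_le_of_le_one_left hV h1

lemma K2_le {c μ F V r R : ℝ} (hc : 0 ≤ c) (hμ : 1 ≤ μ) (hF : 0 ≤ F) (hV : 0 ≤ V)
    (hR0 : 0 ≤ R) (hR : R ≤ r) :
    K2Of (1 / 3) c F V μ R ≤ K2Of (1 / 3) c F V 1 r * μ := by
  have hr : 0 ≤ r := hR0.trans hR
  have h1 : K2Of (1 / 3) c F V μ R ≤ K2Of (1 / 3) c F V μ r := by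
    unfold K2Of
    have : (0 : ℝ) ≤ 1 - 1 / 3 := by norm_num
    gcongr
  refine h1.trans ?_
  have h2 : 0 ≤ c ^ 2 * r ^ 6 / (16 * (1 / 3)) + 1 / 2 * c * r ^ 4 + 2 * F * r + 2 / 3 * r ^ 2 := by
    positivity
  have h3 := mul_le_mul_of_nonneg_left hμ h2
  unfold K2Of
  linarith

lemma K1_le {c γ μ F V r : ℝ} (hγ : 0 < γ) (hμ : 1 ≤ μ) (hF : 0 ≤ F) (hV : 0 ≤ V)
    (hR : R0 γ F V μ ≤ r) :
    K1 c γ F V μ ≤ (6 * γ * F * r + 6 * γ * V * r + (c ^ 2 * r ^ 6 + r ^ 2) + 2 + 2 * F * r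
      + 2 * V * r) * μ := by
  have hR0 := R0_nonneg (γ := γ) (μ := μ) hF hV
  have hr : 0 ≤ r := hR0.trans hR
  have hμ0 : 0 ≤ μ := by linarith
  have h1 : K1 c γ F V μ ≤ 6 * γ * F * r + 6 * μ * γ * V * r + μ * (c ^ 2 * r ^ 6 + r ^ 2) + 2 * μ
      + 2 * μ * F * r + 2 * μ * V * r := by
    unfold K1
    gcongr
  have h3 := mul_le_mul_of_nonneg_left hμ (by positivity : 0 ≤ 6 * γ * F * r)
  linarith

lemma exists_R1_le {c γ F V : ℝ} (hc : 0 ≤ c) (hγ : 0 < γ) (hF : 0 ≤ F) (hV : 0 ≤ V) :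
    ∃ D, 0 ≤ D ∧ ∀ μ, 1 ≤ μ → R1 c γ F V μ ≤ D * √μ := by
  set r := F / γ + V + 1
  have hr : 0 ≤ r := by positivity
  set C1 := 6 * γ * F * r + 6 * γ * V * r + (c ^ 2 * r ^ 6 + r ^ 2) + 2 + 2 * F * r + 2 * V * r
  have hC1 : 0 ≤ C1 := by positivity
  have hC2 : 0 ≤ K2Of (1 / 3) c F V 1 r := by
    unfold K2Of
    have : (0 : ℝ) ≤ 1 - 1 / 3 := by norm_num
    positivity
  set C2 := K2Of (1 / 3) c F V 1 r
  refine ⟨√((3 / 2 + 6 * γ) * C2 + C1), Real.sqrt_nonneg _, fun μ hμ => ?_⟩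
  have hμ0 : 0 < μ := by linarith
  rw [← Real.sqrt_mul (by positivity)]
  unfold R1
  apply Real.sqrt_le_sqrt
  have hR := R0_le hγ hμ0.le hF hV
  have h1 : K1 c γ F V μ ≤ C1 * μ := K1_le hγ hμ hF hV hR
  have h2 : K2 c γ F V μ ≤ C2 * μ := K2_le hc hμ hF hV (R0_nonneg hF hV) hR
  rw [div_le_iff₀ (by linarith)]
  have h3 : (3 / 2 * μ + 6 * γ) * K2 c γ F V μ ≤ (3 / 2 * μ + 6 * γ) * (C2 * μ) := by gcongr
  have h4 : 0 ≤ (9 / 2 * γ) * (C2 * μ) := by positivity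
  have h5 : γ * (C2 * μ) ≤ μ * γ * (C2 * μ) := by
    gcongr
    exact le_mul_of_one_le_left hγ.le hμ
  have h6 : C1 * μ ≤ C1 * μ * μ := le_mul_of_one_le_right (by positivity) hμ
  have h7 : 0 ≤ C1 * μ * γ := by positivity
  have h8 : 0 ≤ γ * γ * (C2 * μ) := by positivity
  have h9 : 0 ≤ γ * μ * (C2 * μ) := by positivity
  linarith

/-- In the regime `μ = t²`, `S = D t`, each term of `K6Of` grows at most like `t⁸ = μ⁴`. -/
lemma K6Of_le {c γ F V t r D : ℝ} (hc : 0 ≤ c) (hγ : 0 < γ) (hF : 0 ≤ F) (hV : 0 ≤ V) (ht : 1 ≤ t)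
    (hr : 0 ≤ r) (hD : 0 ≤ D) :
    K6Of c γ F V (t ^ 2) r (D * t) ≤ K6Of c γ F V 1 r D * t ^ 8 := by
  have ht0 : 0 ≤ t := by linarith
  have hpow : ∀ {n : ℕ} {x : ℝ}, n ≤ 8 → 0 ≤ x → x * t ^ n ≤ x * t ^ 8 := fun hn hx =>
    mul_le_mul_of_nonneg_left (pow_le_pow_right₀ ht hn) hx
  have h5 : K5Of c γ F V (t ^ 2) r (D * t) ≤ K5Of c γ F V 1 r D * t ^ 8 := by
    have e : r * (D * t) * (r ^ 2 * (D * t) + (γ + t ^ 2) * r + t ^ 2 * V + F)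
        ≤ t ^ 3 * (r * D * (r ^ 2 * D + (γ + 1) * r + 1 * V + F)) := by
      have h1 : 1 ≤ t ^ 2 := one_le_pow₀ ht
      have h2 : t ≤ t ^ 2 := by rw [pow_two]; exact le_mul_of_one_le_left ht0 ht
      have h3 : r ^ 2 * (D * t) + (γ + t ^ 2) * r + t ^ 2 * V + F
          ≤ t ^ 2 * (r ^ 2 * D + (γ + 1) * r + 1 * V + F) := by
        have i1 : r ^ 2 * D * t ≤ r ^ 2 * D * t ^ 2 := by gcongr
        have i2 : γ * r * 1 ≤ γ * r * t ^ 2 := by gcongr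
        have i3 : F * 1 ≤ F * t ^ 2 := by gcongr
        linarith
      calc _ ≤ r * (D * t) * (t ^ 2 * (r ^ 2 * D + (γ + 1) * r + 1 * V + F)) := by gcongr
        _ = _ := by ring
    have e2 : (r * (D * t) * (r ^ 2 * (D * t) + (γ + t ^ 2) * r + t ^ 2 * V + F)) ^ 2
        ≤ (t ^ 3 * (r * D * (r ^ 2 * D + (γ + 1) * r + 1 * V + F))) ^ 2 := by gcongr
    have e3 := hpow (n := 6) (x := c * (r * D * (r ^ 2 * D + (γ + 1) * r + 1 * V + F)) ^ 2 / γ)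
      (by norm_num) (by positivity)
    have e4 : c * (r * (D * t) * (r ^ 2 * (D * t) + (γ + t ^ 2) * r + t ^ 2 * V + F)) ^ 2 / γ
        ≤ c * (t ^ 3 * (r * D * (r ^ 2 * D + (γ + 1) * r + 1 * V + F))) ^ 2 / γ := by gcongr
    have e5 : c * (t ^ 3 * (r * D * (r ^ 2 * D + (γ + 1) * r + 1 * V + F))) ^ 2 / γ
        = c * (r * D * (r ^ 2 * D + (γ + 1) * r + 1 * V + F)) ^ 2 / γ * t ^ 6 := by ring
    have e6 : c * (√r * (D * t) ^ 2) ^ 4 / γ ^ 3 = c * (√r * D ^ 2) ^ 4 / γ ^ 3 * t ^ 8 := by ring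
    unfold K5Of
    rw [e6, add_mul (c * (√r * D ^ 2) ^ 4 / γ ^ 3)]
    exact add_le_add le_rfl (e4.trans (e5.le.trans e3) |>.trans_eq (by norm_num))
  have g1 := hpow (n := 4) (x := c * V ^ 2 / γ) (by norm_num) (by positivity)
  have g2 := hpow (n := 4) (x := c * γ * V ^ 2) (by norm_num) (by positivity)
  have g3 := hpow (n := 0) (x := c * γ * F ^ 2) (by norm_num) (by positivity)
  have g4 := hpow (n := 4) (x := c * (r ^ 2 * D) ^ 2) (by norm_num) (by positivity)
  have g5 := hpow (n := 2) (x := c * F ^ 2) (by norm_num) (by positivity)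
  have g6 := hpow (n := 6) (x := c * V ^ 2) (by norm_num) (by positivity)
  have e1 : c * (t ^ 2) ^ 2 * V ^ 2 / γ = c * V ^ 2 / γ * t ^ 4 := by ring
  have e2 : c * 1 ^ 2 * V ^ 2 / γ = c * V ^ 2 / γ := by ring
  unfold K6Of
  rw [e1, e2]
  linarith

lemma K7Of_le {c F V t r D : ℝ} (hc : 0 ≤ c) (ht : 1 ≤ t) (hr : 0 ≤ r) (hD : 0 ≤ D) :
    K7Of c F V (t ^ 2) r (D * t) ≤ K7Of c F V 1 r D * t ^ 8 := by
  have hpow : ∀ {n : ℕ} {x : ℝ}, n ≤ 8 → 0 ≤ x → x * t ^ n ≤ x * t ^ 8 := fun hn hx =>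
    mul_le_mul_of_nonneg_left (pow_le_pow_right₀ ht hn) hx
  have g1 := hpow (n := 3) (x := c * (r * D ^ 3)) (by norm_num) (by positivity)
  have g2 := hpow (n := 0) (x := c * F ^ 2) (by norm_num) (by positivity)
  have g3 := hpow (n := 4) (x := c * V ^ 2) (by norm_num) (by positivity)
  unfold K7Of
  linarith

lemma K6Of_nonneg {c γ F V μ R S : ℝ} (hc : 0 ≤ c) (hγ : 0 < γ) (hμ : 0 ≤ μ) :
    0 ≤ K6Of c γ F V μ R S := by
  unfold K6Of K5Of; positivity

lemma K7Of_nonneg {c F V μ R S : ℝ} (hc : 0 ≤ c) (hR : 0 ≤ R) (hS : 0 ≤ S) :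
    0 ≤ K7Of c F V μ R S := by
  unfold K7Of; positivity

lemma R2Of_mono {c γ F V μ R S R' S' : ℝ} (hc : 0 ≤ c) (hγ : 0 < γ) (hμ : 0 ≤ μ) (hF : 0 ≤ F)
    (hV : 0 ≤ V) (hR : 0 ≤ R) (hS : 0 ≤ S) (hRR : R ≤ R') (hSS : S ≤ S') :
    R2Of c γ F V μ R S ≤ R2Of c γ F V μ R' S' := by
  have hR' := hR.trans hRR
  have hS' := hS.trans hSS
  have hRS : 0 ≤ R' * S' := mul_nonneg hR' hS'
  unfold R2Of K6Of K7Of K5Of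
  gcongr

lemma exists_R2_le {c γ F V : ℝ} (hc : 0 ≤ c) (hγ : 0 < γ) (hF : 0 ≤ F) (hV : 0 ≤ V) :
    ∃ C, 0 ≤ C ∧ ∀ μ, 1 ≤ μ → R2 c γ F V μ ≤ C * μ ^ 2 := by
  obtain ⟨D, hD, hR1⟩ := exists_R1_le hc hγ hF hV
  set r := F / γ + V + 1
  have hr : 0 ≤ r := by positivity
  have hK6 := K6Of_nonneg (F := F) (V := V) (R := r) (S := D) hc hγ zero_le_one
  have hK7 := K7Of_nonneg (F := F) (V := V) (μ := 1) hc hr hD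
  refine ⟨√(4 * K6Of c γ F V 1 r D / γ + 4 * K7Of c F V 1 r D) + r, by positivity, fun μ hμ => ?_⟩
  have hμ0 : 0 ≤ μ := by linarith
  have ht : 1 ≤ √μ := Real.one_le_sqrt.mpr hμ
  have hμt : √μ ^ 2 = μ := Real.sq_sqrt hμ0
  have h1 : R2 c γ F V μ ≤ R2Of c γ F V μ r (D * √μ) :=
    R2Of_mono hc hγ hμ0 hF hV (R0_nonneg hF hV) (Real.sqrt_nonneg _) (R0_le hγ hμ0 hF hV) (hR1 μ hμ)
  refine h1.trans ?_
  have h6 := K6Of_le hc hγ hF hV ht hr hD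
  have h7 := K7Of_le (F := F) (V := V) hc ht hr hD
  have h8 : √μ ^ 8 = (μ ^ 2) ^ 2 := by
    rw [← pow_mul, show √μ ^ 8 = (√μ ^ 2) ^ 4 by ring, hμt]
  rw [hμt, h8] at h6 h7
  unfold R2Of
  rw [add_mul]
  have h9 : √(4 * K6Of c γ F V μ r (D * √μ) / γ + 4 * K7Of c F V μ r (D * √μ))
      ≤ √(4 * K6Of c γ F V 1 r D / γ + 4 * K7Of c F V 1 r D) * μ ^ 2 := by
    rw [← Real.sqrt_sq (sq_nonneg μ), ← Real.sqrt_mul (by positivity)]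
    apply Real.sqrt_le_sqrt
    have : 4 * K6Of c γ F V μ r (D * √μ) / γ ≤ 4 * (K6Of c γ F V 1 r D * (μ ^ 2) ^ 2) / γ := by gcongr
    have e : 4 * (K6Of c γ F V 1 r D * (μ ^ 2) ^ 2) / γ = 4 * K6Of c γ F V 1 r D / γ * (μ ^ 2) ^ 2 := by
      ring
    rw [add_mul]
    linarith
  have h10 : r ≤ r * μ ^ 2 := le_mul_of_one_le_right hr (one_le_pow₀ hμ)
  linarith

lemma exists_R'_le {c γ F V : ℝ} (hc : 0 ≤ c) (hγ : 0 < γ) (hF : 0 ≤ F) (hV : 0 ≤ V) :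
    ∃ C, 0 ≤ C ∧ ∀ μ, 1 ≤ μ → R' c γ F V μ ≤ C * μ ^ 2 := by
  obtain ⟨D, hD, hR1⟩ := exists_R1_le hc hγ hF hV
  obtain ⟨C, hC, hR2⟩ := exists_R2_le hc hγ hF hV
  set r := F / γ + V + 1
  have hr : 0 ≤ r := by positivity
  refine ⟨C + c * r ^ 2 * D + (γ + 1) * r + F + V, by positivity, fun μ hμ => ?_⟩
  have hμ0 : 0 ≤ μ := by linarith
  have h1 := hR1 μ hμ
  have h2 := hR2 μ hμ
  have h3 : R0 γ F V μ ≤ r := R0_le hγ hμ0 hF hV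
  have h0 := R0_nonneg (γ := γ) (μ := μ) hF hV
  have hR10 : 0 ≤ R1 c γ F V μ := Real.sqrt_nonneg _
  have hμ2 : μ ≤ μ ^ 2 := by rw [pow_two]; exact le_mul_of_one_le_left hμ0 hμ
  have hsq : √μ ≤ μ ^ 2 := by
    refine le_trans ?_ hμ2
    exact Real.sqrt_le_iff.mpr ⟨hμ0, hμ2⟩
  have h4 : c * R0 γ F V μ ^ 2 * R1 c γ F V μ ≤ c * r ^ 2 * (D * μ ^ 2) := by
    gcongr
    exact h1.trans (by gcongr)
  have h5 : (γ + μ) * R0 γ F V μ ≤ (γ * μ ^ 2 + μ ^ 2) * r := by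
    gcongr
    exact le_mul_of_one_le_right hγ.le (one_le_pow₀ hμ)
  have h6 : F ≤ F * μ ^ 2 := le_mul_of_one_le_right hF (one_le_pow₀ hμ)
  have h7 : μ * V ≤ μ ^ 2 * V := by gcongr
  unfold R'
  linarith

lemma isBigO_of_le {f g : ℝ → ℝ} {C : ℝ} (hf : ∀ μ, 1 ≤ μ → 0 ≤ f μ) (hg : ∀ μ, 1 ≤ μ → 0 ≤ g μ)
    (h : ∀ μ, 1 ≤ μ → f μ ≤ C * g μ) : f =O[atTop] g := by
  refine IsBigO.of_bound C ?_
  filter_upwards [eventually_ge_atTop 1] with μ hμ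
  rw [Real.norm_of_nonneg (hf μ hμ), Real.norm_of_nonneg (hg μ hμ)]
  exact h μ hμ

/-- The growth of the bounds as `μ → ∞`. -/
lemma isBigO_bounds {c γ F V : ℝ} (hc : 0 ≤ c) (hγ : 0 < γ) (hF : 0 ≤ F) (hV : 0 ≤ V) :
    (fun μ : ℝ => R0 γ F V μ) =O[atTop] (fun _ : ℝ => (1 : ℝ)) ∧
    (fun μ : ℝ => R1 c γ F V μ) =O[atTop] (fun μ : ℝ => μ ^ (1 / 2 : ℝ)) ∧
    (fun μ : ℝ => R2 c γ F V μ) =O[atTop] (fun μ : ℝ => μ ^ 2) ∧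
    (fun μ : ℝ => R' c γ F V μ) =O[atTop] (fun μ : ℝ => μ ^ 2) := by
  obtain ⟨D, hD, hR1⟩ := exists_R1_le hc hγ hF hV
  obtain ⟨C, hC, hR2⟩ := exists_R2_le hc hγ hF hV
  obtain ⟨C', hC', hR'⟩ := exists_R'_le hc hγ hF hV
  have hR0 : ∀ μ : ℝ, 0 ≤ R0 γ F V μ := fun μ => R0_nonneg hF hV
  have hR20 : ∀ μ : ℝ, 0 ≤ R2 c γ F V μ := fun μ => add_nonneg (Real.sqrt_nonneg _) (hR0 μ)
  refine ⟨isBigO_of_le (C := F / γ + V + 1) (fun μ _ => hR0 μ) (fun _ _ => zero_le_one) fun μ hμ => ?_,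
    isBigO_of_le (C := D) (fun μ _ => Real.sqrt_nonneg _) (fun μ hμ => by positivity) fun μ hμ => ?_,
    isBigO_of_le (C := C) (fun μ _ => hR20 μ) (fun μ _ => sq_nonneg μ) hR2,
    isBigO_of_le (C := C') (fun μ hμ => ?_) (fun μ _ => sq_nonneg μ) hR'⟩
  · rw [mul_one]
    exact R0_le hγ (by linarith) hF hV
  · rw [← Real.sqrt_eq_rpow]
    exact hR1 μ hμ
  · have h1 : 0 ≤ R1 c γ F V μ := Real.sqrt_nonneg _
    have h2 := hR20 μ
    have h3 := hR0 μ
    have hμ0 : 0 ≤ μ := by linarith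
    unfold R'
    positivity

/-! ### The bootstrap -/

section Conclusion

variable {γ μ : ℝ} {m : ℕ} {f : L2per L} {v w : ℝ → L2per L}

/-- The constant `200000 (1/L + 2)⁴` of the `H²` estimate, enlarged by a factor that makes the
high modes of `w` and `w_x` small once `R2Tilde * L / (2 π (m + 1)) ≤ 1`. -/
def estConst (L : ℝ) : ℝ := (6 + 6 * L ^ 2) * (200000 * (1 / L + 2) ^ 4)

lemma le_estConst (hL0 : 0 < L) : 3 * (1 / L) + 6 ≤ estConst L := by
  have hβ : 0 < 1 / L := by positivity
  unfold estConst
  have h1 : (1 / L + 2) ^ 1 ≤ (1 / L + 2) ^ 4 := pow_le_pow_right₀ (by linarith) (by norm_num)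
  have h2 : 0 ≤ L ^ 2 * (200000 * (1 / L + 2) ^ 4) := by positivity
  linarith

/-- The `H²` bound in terms of `estConst`; the margin `6 + 6 L²` is kept for the high modes. -/
lemma IsBoundedSolution.mul_norm_sq_le (hw : IsBoundedSolution γ μ m f v w)
    (hv : MemX m v) (hγ : 0 < γ) (hμ : 0 ≤ μ) {R S : ℝ} (hR : ∀ s, ‖w s‖ ≤ R)
    (hS : ∀ s, h1Norm (w s) ≤ S) (s : ℝ) :
    (6 + 6 * L ^ 2) * ‖weakDeriv (weakDeriv (w s))‖ ^ 2 ≤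
      4 * K6Of (estConst L) γ ‖f‖ (xNorm v) μ R S / γ + 4 * K7Of (estConst L) ‖f‖ (xNorm v) μ R S := by
  have h := hw.norm_weakDeriv_weakDeriv_sq_le hv hγ hμ hR hS s
  have h2 := mul_le_mul_of_nonneg_left h (by positivity : 0 ≤ 6 + 6 * L ^ 2)
  refine h2.trans (le_of_eq ?_)
  have e6 : ∀ c, K6Of c γ ‖f‖ (xNorm v) μ R S = c * K6Of 1 γ ‖f‖ (xNorm v) μ R S := fun c => by
    unfold K6Of K5Of; ring
  have e7 : ∀ c, K7Of c ‖f‖ (xNorm v) μ R S = c * K7Of 1 ‖f‖ (xNorm v) μ R S := fun c => by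
    unfold K7Of; ring
  rw [e6 (estConst L), e7 (estConst L)]
  unfold estConst
  ring

lemma IsBoundedSolution.norm_weakDeriv_weakDeriv_add_le (hw : IsBoundedSolution γ μ m f v w)
    (hv : MemX m v) (hγ : 0 < γ) (hμ : 0 ≤ μ) {R S : ℝ} (hR : ∀ s, ‖w s‖ ≤ R)
    (hS : ∀ s, h1Norm (w s) ≤ S) (s : ℝ) :
    ‖weakDeriv (weakDeriv (w s))‖ + R ≤ R2Of (estConst L) γ ‖f‖ (xNorm v) μ R S := by
  have h := hw.mul_norm_sq_le hv hγ hμ hR hS s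
  unfold R2Of
  gcongr
  apply Real.le_sqrt_of_sq_le
  refine le_trans ?_ h
  apply le_mul_of_one_le_left (sq_nonneg _)
  nlinarith [sq_nonneg L]

lemma h2Norm_le_add (u : L2per L) : h2Norm u ≤ ‖weakDeriv (weakDeriv u)‖ + ‖u‖ := by
  unfold h2Norm
  rw [Real.sqrt_le_left (by positivity)]
  have : 0 ≤ ‖weakDeriv (weakDeriv u)‖ * ‖u‖ := by positivity
  linarith

lemma IsBoundedSolution.norm_deriv_le (hw : IsBoundedSolution γ μ m f v w)
    (hv : MemX m v) (hγ : 0 < γ) (hμ : 0 ≤ μ) {c R S T : ℝ} (hc : 1 / L + 2 ≤ c) (s : ℝ)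
    (hR : ‖w s‖ ≤ R) (hS : h1Norm (w s) ≤ S) (hT : ‖weakDeriv (weakDeriv (w s))‖ ≤ T) :
    ‖deriv w s‖ ≤ T + c * R ^ 2 * S + (γ + μ) * R + ‖f‖ + μ * xNorm v := by
  have hS0 : 0 ≤ S := (norm_nonneg _).trans ((norm_le_h1Norm _).trans hS)
  have h1 := norm_cubic_le_mul (hw.memY.memH2 s).isDeriv.1 hR hS
  have h2 : (1 / L + 2) * (R ^ 2 * S) ≤ c * (R ^ 2 * S) := by gcongr
  have h3 : ‖damp γ μ m (w s)‖ ≤ (γ + μ) * R := norm_damp_le hγ.le hμ hR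
  have h4 : ‖Complex.I • (μ • v s)‖ ≤ μ * xNorm v := by
    rw [norm_smul, norm_smul, Complex.norm_I, one_mul, Real.norm_of_nonneg hμ]
    gcongr; exact hv.norm_le s
  rw [hw.deriv_eq s]
  refine (norm_sub_le _ _).trans ?_
  rw [norm_smul, Complex.norm_I, one_mul]
  unfold resid
  have h5 := norm_sub_le (weakDeriv (weakDeriv (w s)) + cubic (w s) - f) (Complex.I • (μ • v s))
  have h6 := norm_sub_le (weakDeriv (weakDeriv (w s)) + cubic (w s)) f
  have h7 := norm_add_le (weakDeriv (weakDeriv (w s))) (cubic (w s))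
  linarith

/-- The bounds in `L²`, `H¹`, `H²`, and on the time derivative. -/
lemma IsBoundedSolution.bounds (hw : IsBoundedSolution γ μ m f v w)
    (hv : MemX m v) (hγ : 0 < γ) (hμ : 0 ≤ μ)
    (hm1 : R1TildeTilde (estConst L) γ ‖f‖ (xNorm v) μ * L / (2 * Real.pi * (m + 1)) ≤ 1)
    (hm2 : R2Tilde (estConst L) γ ‖f‖ (xNorm v) μ * L / (2 * Real.pi * (m + 1)) ≤ 1) (s : ℝ) :
    ‖w s‖ ≤ R0 γ ‖f‖ (xNorm v) μ ∧
      h1Norm (w s) ≤ R1 (estConst L) γ ‖f‖ (xNorm v) μ ∧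
      h2Norm (w s) ≤ R2 (estConst L) γ ‖f‖ (xNorm v) μ ∧
      ‖deriv w s‖ ≤ R' (estConst L) γ ‖f‖ (xNorm v) μ := by
  have hL0 := hL.out
  have hβ : 0 < 1 / L := by positivity
  have hπ := Real.pi_pos
  have hc := le_estConst hL0
  have hF := norm_nonneg f
  have hV := hv.xNorm_nonneg
  set ℓ := L / (2 * Real.pi * (m + 1)) with hℓ
  have hℓ0 : 0 ≤ ℓ := by positivity
  have hℓL : ℓ ≤ L := by
    apply div_le_self hL0.le
    have := Real.pi_gt_three
    have : (0 : ℝ) ≤ m := Nat.cast_nonneg m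
    nlinarith
  rw [mul_div_assoc, ← hℓ] at hm1 hm2
  have hH1 : ∀ t, h1Norm (w t) ≤ R1TildeTilde (estConst L) γ ‖f‖ (xNorm v) μ :=
    hw.h1Norm_le_R1Of hv hγ hμ (by linarith) (hw.norm_le_R0Tilde hv hγ hμ)
  have hQ1 : ∀ t, ‖w t - Pm m (w t)‖ ≤ 1 := fun t => by
    refine ((hw.memY.memH2 t).isDeriv.1.norm_sub_Pm_le m).trans (le_trans ?_ hm1)
    rw [mul_comm, ← hℓ]
    gcongr
    exact (norm_sub_Pm_le _ _).trans ((norm_weakDeriv_le_h1Norm _).trans (hH1 t))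
  have hR := hw.norm_le_R0 hv hγ hμ hQ1
  have hS : ∀ t, h1Norm (w t) ≤ R1Tilde (estConst L) γ ‖f‖ (xNorm v) μ :=
    hw.h1Norm_le_R1Of hv hγ hμ (by linarith) hR
  -- the high modes of `w_x` are small since the constant in `R2Tilde` is large
  have hQx : ∀ t, (6 + 6 * L ^ 2) * ‖weakDeriv (w t) - Pm m (weakDeriv (w t))‖ ^ 2 ≤ 1 := fun t => by
    have h1 := hw.mul_norm_sq_le hv hγ hμ hR hS t
    have h2 : ‖weakDeriv (w t) - Pm m (weakDeriv (w t))‖ ≤ ℓ * ‖weakDeriv (weakDeriv (w t))‖ :=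
      ((hw.memY.memH2 t).isDeriv.2.norm_sub_Pm_le m).trans
        (mul_le_mul_of_nonneg_left (norm_sub_Pm_le _ _) hℓ0)
    set X := 4 * K6Of (estConst L) γ ‖f‖ (xNorm v) μ (R0 γ ‖f‖ (xNorm v) μ)
        (R1Tilde (estConst L) γ ‖f‖ (xNorm v) μ) / γ
      + 4 * K7Of (estConst L) ‖f‖ (xNorm v) μ (R0 γ ‖f‖ (xNorm v) μ)
        (R1Tilde (estConst L) γ ‖f‖ (xNorm v) μ) with hX
    have hX0 : 0 ≤ X := le_trans (by positivity) h1
    have h3 : √X * ℓ ≤ 1 := by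
      refine le_trans ?_ hm2
      gcongr
      unfold R2Tilde R2Of
      exact le_add_of_nonneg_right (R0_nonneg hF hV)
    calc (6 + 6 * L ^ 2) * ‖weakDeriv (w t) - Pm m (weakDeriv (w t))‖ ^ 2
        ≤ (6 + 6 * L ^ 2) * (ℓ * ‖weakDeriv (weakDeriv (w t))‖) ^ 2 := by gcongr
      _ = ((6 + 6 * L ^ 2) * ‖weakDeriv (weakDeriv (w t))‖ ^ 2) * ℓ ^ 2 := by ring
      _ ≤ X * ℓ ^ 2 := by gcongr
      _ = (√X * ℓ) ^ 2 := by rw [mul_pow, Real.sq_sqrt hX0]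
      _ ≤ 1 := pow_le_one₀ (by positivity) h3
  have hQx' : ∀ t, ‖weakDeriv (w t) - Pm m (weakDeriv (w t))‖ ^ 2 ≤ 2 / 3 := fun t => by
    have h1 := hQx t
    have h2 : 0 ≤ L ^ 2 * ‖weakDeriv (w t) - Pm m (weakDeriv (w t))‖ ^ 2 := by positivity
    linarith
  have hQ : ∀ t, ‖w t - Pm m (w t)‖ ≤ 4 / 9 := fun t => by
    have h1 : ‖w t - Pm m (w t)‖ ≤ L * ‖weakDeriv (w t) - Pm m (weakDeriv (w t))‖ :=
      ((hw.memY.memH2 t).isDeriv.1.norm_sub_Pm_le m).trans (by gcongr)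
    refine h1.trans (le_of_sq_le_sq ?_ (by norm_num))
    have h2 := hQx t
    have h3 := sq_nonneg ‖weakDeriv (w t) - Pm m (weakDeriv (w t))‖
    rw [mul_pow]
    linarith
  have hS1 := hw.h1Norm_le_R1 hv hγ hμ (c := estConst L) (by linarith) hR hQ hQx'
  have hA : ‖weakDeriv (weakDeriv (w s))‖ + R0 γ ‖f‖ (xNorm v) μ
      ≤ R2 (estConst L) γ ‖f‖ (xNorm v) μ :=
    hw.norm_weakDeriv_weakDeriv_add_le hv hγ hμ hR hS1 s
  have hR00 := R0_nonneg (γ := γ) (μ := μ) hF hV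
  refine ⟨hR s, hS1 s, ?_, ?_⟩
  · exact (h2Norm_le_add (w s)).trans ((add_le_add le_rfl (hR s)).trans hA)
  · exact hw.norm_deriv_le hv hγ hμ (by linarith) s (hR s) (hS1 s) (by linarith)

end Conclusion

end

end NLS

theorem theorem4p2 (L : ℝ) [Fact (0 < L)] :
    ∃ c : ℝ, 0 < c ∧
      (∀ (γ μ : ℝ) (m : ℕ) (f : NLS.L2per L) (v w : ℝ → NLS.L2per L),
        0 < γ → 0 ≤ μ → NLS.MemX m v → NLS.IsBoundedSolution γ μ m f v w →
        max (NLS.R1TildeTilde c γ ‖f‖ (NLS.xNorm v) μ * L / (2 * Real.pi * (m + 1)))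
            (NLS.R2Tilde c γ ‖f‖ (NLS.xNorm v) μ * L / (2 * Real.pi * (m + 1))) ≤ 1 →
        ∀ s : ℝ,
          ‖w s‖ ≤ NLS.R0 γ ‖f‖ (NLS.xNorm v) μ ∧
          NLS.h1Norm (w s) ≤ NLS.R1 c γ ‖f‖ (NLS.xNorm v) μ ∧
          NLS.h2Norm (w s) ≤ NLS.R2 c γ ‖f‖ (NLS.xNorm v) μ ∧
          ‖deriv w s‖ ≤ NLS.R' c γ ‖f‖ (NLS.xNorm v) μ) ∧
      (∀ γ F V : ℝ, 0 < γ → 0 ≤ F → 0 ≤ V →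
        (fun μ : ℝ => NLS.R0 γ F V μ) =O[atTop] (fun _ : ℝ => (1 : ℝ)) ∧
        (fun μ : ℝ => NLS.R1 c γ F V μ) =O[atTop] (fun μ : ℝ => μ ^ (1 / 2 : ℝ)) ∧
        (fun μ : ℝ => NLS.R2 c γ F V μ) =O[atTop] (fun μ : ℝ => μ ^ 2) ∧
        (fun μ : ℝ => NLS.R' c γ F V μ) =O[atTop] (fun μ : ℝ => μ ^ 2)) := by
  have hL0 : 0 < L := Fact.out
  have hc : 0 < NLS.estConst L := by unfold NLS.estConst; positivity
  refine ⟨NLS.estConst L, hc, ?_, fun γ F V hγ hF hV => NLS.isBigO_bounds hc.le hγ hF hV⟩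
  intro γ μ m f v w hγ hμ hv hw hm s
  exact hw.bounds hv hγ hμ ((le_max_left _ _).trans hm) ((le_max_right _ _).trans hm) s
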